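/- Let $H$ be a complex Hilbert space with inner product $(\cdot,\cdot)$ (linear in the first argument), let $V\subset H$ be a dense subspace and let $a\colon V\times V\to\mathbb{C}$ be a closed Hermitian positive-definite sesquilinear form, with energy norm $\|u\|_V=a(u,u)^{1/2}$. Let $A$ be the selfadjoint operator in $H$ associated with $a$, and assume that $A$ has a sequence of eigenpairs $(\mu_k,\psi_k)$, $k=1,2,\dots$, whose eigenvectors $\psi_k$ form an orthonormal basis of $H$. Let $b$ be a sesquilinear form whose domain $D(b)\subset V$ is a subspace containing all $\psi_k$. Assume: (i) (eigenvalue separation) there are $\gamma>0$, $\kappa>0$ and $N_0$ with $\mu_{k+1}-\mu_k\ge\kappa k^{\gamma-1}$ for all $k\ge N_0$; (ii) (local form-subordination) there are $\alpha\in\mathbb{R}$ and $M_b>0$ with $|b(\psi_m,\psi_n)|\le M_b\,m^{-\alpha}n^{-\alpha}$ for all $m,n\ge1$; (iii) $2\alpha+\gamma>3/2$ if $\alpha\le1$, and $2\alpha+\gamma>1$ if $\alpha>1$. Then the restriction of $b$ to $\operatorname{span}\{\psi_k\}$ extends uniquely to a sesquilinear form on $V$ that is bounded with respect to $\|\cdot\|_V$;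 the extension, again denoted by $b$, agrees with the given form on all of $D(b)$ if the latter is bounded with respect to $\|\cdot\|_V$. Let $T$ be the operator in $H$ associated with the form $t=a+b$ on $V$, that is, $u\in D(T)$ and $Tu=f$ if and only if $u\in V$, $f\in H$ and $a(u,v)+b(u,v)=(f,v)$ for all $v\in V$. For $n\ge1$ let $$\Pi_n=\{z\in\mathbb{C}:\ \mu_n-\tfrac{\kappa}{2}(n-1)^{\gamma-1}<\operatorname{Re}z<\mu_n+\tfrac{\kappa}{2}n^{\gamma-1},\ |\operatorname{Im}z|<\tfrac{\kappa}{2}n^{\gamma-1}\}.$$ Call $(\lambda_n,\phi_n)_{n\ge1}$ a perturbed root system if - the spectrum of $T$ is $\{\lambda_n : n\ge1\}$, and each value occurs only finitely often among the $\lambda_n$; - for each $m$, the vectors $\phi_n$ with $\lambda_n=\lambda_m$ form a basis of the root space $\bigcup_k\ker(T-\lambda_m)^k$; - each $\phi_n$ is either an eigenvector of $T$ for $\lambda_n$, or satisfies $n\ge2$ and $(T-\lambda_n)\phi_n=\phi_{n-1}$; - for all sufficiently large $n$, $\partial\Pi_n$ lies in the resolvent set of $T$, $\lambda_n$ is the only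 point of the spectrum of $T$ in $\Pi_n$, it has algebraic multiplicity one, and $\phi_n=\frac{1}{2\pi i}\oint_{\partial\Pi_n}(z-T)^{-1}\psi_n\,dz$ (counterclockwise). Then a perturbed root system exists, and for every perturbed root system $(\lambda_n,\phi_n)_{n\ge1}$ the sequence $\{\phi_n\}$ is quadratically close to $\{\psi_n\}$ in $H$: $$\sum_{n=1}^\infty\|\psi_n-\phi_n\|^2<\infty .$$ -/

import Mathlib

open scoped ComplexConjugate

noncomputable section

namespace FormPerturbation

variable {H : Type*} [NormedAddCommGroup H] [InnerProductSpace ℂ H]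

/-! Sesquilinear forms are linear in the first and conjugate-linear in the second argument; the
scalar product `(u, v)` of `H` in this convention is `inner ℂ v u`. -/

/-- A Hermitian positive-definite form `a` with form domain `V`. -/
structure IsHermitianPosDef {V : Submodule ℂ H} (a : V →ₗ[ℂ] V →ₗ⋆[ℂ] ℂ) : Prop where
  hermitian : ∀ u v, a v u = conj (a u v)
  pos : ∀ u, u ≠ 0 → 0 < (a u u).re

/-- A nonnegative form `a` with form domain `V` is closed: if `uₖ ∈ V` converges to `x` in `H` and
`a(uₖ - uₗ, uₖ - uₗ) → 0` as `k, l → ∞`, then `x ∈ V` and `a(uₖ - x, uₖ - x) → 0`. -/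
def IsClosedForm {V : Submodule ℂ H} (a : V →ₗ[ℂ] V →ₗ⋆[ℂ] ℂ) : Prop :=
  ∀ (u : ℕ → V) (x : H),
    Filter.Tendsto (fun k => (u k : H)) Filter.atTop (nhds x) →
    Filter.Tendsto (fun p : ℕ × ℕ => (a (u p.1 - u p.2) (u p.1 - u p.2)).re)
      Filter.atTop (nhds 0) →
    ∃ hx : x ∈ V,
      Filter.Tendsto (fun k => (a (u k - ⟨x, hx⟩) (u k - ⟨x, hx⟩)).re) Filter.atTop (nhds 0)

/-- The energy norm `‖u‖_V = a(u,u)^{1/2}`. -/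
def energyNorm {V : Submodule ℂ H} (a : V →ₗ[ℂ] V →ₗ⋆[ℂ] ℂ) (u : V) : ℝ :=
  Real.sqrt (a u u).re

/-- The form `b`, with domain `D ⊆ V`, is bounded with respect to the energy norm of `a`. -/
def IsEnergyBounded {V D : Submodule ℂ H} (a : V →ₗ[ℂ] V →ₗ⋆[ℂ] ℂ) (hDV : D ≤ V)
    (b : D →ₗ[ℂ] D →ₗ⋆[ℂ] ℂ) : Prop :=
  ∃ C : ℝ, ∀ u v : D, ‖b u v‖ ≤
    C * energyNorm a (Submodule.inclusion hDV u) * energyNorm a (Submodule.inclusion hDV v)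

/-- `c` is an energy-bounded form on `V` that agrees with `b` on `S` (a subspace of the domain `D`
of `b`, in the applications dense in `V`): the extension of `b` by continuity from `S` to `V`. -/
structure IsContinuousExtension {V D : Submodule ℂ H} (a : V →ₗ[ℂ] V →ₗ⋆[ℂ] ℂ) (hDV : D ≤ V)
    (b : D →ₗ[ℂ] D →ₗ⋆[ℂ] ℂ) (S : Submodule ℂ H) (c : V →ₗ[ℂ] V →ₗ⋆[ℂ] ℂ) : Prop where
  bounded : IsEnergyBounded a le_rfl c
  extends_form : ∀ u v : D, (u : H) ∈ S → (v : H) ∈ S →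
    c (Submodule.inclusion hDV u) (Submodule.inclusion hDV v) = b u v

/-- The graph of the operator of a form `t` with form domain `V`: all `(u, f)` such that
`u ∈ V` and `t(u, v) = (f, v)` for all `v ∈ V`. -/
def formGraph {V : Submodule ℂ H} (t : V →ₗ[ℂ] V →ₗ⋆[ℂ] ℂ) : Submodule ℂ (H × H) where
  carrier := {p | ∃ hu : p.1 ∈ V, ∀ v : V, t ⟨p.1, hu⟩ v = inner ℂ (v : H) p.2}
  add_mem' := by
    rintro ⟨u, f⟩ ⟨u', f'⟩ ⟨hu, h⟩ ⟨hu', h'⟩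
    refine ⟨V.add_mem hu hu', fun v => ?_⟩
    have e : (⟨u + u', V.add_mem hu hu'⟩ : V) = ⟨u, hu⟩ + ⟨u', hu'⟩ := rfl
    change t ⟨u + u', V.add_mem hu hu'⟩ v = inner ℂ (v : H) (f + f')
    rw [e, map_add, LinearMap.add_apply, inner_add_right, h v, h' v]
  zero_mem' := by
    refine ⟨V.zero_mem, fun v => ?_⟩
    have e : (⟨0, V.zero_mem⟩ : V) = 0 := rfl
    change t ⟨0, V.zero_mem⟩ v = inner ℂ (v : H) 0
    rw [e, map_zero, LinearMap.zero_apply, inner_zero_right]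
  smul_mem' := by
    rintro c ⟨u, f⟩ ⟨hu, h⟩
    refine ⟨V.smul_mem c hu, fun v => ?_⟩
    have e : (⟨c • u, V.smul_mem c hu⟩ : V) = c • ⟨u, hu⟩ := rfl
    change t ⟨c • u, V.smul_mem c hu⟩ v = inner ℂ (v : H) (c • f)
    rw [e, map_smul, LinearMap.smul_apply, inner_smul_right, h v, smul_eq_mul]

/-- The operator in `H` of a densely defined form `t` with form domain `V`: its domain consists of
all `u ∈ V` for which there is `f ∈ H` with `t(u, v) = (f, v)` for all `v ∈ V`, and it maps `u` to
this `f`. -/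
def formOperator {V : Submodule ℂ H} (t : V →ₗ[ℂ] V →ₗ⋆[ℂ] ℂ) : H →ₗ.[ℂ] H :=
  (formGraph t).toLinearPMap

/-- For a densely defined form, the graph of the operator is the graph above. -/
theorem formOperator_graph {V : Submodule ℂ H} (hV : Dense (V : Set H))
    (t : V →ₗ[ℂ] V →ₗ⋆[ℂ] ℂ) : (formOperator t).graph = formGraph t := by
  apply Submodule.toLinearPMap_graph_eq
  rintro ⟨u, f⟩ ⟨hu, h⟩ h0
  have h0' : u = 0 := h0
  subst h0'
  have e : (⟨0, hu⟩ : V) = 0 := rfl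
  refine hV.eq_zero_of_inner_right (𝕜 := ℂ) fun v hv => ?_
  have h1 := h ⟨v, hv⟩
  change t ⟨0, hu⟩ ⟨v, hv⟩ = inner ℂ v f at h1
  rw [← h1, e, map_zero, LinearMap.zero_apply]

/-- `u` is an eigenvector of the operator `T` for the eigenvalue `z`. -/
def IsEigenvector (T : H →ₗ.[ℂ] H) (z : ℂ) (u : H) : Prop :=
  u ≠ 0 ∧ ∃ hu : u ∈ T.domain, T ⟨u, hu⟩ = z • u

/-- `R` is a bounded everywhere defined two-sided inverse of `z - T`. -/
def IsResolventAt (T : H →ₗ.[ℂ] H) (z : ℂ) (R : H →L[ℂ] H) : Prop :=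
  (∀ f : H, ∃ hf : R f ∈ T.domain, z • R f - T ⟨R f, hf⟩ = f) ∧
    ∀ u : T.domain, R (z • (u : H) - T u) = u

/-- The resolvent set of an (unbounded) operator. -/
def resolventSet (T : H →ₗ.[ℂ] H) : Set ℂ := {z | ∃ R : H →L[ℂ] H, IsResolventAt T z R}

/-- The spectrum of an (unbounded) operator. -/
def opSpectrum (T : H →ₗ.[ℂ] H) : Set ℂ := (resolventSet T)ᶜ

open Classical in
/-- The resolvent `(z - T)⁻¹` for `z` in the resolvent set, and `0` elsewhere. -/
def opResolvent (T : H →ₗ.[ℂ] H) (z : ℂ) : H →L[ℂ] H :=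
  if h : z ∈ resolventSet T then Classical.choose h else 0

/-- The kernel of `(T - z)^k`, with the natural domain of this power. -/
def powKer (T : H →ₗ.[ℂ] H) (z : ℂ) : ℕ → Submodule ℂ H
  | 0 => ⊥
  | k + 1 => ((powKer T z k).comap (T.toFun - z • T.domain.subtype)).map T.domain.subtype

/-- The root space of `T` at `z`: the union of the kernels of the powers of `T - z`. -/
def rootSpace (T : H →ₗ.[ℂ] H) (z : ℂ) : Submodule ℂ H := ⨆ k, powKer T z k

/-- `φ 0, φ 1, …` are the root vectors of `T`, with the eigenvalues `lam 0, lam 1, …`: the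
spectrum consists of the `lam n`, each attained finitely often; for each eigenvalue, the root
vectors that belong to it are a basis of the root space; and each `φ n` is either an eigenvector
or the successor of `φ (n - 1)` in a Jordan chain. -/
structure IsRootSystem (T : H →ₗ.[ℂ] H) (lam : ℕ → ℂ) (φ : ℕ → H) : Prop where
  spectrum_eq : opSpectrum T = Set.range lam
  finite_multiplicity : ∀ m, {n | lam n = lam m}.Finite
  linearIndependent : ∀ m, LinearIndependent ℂ (fun n : {n // lam n = lam m} => φ n)
  span_eq : ∀ m, Submodule.span ℂ (φ '' {n | lam n = lam m}) = rootSpace T (lam m)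
  chain : ∀ n, IsEigenvector T (lam n) (φ n) ∨
    ∃ m, n = m + 1 ∧ ∃ hn : φ n ∈ T.domain, T ⟨φ n, hn⟩ - lam n • φ n = φ m

/-- The counterclockwise contour integral of `f` over the boundary of the rectangle
`[x₀, x₁] × [y₀, y₁]`. -/
def rectIntegral (f : ℂ → H) (x₀ x₁ y₀ y₁ : ℝ) : H :=
  (∫ x in x₀..x₁, f ((x : ℂ) + (y₀ : ℂ) * Complex.I))
    + Complex.I • (∫ y in y₀..y₁, f ((x₁ : ℂ) + (y : ℂ) * Complex.I))
    - (∫ x in x₀..x₁, f ((x : ℂ) + (y₁ : ℂ) * Complex.I))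
    - Complex.I • (∫ y in y₀..y₁, f ((x₀ : ℂ) + (y : ℂ) * Complex.I))

/-! The rectangles around `μ n`. Indices start at `0` here, so that `n` stands for the `(n+1)`-st
member of the sequence. -/

/-- Left end of the rectangle around `μ n`. -/
def boxLeft (κ γ : ℝ) (μ : ℕ → ℝ) (n : ℕ) : ℝ := μ n - κ / 2 * (n : ℝ) ^ (γ - 1)

/-- Right end of the rectangle around `μ n`. -/
def boxRight (κ γ : ℝ) (μ : ℕ → ℝ) (n : ℕ) : ℝ := μ n + κ / 2 * ((n : ℝ) + 1) ^ (γ - 1)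

/-- Half of the height of the rectangle around `μ n`. -/
def boxHeight (κ γ : ℝ) (n : ℕ) : ℝ := κ / 2 * ((n : ℝ) + 1) ^ (γ - 1)

/-- The open rectangle around `μ n`. -/
def box (κ γ : ℝ) (μ : ℕ → ℝ) (n : ℕ) : Set ℂ :=
  {z | boxLeft κ γ μ n < z.re ∧ z.re < boxRight κ γ μ n ∧ |z.im| < boxHeight κ γ n}

/-- The Riesz projection
`(2πi)⁻¹ ∮ (z - T)⁻¹ x dz` over the boundary of the rectangle around `μ n`, applied to `x`. -/
def rieszProjection (T : H →ₗ.[ℂ] H) (κ γ : ℝ) (μ : ℕ → ℝ) (n : ℕ) (x : H) : H :=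
  (2 * (Real.pi : ℂ) * Complex.I)⁻¹ •
    rectIntegral (fun z => opResolvent T z x) (boxLeft κ γ μ n) (boxRight κ γ μ n)
      (-boxHeight κ γ n) (boxHeight κ γ n)

/-- `lam n, φ n` are the eigenvalues and root vectors of `T`, labelled and scaled as perturbations
of `μ n, ψ n`: for all large `n`, the boundary of the rectangle around `μ n` lies in the resolvent
set of `T`, the rectangle contains no spectrum of `T` except `lam n`, this eigenvalue is simple,
and `φ n` is the Riesz projection of `ψ n`. -/
structure IsPerturbedRootSystem (T : H →ₗ.[ℂ] H) (κ γ : ℝ) (μ : ℕ → ℝ) (ψ : ℕ → H)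
    (lam : ℕ → ℂ) (φ : ℕ → H) : Prop extends IsRootSystem T lam φ where
  eventually_riesz : ∃ N : ℕ, ∀ n, N ≤ n →
    frontier (box κ γ μ n) ⊆ resolventSet T ∧
    opSpectrum T ∩ box κ γ μ n = {lam n} ∧
    Module.finrank ℂ (rootSpace T (lam n)) = 1 ∧
    φ n = rieszProjection T κ γ μ n (ψ n)

end FormPerturbation

end

open scoped ComplexConjugate
-- Write `β k = (k + 1) ^ (-α)`, so that the matrix of `b` is dominated by `M * (β l * β m)`.
-- Lowering `α` only weakens this bound, and for `α = 3/4` the condition `2α + γ > 3/2` is just `γ >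
-- 0`. So one may assume `α ≤ 3/4` and `2α + γ > 3/2`, which covers both cases of the hypothesis.
--
-- Form and operator. Separation gives `μ n ≥ c (n + 1) ^ γ`, hence `∑ β k ^ 2 / μ k < ∞`. With `J =
-- A^{1/2} : V → H` (`exists_isEnergyMap`) the matrix `b(ψ l, ψ m) / √(μ l μ m)` defines a
-- Hilbert-Schmidt operator `K`, and `(K J u, J v)` is the extension of `b`
-- (`exists_continuousExtension`). With `G = J⁻¹` as an operator in `H`, the equation `T u = f`
-- reads `J u + K J u = G f`; for a suitable positive `x` the inverse `R = (T + x)⁻¹` exists and is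
-- compact (`exists_resolvent`).
--
-- Eigenvectors. For large `n` the eigenvalue equation near `μ n` is solved by a contraction in
-- `ℓ^∞` (`exists_eigenSequence`), which needs `β n ^ 2` small against the gap and `∑ m, β m ^ 2 /
-- |μ n - μ m|` small. The eigenvector satisfies `‖φ n - ψ n‖ ^ 2 ≤ C β n ^ 2 ∑ m, β m ^ 2 / |μ n -
-- μ m| ^ 2`. Since `|μ n - μ m|` is at least of order `|n - m|` times the power `γ - 1` of the
-- larger index, the inner sum of the contraction tends to zero and the error is summable over `n`,
-- both because `2α + γ > 3/2` (`tendsto_tsum_weight_div`, `summable_tsum_weight_div_sq`). The same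
-- construction for the adjoint of `K` gives eigenvectors `φ' n` of the adjoint, biorthonormal to
-- the `φ n`.
--
-- Completeness and labelling. Quadratic closeness of the tail `φ' n`, `n ≥ N`, to the tail of the
-- basis forces its annihilator to have dimension exactly `N` (`annihilator_equiv`). The operator
-- acts on this annihilator, and a Jordan basis there fills the first `N` places of the root system.
-- Near `lam n` the resolvent applied to `ψ n` is a simple pole with residue `φ n` plus a
-- holomorphic term, so `φ n` is the Riesz projection of `ψ n`. Every perturbed root system
-- therefore agrees with the constructed one for large `n`, and the summable error bound applies to
-- it.
namespace FormPerturbation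
open Filter Topology

/-! ### Coordinates in a Hilbert basis, Hilbert-Schmidt operators and the Fredholm alternative. -/

section Operators

variable {H : Type*} [NormedAddCommGroup H] [InnerProductSpace ℂ H]

/-- The `k`-th coordinate functional of a Hilbert basis. -/
noncomputable def coef (ψ : HilbertBasis ℕ ℂ H) (k : ℕ) : H →L[ℂ] ℂ := innerSL ℂ (ψ k)

theorem coef_eq_inner (ψ : HilbertBasis ℕ ℂ H) (k : ℕ) (x : H) : coef ψ k x = inner ℂ (ψ k) x := rfl

theorem coef_eq_repr (ψ : HilbertBasis ℕ ℂ H) (k : ℕ) (x : H) : coef ψ k x = ψ.repr x k :=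
  (HilbertBasis.repr_apply_apply ψ x k).symm

theorem hasSum_coef (ψ : HilbertBasis ℕ ℂ H) (x : H) : HasSum (fun k => coef ψ k x • ψ k) x := by
  simpa only [coef_eq_repr] using ψ.hasSum_repr x

theorem hasSum_norm_coef_sq (ψ : HilbertBasis ℕ ℂ H) (x : H) :
    HasSum (fun k => ‖coef ψ k x‖ ^ 2) (‖x‖ ^ 2) := by
  have h := lp.hasSum_norm (p := 2) (by norm_num) (ψ.repr x)
  simpa [coef_eq_repr] using h

theorem summable_norm_coef_sq (ψ : HilbertBasis ℕ ℂ H) (x : H) :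
    Summable (fun k => ‖coef ψ k x‖ ^ 2) := (hasSum_norm_coef_sq ψ x).summable

theorem exists_coef_eq (ψ : HilbertBasis ℕ ℂ H) {f : ℕ → ℂ} (hf : Summable fun k => ‖f k‖ ^ 2) :
    ∃ x, ∀ k, coef ψ k x = f k := by
  have h : Memℓp f 2 := memℓp_gen (by simpa using hf)
  exact ⟨ψ.repr.symm ⟨f, h⟩, fun k => by simp [coef_eq_repr]⟩

theorem ext_coef (ψ : HilbertBasis ℕ ℂ H) {x y : H} (h : ∀ k, coef ψ k x = coef ψ k y) :
    x = y :=
  ψ.repr.injective (lp.ext (funext fun k => by rw [← coef_eq_repr, ← coef_eq_repr, h]))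

theorem coef_basis (ψ : HilbertBasis ℕ ℂ H) (i k : ℕ) :
    coef ψ k (ψ i) = if k = i then 1 else 0 := by
  rw [coef_eq_inner, orthonormal_iff_ite.1 ψ.orthonormal]

theorem coef_sum_smul_basis (ψ : HilbertBasis ℕ ℂ H) (s : Finset ℕ) (g : ℕ → ℂ) (k : ℕ) :
    coef ψ k (∑ i ∈ s, g i • ψ i) = if k ∈ s then g k else 0 := by
  simp [coef_basis]

theorem norm_le_of_coef_sq_le (ψ : HilbertBasis ℕ ℂ H) {x : H} {g : ℕ → ℝ} {S : ℝ}
    (hg : HasSum g S) (h : ∀ k, ‖coef ψ k x‖ ^ 2 ≤ g k) : ‖x‖ ^ 2 ≤ S :=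
  hasSum_le h (hasSum_norm_coef_sq ψ x) hg

theorem summable_mul_of_sq {f g : ℕ → ℝ} (hf0 : ∀ k, 0 ≤ f k) (hg0 : ∀ k, 0 ≤ g k)
    (hf : Summable fun k => f k ^ 2) (hg : Summable fun k => g k ^ 2) :
    Summable (fun k => f k * g k) :=
  Real.summable_mul_of_Lp_Lq_of_nonneg (p := 2) (q := 2)
    ⟨by norm_num, by norm_num, by norm_num⟩ hf0 hg0 (by simpa using hf) (by simpa using hg)

theorem tsum_mul_sq_le {f g : ℕ → ℝ} (hf0 : ∀ k, 0 ≤ f k) (hg0 : ∀ k, 0 ≤ g k)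
    (hf : Summable fun k => f k ^ 2) (hg : Summable fun k => g k ^ 2) :
    (∑' k, f k * g k) ^ 2 ≤ (∑' k, f k ^ 2) * ∑' k, g k ^ 2 := by
  have h := Real.inner_le_Lp_mul_Lq_tsum_of_nonneg (p := 2) (q := 2)
    ⟨by norm_num, by norm_num, by norm_num⟩ hf0 hg0 (by simpa using hf) (by simpa using hg)
  have hF : 0 ≤ ∑' k, f k ^ 2 := tsum_nonneg fun k => sq_nonneg _
  have hG : 0 ≤ ∑' k, g k ^ 2 := tsum_nonneg fun k => sq_nonneg _
  simp only [Real.rpow_ofNat, ← Real.sqrt_eq_rpow] at h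
  have h0 : 0 ≤ ∑' k, f k * g k := tsum_nonneg fun k => mul_nonneg (hf0 k) (hg0 k)
  calc _ ≤ (√(∑' k, f k ^ 2) * √(∑' k, g k ^ 2)) ^ 2 := pow_le_pow_left₀ h0 h 2
    _ = _ := by rw [mul_pow, Real.sq_sqrt hF, Real.sq_sqrt hG]

variable [CompleteSpace H]

/-- Cauchy-Schwarz against the coordinates makes the series converge absolutely; `E` is the
Hilbert-Schmidt operator that maps `ψ k` to `d k`. The bound with `N = 0` controls the operator
norm, and large `N` gives compactness. -/
theorem exists_operator_of_summable_sq (ψ : HilbertBasis ℕ ℂ H) {d : ℕ → H}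
    (hd : Summable fun n => ‖d n‖ ^ 2) :
    ∃ E : H →L[ℂ] H, (∀ x, HasSum (fun k => coef ψ k x • d k) (E x)) ∧
      ∀ N x, (∀ k < N, coef ψ k x = 0) → ‖E x‖ ≤ √(∑' k, ‖d (k + N)‖ ^ 2) * ‖x‖ := by
  have hs : ∀ x, Summable fun k => ‖coef ψ k x • d k‖ := fun x => by
    simpa [norm_smul] using summable_mul_of_sq (fun _ => norm_nonneg _) (fun _ => norm_nonneg _)
      (summable_norm_coef_sq ψ x) hd
  have key : ∀ N x, (∀ k < N, coef ψ k x = 0) →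
      ‖∑' k, coef ψ k x • d k‖ ≤ √(∑' k, ‖d (k + N)‖ ^ 2) * ‖x‖ := fun N x hx => by
    have h1 : ∑' k, coef ψ k x • d k = ∑' k, coef ψ (k + N) x • d (k + N) := by
      rw [← (hs x).of_norm.sum_add_tsum_nat_add N,
        Finset.sum_eq_zero fun k hk => by rw [hx k (Finset.mem_range.1 hk), zero_smul], zero_add]
    have h2 : Summable fun k => ‖coef ψ (k + N) x‖ ^ 2 :=
      (summable_nat_add_iff (f := fun k => ‖coef ψ k x‖ ^ 2) N).2 (summable_norm_coef_sq ψ x)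
    have h3 : Summable fun k => ‖d (k + N)‖ ^ 2 :=
      (summable_nat_add_iff (f := fun k => ‖d k‖ ^ 2) N).2 hd
    have h4 : ∑' k, ‖coef ψ (k + N) x‖ ^ 2 ≤ ‖x‖ ^ 2 := by
      rw [← (hasSum_norm_coef_sq ψ x).tsum_eq,
        ← (summable_norm_coef_sq ψ x).sum_add_tsum_nat_add N]
      exact le_add_of_nonneg_left (Finset.sum_nonneg fun _ _ => sq_nonneg _)
    have h5 := tsum_mul_sq_le (fun k => norm_nonneg (coef ψ (k + N) x))
      (fun k => norm_nonneg (d (k + N))) h2 h3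
    have h6 : 0 ≤ ∑' k, ‖d (k + N)‖ ^ 2 := tsum_nonneg fun _ => sq_nonneg _
    rw [h1]
    have h7 : Summable fun k => ‖coef ψ (k + N) x • d (k + N)‖ :=
      (summable_nat_add_iff (f := fun k => ‖coef ψ k x • d k‖) N).2 (hs x)
    refine (norm_tsum_le_tsum_norm h7).trans ?_
    simp only [norm_smul]
    refine le_of_sq_le_sq ?_ (by positivity)
    rw [mul_pow, Real.sq_sqrt h6, mul_comm]
    exact h5.trans (mul_le_mul_of_nonneg_right h4 h6)
  let E₀ : H →ₗ[ℂ] H :=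
    { toFun := fun x => ∑' k, coef ψ k x • d k
      map_add' := fun x y => by
        rw [← (hs x).of_norm.tsum_add (hs y).of_norm]
        simp [add_smul]
      map_smul' := fun c x => by
        simp only [map_smul, smul_assoc, RingHom.id_apply]
        exact (hs x).of_norm.tsum_const_smul c }
  refine ⟨E₀.mkContinuous (√(∑' k, ‖d (k + 0)‖ ^ 2)) fun x => key 0 x (by simp), fun x => ?_,
    fun N x hx => key N x hx⟩
  exact (hs x).of_norm.hasSum

/-- An operator that is small on vectors with vanishing first coordinates is compact. -/
theorem isCompactOperator_of_small_tail (ψ : HilbertBasis ℕ ℂ H) (E : H →L[ℂ] H)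
    (h : ∀ ε > 0, ∃ N, ∀ x, (∀ k < N, coef ψ k x = 0) → ‖E x‖ ≤ ε * ‖x‖) :
    IsCompactOperator E := by
  let P : ℕ → H →L[ℂ] H := fun N => ∑ k ∈ Finset.range N, (innerSL ℂ (ψ k)).smulRight (ψ k)
  have hP : ∀ N x, P N x = ∑ k ∈ Finset.range N, coef ψ k x • ψ k := fun N x => by
    simp [P, coef_eq_inner]
  have hPr : ∀ N x k, coef ψ k (P N x) = if k < N then coef ψ k x else 0 := fun N x k => by
    simp only [hP, coef_sum_smul_basis, Finset.mem_range]
  have hle : ∀ N x, ‖x - P N x‖ ≤ ‖x‖ := fun N x => by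
    refine le_of_sq_le_sq ?_ (norm_nonneg _)
    refine norm_le_of_coef_sq_le ψ (hasSum_norm_coef_sq ψ x) fun k => ?_
    rw [map_sub, hPr]
    split_ifs <;> simp
  have hcomp : ∀ N, IsCompactOperator (E ∘L P N) := fun N => by
    have h1 : ∀ n, IsCompactOperator (P n) := fun n => by
      induction n with
      | zero => simpa [P] using isCompactOperator_zero
      | succ n ih =>
        have : (P (n + 1) : H → H) = P n + (innerSL ℂ (ψ n)).smulRight (ψ n) := by
          ext x; simp [P, Finset.sum_range_succ]
        rw [this]
        refine ih.add ?_
        have h2 : IsCompactOperator (innerSL ℂ (ψ n) : H →L[ℂ] ℂ) :=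
          isCompactOperator_of_locallyCompactSpace_dom (innerSL ℂ (ψ n) : H →L[ℂ] ℂ)
        exact h2.clm_comp ((ContinuousLinearMap.id ℂ ℂ).smulRight (ψ n))
    exact (h1 N).clm_comp E
  -- The finite-rank operators `E ∘L P N` converge to `E` in norm, because `x - P n x` has vanishing
  -- first coordinates.
  refine isCompactOperator_of_tendsto (l := atTop) (F := fun N => E ∘L P N) ?_
    (Eventually.of_forall hcomp)
  rw [Metric.tendsto_atTop]
  intro ε hε
  obtain ⟨N, hN⟩ := h (ε / 2) (by positivity)
  refine ⟨N, fun n hn => ?_⟩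
  rw [dist_comm, dist_eq_norm]
  refine lt_of_le_of_lt (ContinuousLinearMap.opNorm_le_bound _ (by positivity : 0 ≤ ε / 2)
    fun x => ?_) (by linarith)
  have : (E - E ∘L P n) x = E (x - P n x) := by simp
  rw [this]
  refine (hN _ fun k hk => ?_).trans (mul_le_mul_of_nonneg_left (hle n x) (by positivity))
  rw [map_sub, hPr, if_pos (hk.trans_le hn), sub_self]

omit [CompleteSpace H] in
theorem exists_tail_le (ψ : HilbertBasis ℕ ℂ H) {d : ℕ → H} {E : H →L[ℂ] H}
    (hE : ∀ N x, (∀ k < N, coef ψ k x = 0) → ‖E x‖ ≤ √(∑' k, ‖d (k + N)‖ ^ 2) * ‖x‖) (ε : ℝ)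
    (hε : 0 < ε) : ∃ N, ∀ x, (∀ k < N, coef ψ k x = 0) → ‖E x‖ ≤ ε * ‖x‖ := by
  have h1 : Tendsto (fun N => √(∑' k, ‖d (k + N)‖ ^ 2)) atTop (𝓝 0) := by
    have := (tendsto_sum_nat_add fun k => ‖d k‖ ^ 2).sqrt
    simpa using this
  obtain ⟨N, hN⟩ := ((h1.eventually (gt_mem_nhds hε)).exists)
  exact ⟨N, fun x hx => (hE N x hx).trans (mul_le_mul_of_nonneg_right hN.le (norm_nonneg _))⟩

/-- The Fredholm alternative: an injective compact perturbation of the identity is invertible. -/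
theorem isUnit_one_add_of_injective {S : H →L[ℂ] H} (hS : IsCompactOperator S)
    (hinj : ∀ x, x + S x = 0 → x = 0) : IsUnit (1 + S) := by
  have h := IsCompactOperator.hasEigenvalue_or_mem_resolventSet (T := S) hS
    (μ := (-1 : ℂ)) (by norm_num)
  rcases h with h | h
  · obtain ⟨x, hx⟩ := h.exists_hasEigenvector
    refine absurd (hinj x ?_) hx.2
    have := hx.apply_eq_smul
    simp at this
    simp [this]
  · rw [spectrum.mem_resolventSet_iff] at h
    have : (1 + S) = -(algebraMap ℂ (H →L[ℂ] H) (-1) - S) := by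
      ext x; simp [add_comm]
    rw [this]
    exact h.neg

end Operators

/-! ### Cauchy's integral over the boundary of a rectangle. -/

section Rectangle

open Complex

theorem log_sub_log_neg_of_im_pos {p : ℂ} (h : 0 < p.im) : log p - log (-p) = Real.pi * I := by
  simp only [log, norm_neg, arg_neg_eq_arg_sub_pi_of_im_pos h]
  push_cast
  ring

theorem log_neg_sub_log_of_im_neg {p : ℂ} (h : p.im < 0) : log (-p) - log p = Real.pi * I := by
  simp only [log, norm_neg, arg_neg_eq_arg_add_pi_of_im_neg h]
  push_cast
  ring

theorem integral_inv_line {F f : ℝ → ℂ} {s : ℂ} {a b : ℝ}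
    (hF : ∀ t, F t ∈ slitPlane) (hd : ∀ t, HasDerivAt F s t) (hf : ∀ t, f t = s / F t) :
    ∫ t in a..b, f t = log (F b) - log (F a) := by
  have hc : Continuous F := continuous_iff_continuousAt.2 fun t => (hd t).continuousAt
  have h0 : ∀ t, F t ≠ 0 := fun t => slitPlane_ne_zero (hF t)
  have hfc : Continuous f := by
    rw [funext hf]; exact continuous_const.div hc h0
  refine intervalIntegral.integral_eq_sub_of_hasDerivAt (f := fun t => log (F t)) (fun t _ => ?_)
    (hfc.intervalIntegrable a b)
  rw [hf]
  exact (hd t).clog_real (hF t)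

/-- The integral of the Cauchy kernel over the boundary of a rectangle around its pole. -/
theorem rectIntegral_inv_sub {H : Type*} [NormedAddCommGroup H] [InnerProductSpace ℂ H]
    [CompleteSpace H] {x₀ x₁ y₀ y₁ : ℝ} {w : ℂ} (hx₀ : x₀ < w.re) (hx₁ : w.re < x₁)
    (hy₀ : y₀ < w.im) (hy₁ : w.im < y₁) (v : H) :
    rectIntegral (fun z => (z - w)⁻¹ • v) x₀ x₁ y₀ y₁ = (2 * (Real.pi : ℂ) * I) • v := by
  have hre : ∀ x y : ℝ, ((x : ℂ) + (y : ℂ) * I - w).re = x - w.re := fun x y => by simp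
  have him : ∀ x y : ℝ, ((x : ℂ) + (y : ℂ) * I - w).im = y - w.im := fun x y => by simp
  have dx : ∀ y t : ℝ, HasDerivAt (fun x : ℝ => (x : ℂ) + (y : ℂ) * I - w) 1 t := fun y t =>
    ((hasDerivAt_id t).ofReal_comp.add_const _).sub_const _
  have dy : ∀ x t : ℝ, HasDerivAt (fun y : ℝ => (x : ℂ) + (y : ℂ) * I - w) I t := fun x t => by
    simpa using (((hasDerivAt_id t).ofReal_comp.mul_const I).const_add (x : ℂ)).sub_const w
  have e1 : ∫ x in x₀..x₁, ((x : ℂ) + (y₀ : ℂ) * I - w)⁻¹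
      = log (x₁ + y₀ * I - w) - log (x₀ + y₀ * I - w) :=
    integral_inv_line (F := fun x : ℝ => (x : ℂ) + (y₀ : ℂ) * I - w) (s := 1)
      (fun t => Or.inr (by rw [him]; exact (sub_neg.2 hy₀).ne)) (dx y₀) (fun t => by simp)
  have e2 : ∫ x in x₀..x₁, ((x : ℂ) + (y₁ : ℂ) * I - w)⁻¹
      = log (x₁ + y₁ * I - w) - log (x₀ + y₁ * I - w) :=
    integral_inv_line (F := fun x : ℝ => (x : ℂ) + (y₁ : ℂ) * I - w) (s := 1)
      (fun t => Or.inr (by rw [him]; exact (sub_pos.2 hy₁).ne')) (dx y₁) (fun t => by simp)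
  have e3 : I * ∫ y in y₀..y₁, ((x₁ : ℂ) + (y : ℂ) * I - w)⁻¹
      = log (x₁ + y₁ * I - w) - log (x₁ + y₀ * I - w) := by
    rw [← intervalIntegral.integral_const_mul]
    exact integral_inv_line (F := fun y : ℝ => (x₁ : ℂ) + (y : ℂ) * I - w) (s := I)
      (fun t => Or.inl (by rw [hre]; exact sub_pos.2 hx₁)) (dy x₁) (fun t => div_eq_mul_inv _ _)
  -- The left side crosses the branch cut of `log`, so the primitive `log (-p)` is used on it. The
  -- mismatch with `log p` is `π i` at each of the two left corners, which makes up `2 π i`.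
  have e4 : I * ∫ y in y₀..y₁, ((x₀ : ℂ) + (y : ℂ) * I - w)⁻¹
      = log (-(x₀ + y₁ * I - w)) - log (-(x₀ + y₀ * I - w)) := by
    rw [← intervalIntegral.integral_const_mul]
    exact integral_inv_line (F := fun y : ℝ => -((x₀ : ℂ) + (y : ℂ) * I - w)) (s := -I)
      (fun t => Or.inl (by rw [neg_re, hre]; linarith)) (fun t => (dy x₀ t).neg)
      (fun t => by rw [neg_div_neg_eq, div_eq_mul_inv])
  have l1 := log_sub_log_neg_of_im_pos (p := x₀ + y₁ * I - w) (by rw [him]; linarith)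
  have l2 := log_neg_sub_log_of_im_neg (p := x₀ + y₀ * I - w) (by rw [him]; linarith)
  simp only [rectIntegral, intervalIntegral.integral_smul_const, smul_smul]
  rw [e1, e2, e3, e4, ← add_smul, ← sub_smul, ← sub_smul]
  congr 1
  linear_combination l1 + l2

/-- Cauchy's theorem for a simple pole: the boundary integral of `(z - w)⁻¹ • v + g z` with `g`
holomorphic in a neighbourhood of the closed rectangle. -/
theorem rectIntegral_eq_of_simple_pole {H : Type*} [NormedAddCommGroup H] [InnerProductSpace ℂ H]
    [CompleteSpace H] {x₀ x₁ y₀ y₁ : ℝ} {w : ℂ} (hx₀ : x₀ < w.re) (hx₁ : w.re < x₁)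
    (hy₀ : y₀ < w.im) (hy₁ : w.im < y₁) {f g : ℂ → H} (v : H)
    (hg : DifferentiableOn ℂ g (Set.Icc x₀ x₁ ×ℂ Set.Icc y₀ y₁))
    (hf : ∀ z ∈ Set.Icc x₀ x₁ ×ℂ Set.Icc y₀ y₁,
      (z.re = x₀ ∨ z.re = x₁ ∨ z.im = y₀ ∨ z.im = y₁) → f z = (z - w)⁻¹ • v + g z) :
    rectIntegral f x₀ x₁ y₀ y₁ = (2 * (Real.pi : ℂ) * I) • v := by
  have hx : x₀ ≤ x₁ := (hx₀.trans hx₁).le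
  have hy : y₀ ≤ y₁ := (hy₀.trans hy₁).le
  have c1 := integral_boundary_rect_eq_zero_of_differentiableOn g ⟨x₀, y₀⟩ ⟨x₁, y₁⟩
    (by simpa [Set.uIcc_of_le hx, Set.uIcc_of_le hy] using hg)
  simp only at c1
  rw [← rectIntegral_inv_sub hx₀ hx₁ hy₀ hy₁ v]
  have hgc := hg.continuousOn
  have hh : ∀ y ∈ Set.Icc y₀ y₁, (y = y₀ ∨ y = y₁) →
      ∫ x in x₀..x₁, f ((x : ℂ) + (y : ℂ) * I) =
        (∫ x in x₀..x₁, ((x : ℂ) + (y : ℂ) * I - w)⁻¹ • v) +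
          ∫ x in x₀..x₁, g ((x : ℂ) + (y : ℂ) * I) := fun y hym hyb => by
    rw [← intervalIntegral.integral_add]
    · refine intervalIntegral.integral_congr fun x hxm => ?_
      rw [Set.uIcc_of_le hx] at hxm
      refine hf _ ⟨by simpa using hxm, by simpa using hym⟩ ?_
      rcases hyb with h | h <;> simp [h]
    · refine ContinuousOn.intervalIntegrable (ContinuousOn.smul (ContinuousOn.inv₀ (by fun_prop)
        fun x _ h0 => ?_) continuousOn_const)
      have := congrArg im h0
      simp at this
      rcases hyb with h | h <;> linarith
    · refine ContinuousOn.intervalIntegrable (hgc.comp (by fun_prop) fun x hxm => ?_)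
      rw [Set.uIcc_of_le hx] at hxm
      exact ⟨by simpa using hxm, by simpa using hym⟩
  have hv : ∀ x ∈ Set.Icc x₀ x₁, (x = x₀ ∨ x = x₁) →
      ∫ y in y₀..y₁, f ((x : ℂ) + (y : ℂ) * I) =
        (∫ y in y₀..y₁, ((x : ℂ) + (y : ℂ) * I - w)⁻¹ • v) +
          ∫ y in y₀..y₁, g ((x : ℂ) + (y : ℂ) * I) := fun x hxm hxb => by
    rw [← intervalIntegral.integral_add]
    · refine intervalIntegral.integral_congr fun y hym => ?_
      rw [Set.uIcc_of_le hy] at hym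
      refine hf _ ⟨by simpa using hxm, by simpa using hym⟩ ?_
      rcases hxb with h | h <;> simp [h]
    · refine ContinuousOn.intervalIntegrable (ContinuousOn.smul (ContinuousOn.inv₀ (by fun_prop)
        fun y _ h0 => ?_) continuousOn_const)
      have := congrArg re h0
      simp at this
      rcases hxb with h | h <;> linarith
    · refine ContinuousOn.intervalIntegrable (hgc.comp (by fun_prop) fun y hym => ?_)
      rw [Set.uIcc_of_le hy] at hym
      exact ⟨by simpa using hxm, by simpa using hym⟩
  simp only [rectIntegral]
  rw [hh y₀ ⟨le_rfl, hy⟩ (Or.inl rfl), hh y₁ ⟨hy, le_rfl⟩ (Or.inr rfl),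
    hv x₀ ⟨le_rfl, hx⟩ (Or.inl rfl), hv x₁ ⟨hx, le_rfl⟩ (Or.inr rfl), smul_add, smul_add]
  linear_combination (norm := module) c1

end Rectangle

/-! ### Separation and growth of the eigenvalues, and the sums over inverse gaps. -/

section Estimates

variable {μ : ℕ → ℝ} {γ κ : ℝ} {N₀ : ℕ}

/-- The worst point of `[x / 4, x]` is the left end for `e ≥ 0` and the right end for `e ≤ 0`. The
minimum covers both, since `γ - 1` may have either sign. -/
theorem rpow_ge_of_quarter_le {x y e : ℝ} (hx : 0 < x) (h1 : x / 4 ≤ y) (h2 : y ≤ x) :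
    min 1 ((1 / 4 : ℝ) ^ e) * x ^ e ≤ y ^ e := by
  have hy : 0 < y := by linarith
  rcases le_total 0 e with he | he
  · calc _ ≤ (1 / 4 : ℝ) ^ e * x ^ e :=
        mul_le_mul_of_nonneg_right (min_le_right _ _) (Real.rpow_nonneg hx.le _)
      _ = (x / 4) ^ e := by
        rw [← Real.mul_rpow (by norm_num) hx.le]; ring_nf
      _ ≤ y ^ e := Real.rpow_le_rpow (by positivity) h1 he
  · calc _ ≤ 1 * x ^ e := mul_le_mul_of_nonneg_right (min_le_left _ _) (Real.rpow_nonneg hx.le _)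
      _ ≤ y ^ e := by rw [one_mul]; exact Real.rpow_le_rpow_of_nonpos hy h2 he

theorem le_of_separation (hκ : 0 < κ)
    (hsep : ∀ k, N₀ ≤ k → κ * ((k : ℝ) + 1) ^ (γ - 1) ≤ μ (k + 1) - μ k) {m n : ℕ}
    (hm : N₀ ≤ m) (hmn : m ≤ n) : μ m ≤ μ n := by
  induction n, hmn using Nat.le_induction with
  | base => exact le_rfl
  | succ n hn ih =>
    have := hsep n (hm.trans hn)
    have h2 : 0 < κ * ((n : ℝ) + 1) ^ (γ - 1) := by positivity
    linarith

/-- Only the consecutive gaps in the upper half of the index range, from `(m + n) / 2` to `n`, are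
added up. There the index is comparable with `n`, so each gap is at least `κ * c₁ * (n + 1) ^ (γ -
1)`, and there are at least `(n - m) / 2` of them. Monotonicity disposes of the lower half. -/
theorem sub_ge_of_separation (hκ : 0 < κ)
    (hsep : ∀ k, N₀ ≤ k → κ * ((k : ℝ) + 1) ^ (γ - 1) ≤ μ (k + 1) - μ k) :
    ∃ c > 0, ∀ m n : ℕ, N₀ ≤ m → m < n →
      c * (((n : ℝ) + 1) ^ (γ - 1) * ((n : ℝ) - m)) ≤ μ n - μ m := by
  set c₁ := min 1 ((1 / 4 : ℝ) ^ (γ - 1))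
  have hc₁ : 0 < c₁ := by positivity
  refine ⟨κ * c₁ / 2, by positivity, fun m n hm hmn => ?_⟩
  set X : ℝ := ((n : ℝ) + 1) ^ (γ - 1)
  have hX : 0 < X := by positivity
  have key : ∀ i, (m + n) / 2 + i ≤ n → κ * c₁ * X * i ≤ μ ((m + n) / 2 + i) - μ ((m + n) / 2) := by
    intro i
    induction i with
    | zero => simp
    | succ i ih =>
      intro hi
      have h1 := ih (by omega)
      have h2 := hsep ((m + n) / 2 + i) (by omega)
      have h3 : c₁ * X ≤ (((((m + n) / 2 + i : ℕ)) : ℝ) + 1) ^ (γ - 1) := by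
        refine rpow_ge_of_quarter_le (by positivity) ?_ ?_
        · have : n + 1 ≤ 4 * ((m + n) / 2 + i + 1) := by omega
          have : ((n + 1 : ℕ) : ℝ) ≤ ((4 * ((m + n) / 2 + i + 1) : ℕ) : ℝ) := by exact_mod_cast this
          push_cast at this ⊢
          linarith
        · have : (m + n) / 2 + i ≤ n := by omega
          have : (((m + n) / 2 + i : ℕ) : ℝ) ≤ n := by exact_mod_cast this
          linarith
      have h4 := mul_le_mul_of_nonneg_left h3 hκ.le
      rw [← add_assoc]
      push_cast at *
      linarith
  have h1 := key (n - (m + n) / 2) (by omega)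
  rw [Nat.add_sub_cancel' (by omega)] at h1
  have h2 := le_of_separation hκ hsep hm (show m ≤ (m + n) / 2 by omega)
  have h3 : ((n : ℝ) - m) / 2 ≤ ((n - (m + n) / 2 : ℕ) : ℝ) := by
    have : n ≤ 2 * (n - (m + n) / 2) + m := by omega
    have : (n : ℝ) ≤ ((2 * (n - (m + n) / 2) + m : ℕ) : ℝ) := by exact_mod_cast this
    push_cast at this
    linarith
  have h4 := mul_le_mul_of_nonneg_left h3 (show 0 ≤ κ * c₁ * X by positivity)
  linarith

theorem tendsto_weight_atTop (hγ : 0 < γ) (a : ℝ) :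
    Tendsto (fun n : ℕ => ((n : ℝ) + 1) ^ (γ - 1) * ((n : ℝ) - a)) atTop atTop := by
  have h1 : Tendsto (fun n : ℕ => ((n : ℝ) + 1)) atTop atTop :=
    tendsto_atTop_add_const_right _ _ tendsto_natCast_atTop_atTop
  have h2 : Tendsto (fun n : ℕ => ((n : ℝ) + 1) ^ γ) atTop atTop := (tendsto_rpow_atTop hγ).comp h1
  refine tendsto_atTop_mono' _ ?_ (h2.atTop_div_const (show (0 : ℝ) < 2 by norm_num))
  filter_upwards [h1.eventually_ge_atTop (2 * (a + 1))] with n hn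
  have hn1 : (0 : ℝ) < (n : ℝ) + 1 := by positivity
  rw [show ((n : ℝ) + 1) ^ γ = ((n : ℝ) + 1) ^ (γ - 1) * ((n : ℝ) + 1) by
    rw [← Real.rpow_add_one hn1.ne']; ring_nf, mul_div_assoc]
  exact mul_le_mul_of_nonneg_left (by linarith) (by positivity)

/-- The eigenvalues are separated as the powers `n ^ γ`. -/
theorem exists_separation (hγ : 0 < γ) (hκ : 0 < κ)
    (hsep : ∀ k, N₀ ≤ k → κ * ((k : ℝ) + 1) ^ (γ - 1) ≤ μ (k + 1) - μ k) :
    ∃ c > 0, ∃ N₁, N₀ < N₁ ∧ ∀ m n : ℕ, N₁ ≤ n → m < n →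
      c * (((n : ℝ) + 1) ^ (γ - 1) * ((n : ℝ) - m)) ≤ μ n - μ m := by
  obtain ⟨c, hc, h⟩ := sub_ge_of_separation hκ hsep
  obtain ⟨B, hB⟩ : ∃ B, ∀ m < N₀, μ m ≤ B := by
    obtain ⟨B, hB⟩ := ((Finset.range N₀).image μ).bddAbove
    exact ⟨B, fun m hm => hB (Finset.mem_coe.2 (Finset.mem_image_of_mem _ (Finset.mem_range.2 hm)))⟩
  -- The eigenvalues with index below `N₀` are not ordered, but they are bounded by `B`. For large
  -- `n`, half of the lower bound for `μ n - μ N₀` absorbs `B - μ N₀`. Replacing `n - N₀` by `(n -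
  -- m) / 2` costs another factor two, hence `c / 4`.
  have h1 := (tendsto_weight_atTop hγ N₀).const_mul_atTop (show 0 < c / 2 by positivity)
  obtain ⟨N₁, hN₁⟩ := eventually_atTop.1 (h1.eventually_ge_atTop (B - μ N₀))
  refine ⟨c / 4, by positivity, max N₁ (2 * N₀ + 1), by omega, fun m n hn hmn => ?_⟩
  set X : ℝ := ((n : ℝ) + 1) ^ (γ - 1)
  have hX : 0 < X := by positivity
  rcases le_or_gt N₀ m with hm | hm
  · refine le_trans ?_ (h m n hm hmn)
    have : (0 : ℝ) < (n : ℝ) - m := sub_pos.2 (by exact_mod_cast hmn)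
    exact mul_le_mul_of_nonneg_right (by linarith) (by positivity)
  · have e1 := h N₀ n le_rfl (by omega)
    have e2 := hN₁ n (by omega)
    have e3 := hB m hm
    have e4 : ((n : ℝ) - m) / 2 ≤ (n : ℝ) - N₀ := by
      have : ((2 * N₀ + 1 : ℕ) : ℝ) ≤ n := by exact_mod_cast (by omega : 2 * N₀ + 1 ≤ n)
      push_cast at this
      have : (0 : ℝ) ≤ m := by positivity
      linarith
    have e5 := mul_le_mul_of_nonneg_left e4 (show 0 ≤ c / 2 * X by positivity)
    simp only [X] at *
    linarith

/-- For large `n` the distance to `μ 0 > 0` already has order `(n + 1) ^ γ`. Positivity of the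
finitely many remaining eigenvalues only affects the constant. -/
theorem exists_growth {c : ℝ} (hc : 0 < c) {N₁ : ℕ} (hpos : ∀ k, 0 < μ k)
    (h : ∀ m n : ℕ, N₁ ≤ n → m < n → c * (((n : ℝ) + 1) ^ (γ - 1) * ((n : ℝ) - m)) ≤ μ n - μ m) :
    ∃ c' > 0, ∀ n : ℕ, c' * ((n : ℝ) + 1) ^ γ ≤ μ n := by
  obtain ⟨b, hb, hb'⟩ : ∃ b > 0, ∀ n < N₁ + 1, b ≤ μ n / ((n : ℝ) + 1) ^ γ := by
    clear h
    induction N₁ with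
    | zero => exact ⟨μ 0 / (((0 : ℕ) : ℝ) + 1) ^ γ, by have := hpos 0; positivity, fun n hn => by
        obtain rfl : n = 0 := by omega
        exact le_rfl⟩
    | succ N ih =>
      obtain ⟨b, hb, h⟩ := ih
      refine ⟨min b (μ (N + 1) / (((N + 1 : ℕ) : ℝ) + 1) ^ γ), ?_, fun n hn => ?_⟩
      · have := hpos (N + 1); positivity
      · rcases Nat.lt_succ_iff_lt_or_eq.1 hn with h1 | rfl
        · exact (min_le_left _ _).trans (h n h1)
        · exact min_le_right _ _
  refine ⟨min b (c / 2), by positivity, fun n => ?_⟩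
  have hX : (0 : ℝ) < ((n : ℝ) + 1) ^ γ := by positivity
  rcases lt_or_ge n (N₁ + 1) with hn | hn
  · rw [← le_div_iff₀ hX]
    exact (min_le_left _ _).trans (hb' n hn)
  · have h1 := h 0 n (by omega) (by omega)
    have h2 := hpos 0
    have hn1 : (0 : ℝ) < (n : ℝ) + 1 := by positivity
    have h3 : ((n : ℝ) + 1) ^ γ = ((n : ℝ) + 1) ^ (γ - 1) * ((n : ℝ) + 1) := by
      rw [← Real.rpow_add_one hn1.ne']; ring_nf
    have h4 : ((n : ℝ) + 1) / 2 ≤ (n : ℝ) - (0 : ℕ) := by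
      have : (1 : ℝ) ≤ n := by exact_mod_cast (by omega : 1 ≤ n)
      push_cast
      linarith
    have h5 := mul_le_mul_of_nonneg_left h4
      (show 0 ≤ c * ((n : ℝ) + 1) ^ (γ - 1) by positivity)
    calc min b (c / 2) * ((n : ℝ) + 1) ^ γ ≤ c / 2 * ((n : ℝ) + 1) ^ γ :=
          mul_le_mul_of_nonneg_right (min_le_right _ _) hX.le
      _ ≤ μ n := by
        rw [h3]
        generalize ((n : ℝ) + 1) ^ (γ - 1) = X at h1 h5
        simp only [Nat.cast_zero, sub_zero] at h1 h5
        linarith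

/-- For `p + q = n`, the mixed product of powers is dominated by pure powers. -/
theorem rpow_mul_rpow_le {p q α r s : ℝ} (hp : 0 < p) (hq : 0 < q) (hα : 2 * α ≤ s) (hα1 : α ≤ 1)
    (hrs : r ≤ s) :
    p ^ (-(2 * α)) * q ^ (-r) ≤ 4 * (p + q) ^ (-(2 * α) + s - r) * (p ^ (-s) + q ^ (-s)) := by
  have hP : 0 < p + q := by positivity
  -- Within a factor two of `p + q`, the power `-(2 * α)` changes by at most `2 ^ (2 * α) ≤ 4`; this
  -- uses `α ≤ 1`.
  have aux : ∀ x : ℝ, 0 < x → x ≤ p + q → p + q ≤ 2 * x →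
      x ^ (-(2 * α)) ≤ 4 * (p + q) ^ (-(2 * α)) := fun x hx h1 h2 => by
    rcases le_total 0 α with h | h
    · calc x ^ (-(2 * α)) ≤ ((p + q) / 2) ^ (-(2 * α)) :=
          Real.rpow_le_rpow_of_nonpos (by positivity) (by linarith) (by linarith)
        _ = 2 ^ (2 * α) * (p + q) ^ (-(2 * α)) := by
          rw [Real.div_rpow hP.le (by norm_num), Real.rpow_neg (by norm_num : (0 : ℝ) ≤ 2),
            div_inv_eq_mul, mul_comm]
        _ ≤ 4 * (p + q) ^ (-(2 * α)) := by
          refine mul_le_mul_of_nonneg_right ?_ (by positivity)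
          calc (2 : ℝ) ^ (2 * α) ≤ 2 ^ (2 : ℝ) :=
                Real.rpow_le_rpow_of_exponent_le (by norm_num) (by linarith)
            _ = 4 := by norm_num
    · calc x ^ (-(2 * α)) ≤ (p + q) ^ (-(2 * α)) := Real.rpow_le_rpow hx.le h1 (by linarith)
        _ ≤ 4 * (p + q) ^ (-(2 * α)) := by
          have : 0 < (p + q) ^ (-(2 * α)) := by positivity
          linarith
  have e0 : (p + q) ^ (-(2 * α) + s - r) = (p + q) ^ (-(2 * α)) * (p + q) ^ (s - r) := by
    rw [← Real.rpow_add hP]; ring_nf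
  have e1 : q ^ (s - r) ≤ (p + q) ^ (s - r) :=
    Real.rpow_le_rpow hq.le (by linarith) (by linarith)
  have e2 : q ^ (-r) = q ^ (s - r) * q ^ (-s) := by rw [← Real.rpow_add hq]; ring_nf
  rw [e0]
  -- The larger of `p` and `q` is comparable with `p + q` and carries the surplus power; the smaller
  -- one keeps exactly the exponent `-s`. The conditions `2 * α ≤ s` and `r ≤ s` say that the
  -- surplus exponents are nonnegative.
  rcases le_total q p with h | h
  · calc p ^ (-(2 * α)) * q ^ (-r)
          ≤ (4 * (p + q) ^ (-(2 * α))) * ((p + q) ^ (s - r) * q ^ (-s)) := by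
          rw [e2]
          gcongr
          exact aux p hp (by linarith) (by linarith)
      _ = 4 * ((p + q) ^ (-(2 * α)) * (p + q) ^ (s - r)) * q ^ (-s) := by ring
      _ ≤ _ := by
        gcongr
        have : 0 < p ^ (-s) := by positivity
        linarith
  · have e3 : p ^ (-(2 * α)) = p ^ (s - 2 * α) * p ^ (-s) := by
      rw [← Real.rpow_add hp]; ring_nf
    have e4 : p ^ (s - 2 * α) ≤ q ^ (s - 2 * α) := Real.rpow_le_rpow hp.le h (by linarith)
    have e5 : q ^ (s - 2 * α) * q ^ (-r) = q ^ (-(2 * α)) * q ^ (s - r) := by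
      rw [← Real.rpow_add hq, ← Real.rpow_add hq]; ring_nf
    calc p ^ (-(2 * α)) * q ^ (-r) = p ^ (s - 2 * α) * q ^ (-r) * p ^ (-s) := by rw [e3]; ring
      _ ≤ q ^ (s - 2 * α) * q ^ (-r) * p ^ (-s) := by gcongr
      _ = q ^ (-(2 * α)) * q ^ (s - r) * p ^ (-s) := by rw [e5]
      _ ≤ (4 * (p + q) ^ (-(2 * α))) * (p + q) ^ (s - r) * p ^ (-s) := by
        gcongr
        exact aux q hq (by linarith) (by linarith)
      _ = 4 * ((p + q) ^ (-(2 * α)) * (p + q) ^ (s - r)) * p ^ (-s) := by ring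
      _ ≤ _ := by
        gcongr
        have : 0 < q ^ (-s) := by positivity
        linarith

/-- The bound is uniform in `n` because the sum is part of the sum over all integers. The term `m =
n` is `0 ^ (-s) = 0`. -/
theorem tsum_abs_sub_rpow_le {s : ℝ} (hs : 1 < s) :
    ∃ Z : ℝ, 0 ≤ Z ∧ ∀ n : ℕ, Summable (fun m : ℕ => |(n : ℝ) - m| ^ (-s)) ∧
      ∑' m : ℕ, |(n : ℝ) - m| ^ (-s) ≤ Z := by
  have h := Real.summable_abs_int_rpow hs
  refine ⟨∑' k : ℤ, |(k : ℝ)| ^ (-s), tsum_nonneg fun k => by positivity, fun n => ?_⟩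
  have hi : Function.Injective fun m : ℕ => (n : ℤ) - m := fun a b hab => by
    simpa using hab
  have e : (fun m : ℕ => |(n : ℝ) - m| ^ (-s)) =
      (fun k : ℤ => |(k : ℝ)| ^ (-s)) ∘ fun m : ℕ => (n : ℤ) - m := by
    ext m; simp
  rw [e]
  exact ⟨h.comp_injective hi, tsum_comp_le_tsum_of_inj h (fun k => by positivity) hi⟩

theorem summable_succ_rpow {s : ℝ} (hs : 1 < s) :
    Summable (fun m : ℕ => ((m : ℝ) + 1) ^ (-s)) := by
  have h : Summable (fun m : ℕ => (m : ℝ) ^ (-s)) := Real.summable_nat_rpow.2 (by linarith)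
  simpa using (summable_nat_add_iff (f := fun m : ℕ => (m : ℝ) ^ (-s)) 1).2 h

theorem tendsto_succ_rpow_neg {s : ℝ} (hs : 0 < s) :
    Tendsto (fun m : ℕ => ((m : ℝ) + 1) ^ (-s)) atTop (𝓝 0) :=
  (tendsto_rpow_neg_atTop hs).comp
    (tendsto_atTop_add_const_right _ _ tendsto_natCast_atTop_atTop)

variable {α c : ℝ} {N₁ : ℕ}

/-- For `m < n` this is `rpow_mul_rpow_le` with `r = 1` and `s = 3 / 2`, which requires `2 * α ≤ 3 /
2`. For `m > n` the factor `(m + 1) ^ (-(2 * α) + 1 - γ)` splits into a power `-(2 * α + γ - 3 /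
2)`, decreasing and therefore comparable with the one of `n`, and a spare `(m + 1) ^ (-1 / 2)`,
which raises `(m - n) ^ (-1)` to the summable power `-3 / 2`. -/
theorem weight_div_le (hα : α ≤ 3 / 4) (hδ : 3 / 2 < 2 * α + γ) (hc : 0 < c)
    (h : ∀ m n : ℕ, N₁ ≤ n → m < n → c * (((n : ℝ) + 1) ^ (γ - 1) * ((n : ℝ) - m)) ≤ μ n - μ m)
    {n : ℕ} (hn : N₁ ≤ n) (m : ℕ) :
    ((m : ℝ) + 1) ^ (-(2 * α)) / |μ n - μ m| ≤ 4 / c * ((n : ℝ) + 1) ^ (-(2 * α + γ - 3 / 2)) *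
      (((m : ℝ) + 1) ^ (-(3 / 2) : ℝ) + |(n : ℝ) - m| ^ (-(3 / 2) : ℝ)) := by
  rcases lt_trichotomy m n with hmn | rfl | hmn
  · have hq : (0 : ℝ) < (n : ℝ) - m := sub_pos.2 (by exact_mod_cast hmn)
    have hp : (0 : ℝ) < (m : ℝ) + 1 := by positivity
    have hn1 : (0 : ℝ) < (n : ℝ) + 1 := by positivity
    have h1 := h m n hn hmn
    have hpos : 0 < c * (((n : ℝ) + 1) ^ (γ - 1) * ((n : ℝ) - m)) := by positivity
    have h2 := rpow_mul_rpow_le (α := α) (r := 1) (s := 3 / 2) hp hq (by linarith) (by linarith)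
      (by norm_num)
    rw [show (m : ℝ) + 1 + ((n : ℝ) - m) = n + 1 by ring] at h2
    rw [abs_of_pos hq, abs_of_pos (hpos.trans_le h1)]
    calc _ ≤ ((m : ℝ) + 1) ^ (-(2 * α)) / (c * (((n : ℝ) + 1) ^ (γ - 1) * ((n : ℝ) - m))) := by
          gcongr
      _ = 1 / c * ((n : ℝ) + 1) ^ (1 - γ) * (((m : ℝ) + 1) ^ (-(2 * α)) * ((n : ℝ) - m) ^ (-1 : ℝ))
          := by
        rw [Real.rpow_neg_one, show 1 - γ = -(γ - 1) by ring, Real.rpow_neg hn1.le]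
        field_simp
      _ ≤ 1 / c * ((n : ℝ) + 1) ^ (1 - γ) * (4 * ((n : ℝ) + 1) ^ (-(2 * α) + 3 / 2 - 1) *
          (((m : ℝ) + 1) ^ (-(3 / 2) : ℝ) + ((n : ℝ) - m) ^ (-(3 / 2) : ℝ))) := by
        gcongr
      _ = _ := by
        rw [show -(2 * α + γ - 3 / 2) = (1 - γ) + (-(2 * α) + 3 / 2 - 1) by ring,
          Real.rpow_add hn1]
        ring
  -- The diagonal term vanishes because division by zero gives zero; all sums over inverse gaps thus
  -- omit `m = n` tacitly.
  · simp only [sub_self, abs_zero, div_zero]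
    positivity
  · have hq : (0 : ℝ) < (m : ℝ) - n := sub_pos.2 (by exact_mod_cast hmn)
    have hp : (0 : ℝ) < (m : ℝ) + 1 := by positivity
    have hn1 : (0 : ℝ) < (n : ℝ) + 1 := by positivity
    have hm0 : (0 : ℝ) ≤ n := by positivity
    have h1 := h n m (by omega) hmn
    have hpos : 0 < c * (((m : ℝ) + 1) ^ (γ - 1) * ((m : ℝ) - n)) := by positivity
    rw [abs_sub_comm (μ n), abs_sub_comm (n : ℝ), abs_of_pos hq, abs_of_pos (hpos.trans_le h1)]
    calc _ ≤ ((m : ℝ) + 1) ^ (-(2 * α)) / (c * (((m : ℝ) + 1) ^ (γ - 1) * ((m : ℝ) - n))) := by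
          gcongr
      _ = 1 / c * (((m : ℝ) + 1) ^ (-(2 * α)) * ((m : ℝ) + 1) ^ (1 - γ)) *
          ((m : ℝ) - n) ^ (-1 : ℝ) := by
        rw [Real.rpow_neg_one, show 1 - γ = -(γ - 1) by ring, Real.rpow_neg hp.le (γ - 1)]
        field_simp
      _ = 1 / c * ((m : ℝ) + 1) ^ (-(2 * α + γ - 3 / 2)) * (((m : ℝ) + 1) ^ (-(1 / 2) : ℝ) *
          ((m : ℝ) - n) ^ (-1 : ℝ)) := by
        rw [← Real.rpow_add hp, mul_assoc, mul_assoc, ← mul_assoc (((m : ℝ) + 1) ^ _),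
          ← Real.rpow_add hp]
        ring_nf
      _ ≤ 1 / c * ((n : ℝ) + 1) ^ (-(2 * α + γ - 3 / 2)) * (((m : ℝ) - n) ^ (-(1 / 2) : ℝ) *
          ((m : ℝ) - n) ^ (-1 : ℝ)) := by
        gcongr 1 / c * ?_ * (?_ * _)
        · exact Real.rpow_le_rpow_of_nonpos hn1 (by linarith) (by linarith)
        · exact Real.rpow_le_rpow_of_nonpos hq (by linarith) (by norm_num)
      _ = 1 / c * ((n : ℝ) + 1) ^ (-(2 * α + γ - 3 / 2)) * ((m : ℝ) - n) ^ (-(3 / 2) : ℝ) := by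
        rw [← Real.rpow_add hq]; norm_num
      _ ≤ _ := by
        have : 0 < ((m : ℝ) + 1) ^ (-(3 / 2) : ℝ) := by positivity
        gcongr
        · norm_num
        · linarith

/-- Apply `rpow_mul_rpow_le` with `r = s = 2`. The three powers of `n + 1`, from the weight, the
squared gap and the mixed product, combine to `-(4 * α + 2 * γ - 2)`, which is below `-1` when `2 *
α + γ > 3 / 2`. -/
theorem weight_div_sq_le_aux (hα : α ≤ 3 / 4) (hc : 0 < c)
    (h : ∀ m n : ℕ, N₁ ≤ n → m < n → c * (((n : ℝ) + 1) ^ (γ - 1) * ((n : ℝ) - m)) ≤ μ n - μ m)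
    {n m : ℕ} (hn : N₁ ≤ n) (hmn : m < n) :
    ((n : ℝ) + 1) ^ (-(2 * α)) * (((m : ℝ) + 1) ^ (-(2 * α)) / |μ n - μ m| ^ 2) ≤
      4 / c ^ 2 * ((n : ℝ) + 1) ^ (-(4 * α + 2 * γ - 2)) *
      (((m : ℝ) + 1) ^ (-2 : ℝ) + |(n : ℝ) - m| ^ (-2 : ℝ)) := by
  have hq : (0 : ℝ) < (n : ℝ) - m := sub_pos.2 (by exact_mod_cast hmn)
  have hp : (0 : ℝ) < (m : ℝ) + 1 := by positivity
  have hn1 : (0 : ℝ) < (n : ℝ) + 1 := by positivity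
  have h1 := h m n hn hmn
  have hpos : 0 < c * (((n : ℝ) + 1) ^ (γ - 1) * ((n : ℝ) - m)) := by positivity
  have h2 := rpow_mul_rpow_le (α := α) (r := 2) (s := 2) hp hq (by linarith) (by linarith) le_rfl
  rw [show (m : ℝ) + 1 + ((n : ℝ) - m) = n + 1 by ring] at h2
  rw [abs_of_pos hq, abs_of_pos (hpos.trans_le h1)]
  calc _ ≤ ((n : ℝ) + 1) ^ (-(2 * α)) * (((m : ℝ) + 1) ^ (-(2 * α)) /
          (c * (((n : ℝ) + 1) ^ (γ - 1) * ((n : ℝ) - m))) ^ 2) := by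
        gcongr
    _ = 1 / c ^ 2 * (((n : ℝ) + 1) ^ (-(2 * α)) * ((n : ℝ) + 1) ^ (2 * (1 - γ))) *
        (((m : ℝ) + 1) ^ (-(2 * α)) * ((n : ℝ) - m) ^ (-2 : ℝ)) := by
      have e1 : ((n : ℝ) + 1) ^ (2 * (1 - γ)) = ((((n : ℝ) + 1) ^ (γ - 1)) ^ 2)⁻¹ := by
        rw [← Real.rpow_natCast, ← Real.rpow_mul hn1.le, ← Real.rpow_neg hn1.le]
        push_cast; ring_nf
      have e2 : ((n : ℝ) - m) ^ (-2 : ℝ) = (((n : ℝ) - m) ^ 2)⁻¹ := by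
        rw [← Real.rpow_natCast, ← Real.rpow_neg hq.le]; norm_num
      rw [e1, e2]
      field_simp
    _ ≤ 1 / c ^ 2 * (((n : ℝ) + 1) ^ (-(2 * α)) * ((n : ℝ) + 1) ^ (2 * (1 - γ))) *
        (4 * ((n : ℝ) + 1) ^ (-(2 * α) + 2 - 2) *
        (((m : ℝ) + 1) ^ (-2 : ℝ) + ((n : ℝ) - m) ^ (-2 : ℝ))) := by
      gcongr
    _ = 1 / c ^ 2 * ((((n : ℝ) + 1) ^ (-(2 * α)) * ((n : ℝ) + 1) ^ (2 * (1 - γ))) *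
        ((n : ℝ) + 1) ^ (-(2 * α) + 2 - 2)) * 4 *
        (((m : ℝ) + 1) ^ (-2 : ℝ) + ((n : ℝ) - m) ^ (-2 : ℝ)) := by ring
    _ = _ := by
      rw [← Real.rpow_add hn1, ← Real.rpow_add hn1]
      ring_nf

/-- The left side is symmetric in `m` and `n`, so the case `m > n` is the previous bound with the
roles exchanged. The last summand on the right is there for this case. -/
theorem weight_div_sq_le (hα : α ≤ 3 / 4) (hδ : 3 / 2 < 2 * α + γ) (hc : 0 < c)
    (h : ∀ m n : ℕ, N₁ ≤ n → m < n → c * (((n : ℝ) + 1) ^ (γ - 1) * ((n : ℝ) - m)) ≤ μ n - μ m)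
    {n : ℕ} (hn : N₁ ≤ n) (m : ℕ) :
    ((n : ℝ) + 1) ^ (-(2 * α)) * (((m : ℝ) + 1) ^ (-(2 * α)) / |μ n - μ m| ^ 2) ≤
      4 / c ^ 2 * (((n : ℝ) + 1) ^ (-(4 * α + 2 * γ - 2)) *
      (((m : ℝ) + 1) ^ (-2 : ℝ) + |(n : ℝ) - m| ^ (-2 : ℝ)) +
      ((n : ℝ) + 1) ^ (-2 : ℝ) * ((m : ℝ) + 1) ^ (-(4 * α + 2 * γ - 2))) := by
  rcases lt_trichotomy m n with hmn | rfl | hmn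
  · refine (weight_div_sq_le_aux hα hc h hn hmn).trans ?_
    rw [mul_assoc]
    gcongr
    have : 0 ≤ ((n : ℝ) + 1) ^ (-2 : ℝ) * ((m : ℝ) + 1) ^ (-(4 * α + 2 * γ - 2)) := by positivity
    linarith
  · simp only [sub_self, abs_zero, ne_eq, OfNat.ofNat_ne_zero, not_false_eq_true, zero_pow,
      div_zero, mul_zero]
    positivity
  · have h1 := weight_div_sq_le_aux hα hc h (n := m) (m := n) (by omega) hmn
    rw [abs_sub_comm (μ n), abs_sub_comm (n : ℝ)]
    have hn1 : (0 : ℝ) < (n : ℝ) + 1 := by positivity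
    have hmn' : (n : ℝ) ≤ m := by exact_mod_cast hmn.le
    calc _ = ((m : ℝ) + 1) ^ (-(2 * α)) * (((n : ℝ) + 1) ^ (-(2 * α)) / |μ m - μ n| ^ 2) := by ring
      _ ≤ _ := h1
      _ = 4 / c ^ 2 * (((m : ℝ) + 1) ^ (-(4 * α + 2 * γ - 2)) * |(m : ℝ) - n| ^ (-2 : ℝ) +
        ((n : ℝ) + 1) ^ (-2 : ℝ) * ((m : ℝ) + 1) ^ (-(4 * α + 2 * γ - 2))) := by ring
      _ ≤ 4 / c ^ 2 * (((n : ℝ) + 1) ^ (-(4 * α + 2 * γ - 2)) *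
        (((m : ℝ) + 1) ^ (-2 : ℝ) + |(m : ℝ) - n| ^ (-2 : ℝ)) +
        ((n : ℝ) + 1) ^ (-2 : ℝ) * ((m : ℝ) + 1) ^ (-(4 * α + 2 * γ - 2))) := by
        gcongr 4 / c ^ 2 * (?_ * ?_ + _)
        · exact Real.rpow_le_rpow_of_nonpos hn1 (by linarith) (by linarith)
        · have : 0 < ((m : ℝ) + 1) ^ (-2 : ℝ) := by positivity
          linarith

/-- The termwise bound is a uniformly summable sequence times a negative power of `n + 1`. The limit
zero is the smallness that makes the fixed point map for the eigenvectors a contraction. -/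
theorem tendsto_tsum_weight_div (hα : α ≤ 3 / 4) (hδ : 3 / 2 < 2 * α + γ) (hc : 0 < c)
    (h : ∀ m n : ℕ, N₁ ≤ n → m < n → c * (((n : ℝ) + 1) ^ (γ - 1) * ((n : ℝ) - m)) ≤ μ n - μ m) :
    (∀ n : ℕ, N₁ ≤ n → Summable fun m : ℕ => ((m : ℝ) + 1) ^ (-(2 * α)) / |μ n - μ m|) ∧
    Tendsto (fun n => ∑' m : ℕ, ((m : ℝ) + 1) ^ (-(2 * α)) / |μ n - μ m|) atTop (𝓝 0) := by
  obtain ⟨Z, hZ, hZs⟩ := tsum_abs_sub_rpow_le (s := 3 / 2) (by norm_num)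
  have hs := summable_succ_rpow (s := 3 / 2) (by norm_num)
  have hb : ∀ n : ℕ, Summable fun m : ℕ => 4 / c * ((n : ℝ) + 1) ^ (-(2 * α + γ - 3 / 2)) *
      (((m : ℝ) + 1) ^ (-(3 / 2) : ℝ) + |(n : ℝ) - m| ^ (-(3 / 2) : ℝ)) := fun n =>
    (hs.add (hZs n).1).mul_left _
  have hsum : ∀ n : ℕ, N₁ ≤ n → Summable fun m : ℕ => ((m : ℝ) + 1) ^ (-(2 * α)) / |μ n - μ m| :=
    fun n hn => Summable.of_nonneg_of_le (fun m => by positivity)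
      (fun m => weight_div_le hα hδ hc h hn m) (hb n)
  refine ⟨hsum, ?_⟩
  have ht := (tendsto_succ_rpow_neg (s := 2 * α + γ - 3 / 2) (by linarith)).const_mul
    (4 / c * (∑' m : ℕ, ((m : ℝ) + 1) ^ (-(3 / 2) : ℝ) + Z))
  rw [mul_zero] at ht
  refine squeeze_zero' (Eventually.of_forall fun n => tsum_nonneg fun m => by positivity) ?_ ht
  filter_upwards [eventually_ge_atTop N₁] with n hn
  refine ((hsum n hn).tsum_le_tsum (fun m => weight_div_le hα hδ hc h hn m) (hb n)).trans ?_
  rw [tsum_mul_left, (hs.tsum_add (hZs n).1)]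
  have := (hZs n).2
  calc _ ≤ 4 / c * ((n : ℝ) + 1) ^ (-(2 * α + γ - 3 / 2)) *
      (∑' m : ℕ, ((m : ℝ) + 1) ^ (-(3 / 2) : ℝ) + Z) := by gcongr
    _ = _ := by ring

/-- After summation over `m` the bound is a combination of the powers `-(4 * α + 2 * γ - 2)` and
`-2` of `n + 1`, both summable. Up to a constant, the sum bounds the total squared distance of the
eigenvectors from the basis. -/
theorem summable_tsum_weight_div_sq (hα : α ≤ 3 / 4) (hδ : 3 / 2 < 2 * α + γ) (hc : 0 < c)
    (h : ∀ m n : ℕ, N₁ ≤ n → m < n → c * (((n : ℝ) + 1) ^ (γ - 1) * ((n : ℝ) - m)) ≤ μ n - μ m) :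
    (∀ n : ℕ, N₁ ≤ n → Summable fun m : ℕ => ((m : ℝ) + 1) ^ (-(2 * α)) / |μ n - μ m| ^ 2) ∧
    Summable fun n : ℕ => ((n : ℝ) + 1) ^ (-(2 * α)) *
      ∑' m : ℕ, ((m : ℝ) + 1) ^ (-(2 * α)) / |μ n - μ m| ^ 2 := by
  obtain ⟨Z, hZ, hZs⟩ := tsum_abs_sub_rpow_le (s := 2) (by norm_num)
  have hs := summable_succ_rpow (s := 2) (by norm_num)
  have hs' := summable_succ_rpow (s := 4 * α + 2 * γ - 2) (by linarith)
  have hb : ∀ n : ℕ, Summable fun m : ℕ => 4 / c ^ 2 * (((n : ℝ) + 1) ^ (-(4 * α + 2 * γ - 2)) *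
      (((m : ℝ) + 1) ^ (-2 : ℝ) + |(n : ℝ) - m| ^ (-2 : ℝ)) +
      ((n : ℝ) + 1) ^ (-2 : ℝ) * ((m : ℝ) + 1) ^ (-(4 * α + 2 * γ - 2))) := fun n =>
    (((hs.add (hZs n).1).mul_left _).add (hs'.mul_left _)).mul_left _
  have hsum' : ∀ n : ℕ, N₁ ≤ n → Summable fun m : ℕ => ((n : ℝ) + 1) ^ (-(2 * α)) *
      (((m : ℝ) + 1) ^ (-(2 * α)) / |μ n - μ m| ^ 2) := fun n hn =>
    Summable.of_nonneg_of_le (fun m => by positivity)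
      (fun m => weight_div_sq_le hα hδ hc h hn m) (hb n)
  refine ⟨fun n hn => (summable_mul_left_iff (by positivity)).1 (hsum' n hn), ?_⟩
  rw [← summable_nat_add_iff N₁]
  have hbound : ∀ n : ℕ, N₁ ≤ n → ((n : ℝ) + 1) ^ (-(2 * α)) *
      ∑' m : ℕ, ((m : ℝ) + 1) ^ (-(2 * α)) / |μ n - μ m| ^ 2 ≤
      4 / c ^ 2 * (((n : ℝ) + 1) ^ (-(4 * α + 2 * γ - 2)) *
        (∑' m : ℕ, ((m : ℝ) + 1) ^ (-2 : ℝ) + Z) +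
        ((n : ℝ) + 1) ^ (-2 : ℝ) * ∑' m : ℕ, ((m : ℝ) + 1) ^ (-(4 * α + 2 * γ - 2))) :=
    fun n hn => by
    rw [← tsum_mul_left]
    refine ((hsum' n hn).tsum_le_tsum (fun m => weight_div_sq_le hα hδ hc h hn m) (hb n)).trans ?_
    rw [tsum_mul_left, ((hs.add (hZs n).1).mul_left _).tsum_add (hs'.mul_left _), tsum_mul_left,
      tsum_mul_left, hs.tsum_add (hZs n).1]
    have := (hZs n).2
    gcongr
  generalize (∑' m : ℕ, ((m : ℝ) + 1) ^ (-2 : ℝ) + Z) = Z₁ at hbound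
  generalize (∑' m : ℕ, ((m : ℝ) + 1) ^ (-(4 * α + 2 * γ - 2))) = Z₂ at hbound
  have hfin : Summable fun n : ℕ => 4 / c ^ 2 * (((n : ℝ) + 1) ^ (-(4 * α + 2 * γ - 2)) * Z₁ +
      ((n : ℝ) + 1) ^ (-2 : ℝ) * Z₂) := ((hs'.mul_right Z₁).add (hs.mul_right Z₂)).mul_left _
  exact Summable.of_nonneg_of_le
    (fun n => mul_nonneg (by positivity) (tsum_nonneg fun m => by positivity))
    (fun n => hbound _ (Nat.le_add_left _ _)) ((summable_nat_add_iff N₁).2 hfin)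

end Estimates

/-! ### Jordan bases in finite dimension. -/

section Jordan

open Module

/-- `e 0, …, e (n - 1)` is a basis of consecutive Jordan chains of `f`, with eigenvalues `lam`. -/
structure IsJordanBasis {Y : Type*} [AddCommGroup Y] [Module ℂ Y] (f : End ℂ Y) (n : ℕ)
    (e : ℕ → Y) (lam : ℕ → ℂ) : Prop where
  finrank_eq : n = finrank ℂ Y
  span_eq : Submodule.span ℂ (e '' Set.Iio n) = ⊤
  chain : ∀ i < n, f (e i) = lam i • e i ∨
    ∃ j, i = j + 1 ∧ lam i = lam j ∧ f (e i) = lam i • e i + e j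

variable {Y : Type*} [AddCommGroup Y] [Module ℂ Y]

/-- A cyclic subspace of maximal height at an eigenvalue has an invariant complement. -/
theorem exists_cyclic_complement [FiniteDimensional ℂ Y] [Nontrivial Y] (f : End ℂ Y) :
    ∃ (lam : ℂ) (k : ℕ) (v : Y) (W : Submodule ℂ Y),
      ((f - lam • 1) ^ (k + 1)) v = 0 ∧ (∀ w ∈ W, f w ∈ W) ∧
      finrank ℂ W + (k + 1) = finrank ℂ Y ∧
      ∀ y, ∃ a : Fin (k + 1) → ℂ, y - ∑ i, a i • ((f - lam • 1) ^ (i : ℕ)) v ∈ W := by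
  classical
  obtain ⟨lam, hlam⟩ := End.exists_eigenvalue f
  set g : End ℂ Y := f - lam • 1 with hg
  -- The height of the longest chain is the first exponent at which the kernels of the powers of `g`
  -- stop growing.
  have hex : ∃ k, LinearMap.ker (g ^ k) = LinearMap.ker (g ^ (k + 1)) := by
    refine ⟨finrank ℂ Y, ?_⟩
    exact (End.ker_pow_eq_ker_pow_finrank_of_le (f := g) (Nat.le_succ _)).symm
  obtain ⟨k', hk', hmin⟩ : ∃ k, LinearMap.ker (g ^ k) = LinearMap.ker (g ^ (k + 1)) ∧
      ∀ m < k, LinearMap.ker (g ^ m) ≠ LinearMap.ker (g ^ (m + 1)) :=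
    ⟨Nat.find hex, Nat.find_spec hex, fun m hm => Nat.find_min hex hm⟩
  have hk0 : k' ≠ 0 := by
    rintro rfl
    obtain ⟨x, hx⟩ := hlam.exists_hasEigenvector
    have h1 : x ∈ LinearMap.ker (g ^ (0 + 1)) := by
      simp [hg, hx.apply_eq_smul]
    rw [← hk'] at h1
    exact hx.2 (by simpa using h1)
  obtain ⟨k, rfl⟩ := Nat.exists_eq_succ_of_ne_zero hk0
  obtain ⟨v, hv1, hv0⟩ : ∃ v, (g ^ (k + 1)) v = 0 ∧ (g ^ k) v ≠ 0 := by
    by_contra! hcon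
    refine hmin k (Nat.lt_succ_self k) (le_antisymm (fun x hx => ?_) fun x hx => ?_)
    · rw [LinearMap.mem_ker] at hx ⊢
      rw [pow_succ', Module.End.mul_apply, hx, map_zero]
    · rw [LinearMap.mem_ker] at hx ⊢
      exact hcon x hx
  -- A preimage `w` of `(g ^ k) v` would satisfy `(g ^ (k + 2)) w = 0`. As the kernels are already
  -- stable, this gives `(g ^ k) v = (g ^ (k + 1)) w = 0`.
  have hnr : (g ^ k) v ∉ LinearMap.range (g ^ (k + 1)) := by
    rintro ⟨w, hw⟩
    have h1 : w ∈ LinearMap.ker (g ^ (k.succ + 1)) := by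
      rw [LinearMap.mem_ker, pow_succ', Module.End.mul_apply]
      change g ((g ^ (k + 1)) w) = 0
      rw [hw, ← Module.End.mul_apply, ← pow_succ', hv1]
    rw [← hk'] at h1
    exact hv0 (by rw [← hw]; exact h1)
  obtain ⟨ℓ, hℓv, hℓ⟩ := Submodule.exists_le_ker_of_notMem hnr
  have hℓ' : ∀ j, k + 1 ≤ j → ∀ y, ℓ ((g ^ j) y) = 0 := fun j hj y => by
    obtain ⟨i, rfl⟩ := Nat.exists_eq_add_of_le hj
    rw [pow_add, Module.End.mul_apply]
    exact hℓ ⟨_, rfl⟩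
  -- The complement is the kernel of `Φ`. On the chain of `v`, `Φ` has the Hankel matrix `ℓ ((g ^ (i
  -- + j)) v)`, which vanishes for `i + j > k` and is nonzero for `i + j = k`, hence is invertible.
  let Φ : Y →ₗ[ℂ] (Fin (k + 1) → ℂ) := LinearMap.pi fun j => ℓ ∘ₗ (g ^ (j : ℕ))
  let Ψ : (Fin (k + 1) → ℂ) →ₗ[ℂ] Y :=
    ∑ i : Fin (k + 1), (LinearMap.proj i).smulRight ((g ^ (i : ℕ)) v)
  have hΨ : ∀ a, Ψ a = ∑ i : Fin (k + 1), a i • ((g ^ (i : ℕ)) v) := fun a => by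
    simp [Ψ]
  have hinj : Function.Injective (Φ ∘ₗ Ψ) := by
    rw [← LinearMap.ker_eq_bot, LinearMap.ker_eq_bot']
    intro a ha
    have h1 : ∀ j : Fin (k + 1),
        ∑ i : Fin (k + 1), a i * ℓ ((g ^ ((j : ℕ) + i)) v) = 0 := fun j => by
      have := congrFun ha j
      simp only [LinearMap.comp_apply, hΨ, Φ, LinearMap.pi_apply, map_sum, map_smul, smul_eq_mul,
        Pi.zero_apply] at this
      rw [← this]
      exact Finset.sum_congr rfl fun i _ => by rw [pow_add, Module.End.mul_apply]
    have h2 : ∀ i : ℕ, ∀ hi : i < k + 1, a ⟨i, hi⟩ = 0 := by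
      intro i
      induction i using Nat.strong_induction_on with
      | _ i ih =>
        intro hi
        have h3 := h1 ⟨k - i, by omega⟩
        rw [Finset.sum_eq_single ⟨i, hi⟩] at h3
        · simp only [Nat.sub_add_cancel (Nat.lt_succ_iff.1 hi)] at h3
          exact (mul_eq_zero.1 h3).resolve_right hℓv
        · intro i' _ hne
          rcases lt_trichotomy (i' : ℕ) i with h | h | h
          · rw [ih i' h i'.2, zero_mul]
          · exact absurd (Fin.ext h) hne
          · simp only
            rw [hℓ' _ (by omega), mul_zero]
        · simp
    ext i
    exact h2 i i.2
  have hsurj : Function.Surjective (Φ ∘ₗ Ψ) := LinearMap.injective_iff_surjective.1 hinj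
  refine ⟨lam, k, v, LinearMap.ker Φ, hv1, fun w hw => ?_, ?_, fun y => ?_⟩
  · have h1 : ∀ j : ℕ, ℓ ((g ^ j) w) = 0 := fun j => by
      rcases lt_or_ge j (k + 1) with hj | hj
      · exact congrFun hw ⟨j, hj⟩
      · exact hℓ' j hj w
    have h2 : f w = g w + lam • w := by simp [hg]
    ext j
    simp only [Φ, LinearMap.pi_apply, LinearMap.comp_apply, h2, map_add, map_smul, Pi.zero_apply]
    rw [h1, ← Module.End.mul_apply, ← pow_succ, h1]
    simp
  · have h1 := LinearMap.finrank_range_add_finrank_ker Φ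
    have h2 : LinearMap.range Φ = ⊤ :=
      LinearMap.range_eq_top.2 (Function.Surjective.of_comp (g := Ψ) hsurj)
    rw [h2, finrank_top, finrank_fintype_fun_eq_card, Fintype.card_fin] at h1
    omega
  · obtain ⟨a, ha⟩ := hsurj (Φ y)
    refine ⟨a, ?_⟩
    rw [LinearMap.mem_ker, map_sub, ← hΨ, ← ha, LinearMap.comp_apply, sub_self]

theorem exists_isJordanBasis_aux (d : ℕ) : ∀ {Y : Type*} [AddCommGroup Y] [Module ℂ Y]
    [FiniteDimensional ℂ Y] (f : End ℂ Y), finrank ℂ Y = d →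
    ∃ e lam, IsJordanBasis f d e lam := by
  induction d using Nat.strong_induction_on with
  | _ d ih =>
    intro Y _ _ _ f hd
    rcases subsingleton_or_nontrivial Y with hY | hY
    · refine ⟨fun _ => 0, fun _ => 0, hd.symm, Subsingleton.elim _ _, fun i hi => ?_⟩
      exact Or.inl (Subsingleton.elim _ _)
    obtain ⟨z, k, v, W, hv, hW, hrank, hdec⟩ := exists_cyclic_complement f
    set g : End ℂ Y := f - z • 1 with hg
    obtain ⟨e', lam', hJ⟩ := ih (finrank ℂ W) (by omega) (f.restrict hW) rfl
    -- The chain is listed from the eigenvector `(g ^ k) v` up to `v`, so that `g` maps each member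
    -- to its predecessor.
    let e : ℕ → Y := fun i => if i < k + 1 then (g ^ (k - i)) v else e' (i - (k + 1))
    let lam : ℕ → ℂ := fun i => if i < k + 1 then z else lam' (i - (k + 1))
    have hneg : ∀ j, ¬ j + (k + 1) < k + 1 := fun j => by omega
    have hf : ∀ y, f y = z • y + g y := fun y => by simp [hg]
    refine ⟨e, lam, hd.symm, ?_, fun i hi => ?_⟩
    · have h1 : ∀ i < k + 1, (g ^ i) v ∈ Submodule.span ℂ (e '' Set.Iio d) := fun i hi => by
        refine Submodule.subset_span ⟨k - i, Set.mem_Iio.2 (by omega), ?_⟩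
        simp only [e]
        rw [if_pos (by omega), show k - (k - i) = i by omega]
      have h2 : W ≤ Submodule.span ℂ (e '' Set.Iio d) := by
        have h3 : W = (Submodule.span ℂ (e' '' Set.Iio (finrank ℂ W))).map W.subtype := by
          rw [hJ.span_eq, Submodule.map_top, Submodule.range_subtype]
        rw [h3, Submodule.map_span]
        refine Submodule.span_mono ?_
        rintro _ ⟨_, ⟨i, hi, rfl⟩, rfl⟩
        refine ⟨i + (k + 1), ?_, ?_⟩
        · simp only [Set.mem_Iio] at hi ⊢
          omega
        · simp only [e, if_neg (hneg i), Nat.add_sub_cancel, Submodule.subtype_apply]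
      rw [eq_top_iff]
      intro y _
      obtain ⟨a, ha⟩ := hdec y
      rw [← sub_add_cancel y (∑ i, a i • (g ^ (i : ℕ)) v)]
      exact add_mem (h2 ha) (sum_mem fun i _ => Submodule.smul_mem _ _ (h1 i i.2))
    · by_cases hik : i < k + 1
      · rcases Nat.eq_zero_or_pos i with rfl | hi0
        · left
          simp only [e, lam, if_pos hik, Nat.sub_zero]
          rw [hf, ← Module.End.mul_apply, ← pow_succ', hv, add_zero]
        · right
          refine ⟨i - 1, by omega, ?_, ?_⟩
          · simp only [lam]
            rw [if_pos hik, if_pos (by omega)]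
          · simp only [e, lam]
            rw [if_pos hik, if_pos hik, if_pos (by omega), hf, ← Module.End.mul_apply, ← pow_succ',
              show k - i + 1 = k - (i - 1) by omega]
      · have h1 := hJ.chain (i - (k + 1)) (by omega)
        simp only [e, lam, if_neg hik]
        rcases h1 with h1 | ⟨j, hj, hl, h1⟩
        · left
          simpa using congrArg Subtype.val h1
        · right
          refine ⟨j + (k + 1), by omega, ?_, ?_⟩
          · simp only [if_neg (hneg j), Nat.add_sub_cancel]
            exact hl
          · simp only [if_neg (hneg j), Nat.add_sub_cancel]
            exact congrArg Subtype.val h1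

/-- Every endomorphism of a finite-dimensional complex space has a Jordan basis. -/
theorem exists_isJordanBasis [FiniteDimensional ℂ Y] (f : End ℂ Y) :
    ∃ e lam, IsJordanBasis f (finrank ℂ Y) e lam :=
  exists_isJordanBasis_aux _ f rfl

variable {f : End ℂ Y} {n : ℕ} {e : ℕ → Y} {lam : ℕ → ℂ}

theorem IsJordanBasis.linearIndependent (h : IsJordanBasis f n e lam) :
    LinearIndependent ℂ (fun i : Fin n => e i) := by
  refine linearIndependent_of_top_le_span_of_card_eq_finrank ?_ (by simpa using h.finrank_eq)
  rw [← h.span_eq]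
  refine Submodule.span_mono ?_
  rintro _ ⟨i, hi, rfl⟩
  exact ⟨⟨i, hi⟩, rfl⟩

theorem IsJordanBasis.mem_maxGenEigenspace (h : IsJordanBasis f n e lam) :
    ∀ i < n, e i ∈ f.maxGenEigenspace (lam i) := by
  intro i
  induction i with
  | zero =>
    intro hi
    rcases h.chain 0 hi with h1 | ⟨j, hj, -⟩
    · rw [End.mem_maxGenEigenspace]
      exact ⟨1, by simp [h1]⟩
    · omega
  | succ i ih =>
    intro hi
    rw [End.mem_maxGenEigenspace]
    rcases h.chain (i + 1) hi with h1 | ⟨j, hj, hl, h1⟩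
    · exact ⟨1, by simp [h1]⟩
    · obtain rfl : i = j := by omega
      obtain ⟨k, hk⟩ := (End.mem_maxGenEigenspace _ _ _).1 (ih (by omega))
      refine ⟨k + 1, ?_⟩
      rw [pow_succ, Module.End.mul_apply]
      have : (f - lam (i + 1) • 1) (e (i + 1)) = e i := by simp [h1]
      rw [this, hl, hk]

/-- The spans of the basis vectors with a common eigenvalue together fill the space and lie in the
generalised eigenspaces. As these are independent, each span exhausts its eigenspace. -/
theorem IsJordanBasis.maxGenEigenspace_le (h : IsJordanBasis f n e lam) (z : ℂ) :
    f.maxGenEigenspace z ≤ Submodule.span ℂ (e '' {i | i < n ∧ lam i = z}) := by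
  set S : ℂ → Submodule ℂ Y := fun w => Submodule.span ℂ (e '' {i | i < n ∧ lam i = w})
  have hS : ∀ w, S w ≤ f.maxGenEigenspace w := fun w => by
    rw [Submodule.span_le]
    rintro _ ⟨i, ⟨hi, rfl⟩, rfl⟩
    exact h.mem_maxGenEigenspace i hi
  have htop : ⊤ ≤ S z ⊔ ⨆ w, ⨆ (_ : w ≠ z), S w := by
    rw [← h.span_eq, Submodule.span_le]
    rintro _ ⟨i, hi, rfl⟩
    have h1 : e i ∈ S (lam i) := Submodule.subset_span ⟨i, ⟨hi, rfl⟩, rfl⟩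
    by_cases hz : lam i = z
    · exact Submodule.mem_sup_left (hz ▸ h1)
    · exact Submodule.mem_sup_right
        (Submodule.mem_iSup_of_mem (lam i) (Submodule.mem_iSup_of_mem hz h1))
  intro u hu
  obtain ⟨s, hs, t, ht, rfl⟩ := Submodule.mem_sup.1 (htop (Submodule.mem_top (x := u)))
  have h1 : t ∈ f.maxGenEigenspace z := by
    simpa using sub_mem hu (hS z hs)
  have h2 : t ∈ ⨆ w, ⨆ (_ : w ≠ z), f.maxGenEigenspace w :=
    (iSup₂_mono fun w _ => hS w) ht
  have h3 : t = 0 := by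
    have := (End.independent_maxGenEigenspace f) z
    exact (Submodule.disjoint_def.1 this) t h1 h2
  rw [h3, add_zero]
  exact hs

end Jordan

/-! ### The square root of the unperturbed operator. -/

section EnergyMap

variable {H : Type*} [NormedAddCommGroup H] [InnerProductSpace ℂ H]
  {V : Submodule ℂ H} {a : V →ₗ[ℂ] V →ₗ⋆[ℂ] ℂ}

theorem mem_graph_formOperator_iff (hV : Dense (V : Set H)) (t : V →ₗ[ℂ] V →ₗ⋆[ℂ] ℂ) (u f : H) :
    (∃ hu : u ∈ (formOperator t).domain, formOperator t ⟨u, hu⟩ = f) ↔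
      ∃ hu : u ∈ V, ∀ v : V, t ⟨u, hu⟩ v = inner ℂ (v : H) f := by
  have h1 : (∃ hu : u ∈ (formOperator t).domain, formOperator t ⟨u, hu⟩ = f) ↔
      (u, f) ∈ (formOperator t).graph := by
    rw [LinearPMap.mem_graph_iff]
    constructor
    · rintro ⟨hu, h⟩
      exact ⟨⟨u, hu⟩, rfl, h⟩
    · rintro ⟨⟨y, hy⟩, h, h'⟩
      simp only at h
      subst h
      exact ⟨hy, h'⟩
  rw [h1, formOperator_graph hV]
  rfl

/-- `J` is the square root of the operator of the form `a` with eigenpairs `μ k, ψ k`. -/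
structure IsEnergyMap (a : V →ₗ[ℂ] V →ₗ⋆[ℂ] ℂ) (μ : ℕ → ℝ) (ψ : HilbertBasis ℕ ℂ H)
    (J : V ≃ₗ[ℂ] H) : Prop where
  coef_apply : ∀ u k, coef ψ k (J u) = (√(μ k) : ℂ) * coef ψ k (u : H)
  form_eq : ∀ u v, a u v = inner ℂ (J v) (J u)

/-- Polarisation with `u + v` and `u + i v`. -/
theorem eq_zero_of_diag (B : V →ₗ[ℂ] V →ₗ⋆[ℂ] ℂ) (h : ∀ u, B u u = 0) (u v : V) : B u v = 0 := by
  have h1 := h (u + v)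
  have h2 := h (u + Complex.I • v)
  simp only [map_add, LinearMap.add_apply, h, map_smul, LinearMap.smul_apply, smul_eq_mul,
    LinearMap.map_smulₛₗ, Complex.conj_I, zero_add, add_zero, mul_zero] at h1 h2
  have h3 : Complex.I * (B v u - B u v) = 0 := by linear_combination h2
  have h4 := (mul_eq_zero.1 h3).resolve_left Complex.I_ne_zero
  linear_combination (1 / 2 : ℂ) * h1 - (1 / 2 : ℂ) * h4

variable {μ : ℕ → ℝ} {ψ : HilbertBasis ℕ ℂ H}

section Eigen

variable (ha : IsHermitianPosDef a) (hψV : ∀ k, ψ k ∈ V)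
  (hψa : ∀ k v, a ⟨ψ k, hψV k⟩ v = μ k * inner ℂ (v : H) (ψ k))
include ha hψa

theorem form_basis_right (u : V) (k : ℕ) : a u ⟨ψ k, hψV k⟩ = μ k * coef ψ k (u : H) := by
  rw [ha.hermitian, hψa, map_mul, Complex.conj_ofReal, inner_conj_symm,
    coef_eq_inner]

omit hψa in
theorem form_self_im (u : V) : a u u = ((a u u).re : ℂ) := by
  have := ha.hermitian u u
  exact (Complex.conj_eq_iff_re.1 this.symm).symm

omit hψa in
theorem form_self_re_nonneg (u : V) : 0 ≤ (a u u).re := by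
  by_cases h : u = 0
  · simp [h]
  · exact (ha.pos u h).le

theorem eigenvalue_pos (k : ℕ) : 0 < μ k := by
  have h0 : (⟨ψ k, hψV k⟩ : V) ≠ 0 := fun h => by
    have : ψ k = 0 := congrArg Subtype.val h
    exact ψ.orthonormal.ne_zero k this
  have h1 := ha.pos _ h0
  rw [form_basis_right ha hψV hψa] at h1
  simpa [coef_basis] using h1

/-- The energy of a finite combination of eigenvectors. -/
theorem form_sub_partialSum (u : V) (s : Finset ℕ) (g : ℕ → ℂ) :
    a (u - ∑ k ∈ s, g k • ⟨ψ k, hψV k⟩) (u - ∑ k ∈ s, g k • ⟨ψ k, hψV k⟩) =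
      a u u - ∑ k ∈ s, (μ k : ℂ) * (coef ψ k (u : H) * conj (g k) + conj (coef ψ k (u : H)) * g k
        - g k * conj (g k)) := by
  set S : V := ∑ k ∈ s, g k • ⟨ψ k, hψV k⟩ with hS
  have hSr : ∀ k ∈ s, coef ψ k (S : H) = g k := fun k hk => by
    have : (S : H) = ∑ k ∈ s, g k • ψ k := by simp [hS]
    rw [this, coef_sum_smul_basis, if_pos hk]
  have hr : ∀ w : V, a w S = ∑ k ∈ s, conj (g k) * (μ k * coef ψ k (w : H)) := fun w => by
    rw [hS, map_sum]
    refine Finset.sum_congr rfl fun k _ => ?_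
    rw [LinearMap.map_smulₛₗ, form_basis_right ha hψV hψa, smul_eq_mul]
  have h1 : a S u = ∑ k ∈ s, g k * (μ k * conj (coef ψ k (u : H))) := by
    rw [ha.hermitian u S, hr, map_sum]
    simp
  have h2 : a S S = ∑ k ∈ s, conj (g k) * (μ k * g k) := by
    rw [hr]
    exact Finset.sum_congr rfl fun k hk => by rw [hSr k hk]
  rw [LinearMap.map_sub₂, map_sub, map_sub, hr u, h1, h2, ← Finset.sum_sub_distrib,
    sub_sub, ← Finset.sum_add_distrib]
  congr 1
  exact Finset.sum_congr rfl fun k _ => by ring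

theorem form_sub_partialSum_re (u : V) (s : Finset ℕ) :
    (a (u - ∑ k ∈ s, coef ψ k (u : H) • ⟨ψ k, hψV k⟩)
      (u - ∑ k ∈ s, coef ψ k (u : H) • ⟨ψ k, hψV k⟩)).re =
      (a u u).re - ∑ k ∈ s, μ k * ‖coef ψ k (u : H)‖ ^ 2 := by
  rw [form_sub_partialSum ha hψV hψa, Complex.sub_re, Complex.re_sum]
  congr 1
  refine Finset.sum_congr rfl fun k _ => ?_
  rw [mul_comm (conj _), add_sub_cancel_right, Complex.mul_conj, Complex.normSq_eq_norm_sq,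
    ← Complex.ofReal_mul, Complex.ofReal_re]

/-- Bessel's inequality for the energy: the remainder after a partial sum has nonnegative energy. -/
theorem summable_energy (u : V) : Summable fun k => μ k * ‖coef ψ k (u : H)‖ ^ 2 := by
  refine summable_of_sum_le (fun k => mul_nonneg (eigenvalue_pos ha hψV hψa k).le (sq_nonneg _))
    (c := (a u u).re) fun s => ?_
  have h1 := form_sub_partialSum_re ha hψV hψa u s
  have h2 := form_self_re_nonneg ha (u - ∑ k ∈ s, coef ψ k (u : H) • ⟨ψ k, hψV k⟩)
  linarith

/-- The partial sums of the expansion of `x` form a Cauchy sequence in energy, so closedness of the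
form puts `x` into `V` and makes the energy of the remainder tend to zero, which is Parseval's
identity for the energy. -/
theorem mem_and_tendsto_of_summable_energy (hac : IsClosedForm a) (x : H)
    (hx : Summable fun k => μ k * ‖coef ψ k x‖ ^ 2) :
    ∃ h : x ∈ V, HasSum (fun k => μ k * ‖coef ψ k x‖ ^ 2) (a ⟨x, h⟩ ⟨x, h⟩).re := by
  let w : ℕ → V := fun n => ∑ k ∈ Finset.range n, coef ψ k x • ⟨ψ k, hψV k⟩
  have hw : Tendsto (fun n => (w n : H)) atTop (𝓝 x) := by
    have := (hasSum_coef ψ x).tendsto_sum_nat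
    simpa [w] using this
  have hinc : ∀ m n, m ≤ n → (a (w n - w m) (w n - w m)).re =
      ∑ k ∈ Finset.range n, μ k * ‖coef ψ k x‖ ^ 2
        - ∑ k ∈ Finset.range m, μ k * ‖coef ψ k x‖ ^ 2 := fun m n hmn => by
    have e1 : w n - w m = -((0 : V) - ∑ k ∈ Finset.Ico m n, coef ψ k x • ⟨ψ k, hψV k⟩) := by
      rw [zero_sub, neg_neg, Finset.sum_Ico_eq_sub _ hmn]
    rw [e1, LinearMap.map_neg₂, map_neg, neg_neg, form_sub_partialSum ha hψV hψa,
      ← Finset.sum_Ico_eq_sub _ hmn, Complex.sub_re, Complex.re_sum]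
    simp only [map_zero, zero_sub, Submodule.coe_zero, zero_mul,
      add_zero, Complex.zero_re]
    rw [← Finset.sum_neg_distrib]
    refine Finset.sum_congr rfl fun k _ => ?_
    rw [Complex.mul_conj, Complex.normSq_eq_norm_sq]
    norm_cast
    ring
  obtain ⟨h, hlim⟩ := hac w x hw <| by
    rw [Metric.tendsto_nhds]
    intro ε hε
    have hc := hx.hasSum.tendsto_sum_nat.cauchySeq
    obtain ⟨N, hN⟩ := Metric.cauchySeq_iff.1 hc ε hε
    filter_upwards [eventually_ge_atTop (N, N)] with p hp
    rw [Real.dist_eq, sub_zero]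
    rcases le_total p.2 p.1 with h | h
    · rw [hinc _ _ h, ← Real.dist_eq]
      exact hN _ hp.1 _ hp.2
    · rw [← neg_sub (w p.2), LinearMap.map_neg₂, map_neg, neg_neg, hinc _ _ h,
        ← Real.dist_eq]
      exact hN _ hp.2 _ hp.1
  refine ⟨h, ?_⟩
  have h1 : ∀ n, (a (w n - ⟨x, h⟩) (w n - ⟨x, h⟩)).re =
      (a ⟨x, h⟩ ⟨x, h⟩).re - ∑ k ∈ Finset.range n, μ k * ‖coef ψ k x‖ ^ 2 := fun n => by
    rw [← form_sub_partialSum_re ha hψV hψa ⟨x, h⟩, ← neg_sub, LinearMap.map_neg₂,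
      map_neg, neg_neg]
  rw [funext h1] at hlim
  have h2 := hx.hasSum.tendsto_sum_nat
  have h3 := tendsto_nhds_unique hlim (h2.const_sub _)
  rw [sub_eq_zero.1 h3.symm]
  exact hx.hasSum

/-- `J` multiplies the `k`-th coordinate by `√(μ k)`. Dividing the coordinates of `y` by `√(μ k)`
gives a vector of `H` because `μ k ≥ m`, and it belongs to `V` because its energy series sums to
`‖y‖ ^ 2`; this is surjectivity. The forms `a u v` and `(J u, J v)` agree on the diagonal by
Parseval, hence everywhere by polarisation. -/
theorem exists_isEnergyMap (hac : IsClosedForm a) {m : ℝ} (hm : 0 < m) (hμ : ∀ k, m ≤ μ k) :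
    ∃ J : V ≃ₗ[ℂ] H, IsEnergyMap a μ ψ J := by
  have hpos : ∀ k, 0 < μ k := fun k => hm.trans_le (hμ k)
  have hsq : ∀ k (z : ℂ), ‖(√(μ k) : ℂ) * z‖ ^ 2 = μ k * ‖z‖ ^ 2 := fun k z => by
    rw [norm_mul, mul_pow, Complex.norm_real, Real.norm_of_nonneg (Real.sqrt_nonneg _),
      Real.sq_sqrt (hpos k).le]
  have hex : ∀ u : V, ∃ y : H, ∀ k, coef ψ k y = (√(μ k) : ℂ) * coef ψ k (u : H) := fun u =>
    exists_coef_eq ψ (f := fun k => (√(μ k) : ℂ) * coef ψ k (u : H))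
      (by simpa only [hsq] using summable_energy ha hψV hψa u)
  choose j hj using hex
  let J₀ : V →ₗ[ℂ] H :=
    { toFun := j
      map_add' := fun u v => ext_coef ψ fun k => by
        simp only [hj, map_add, Submodule.coe_add]; ring
      map_smul' := fun c u => ext_coef ψ fun k => by
        simp only [hj, map_smul, Submodule.coe_smul, smul_eq_mul,
          RingHom.id_apply]
        ring }
  have hJ₀ : ∀ u k, coef ψ k (J₀ u) = (√(μ k) : ℂ) * coef ψ k (u : H) := hj
  have hs0 : ∀ k, (√(μ k) : ℂ) ≠ 0 := fun k => by
    exact_mod_cast (Real.sqrt_pos.2 (hpos k)).ne'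
  have hinj : Function.Injective J₀ := fun u v huv => by
    refine Subtype.ext (ext_coef ψ fun k => ?_)
    have := hJ₀ u k
    rw [huv, hJ₀] at this
    exact (mul_left_cancel₀ (hs0 k) this).symm
  have hsurj : Function.Surjective J₀ := fun y => by
    have hf : ∀ k, μ k * ‖(√(μ k) : ℂ)⁻¹ * coef ψ k y‖ ^ 2 = ‖coef ψ k y‖ ^ 2 := fun k => by
      rw [← hsq, mul_inv_cancel_left₀ (hs0 k)]
    obtain ⟨x, hx⟩ := exists_coef_eq ψ (f := fun k => (√(μ k) : ℂ)⁻¹ * coef ψ k y) <| by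
      refine Summable.of_nonneg_of_le (fun k => sq_nonneg _) (fun k => ?_)
        ((summable_norm_coef_sq ψ y).mul_left m⁻¹)
      rw [← hf k, ← div_eq_inv_mul (μ k * _) m, le_div_iff₀ hm, mul_comm]
      exact mul_le_mul_of_nonneg_right (hμ k) (sq_nonneg _)
    obtain ⟨hxV, -⟩ := mem_and_tendsto_of_summable_energy ha hψV hψa hac x (by
      simpa only [hx, hf] using summable_norm_coef_sq ψ y)
    refine ⟨⟨x, hxV⟩, ext_coef ψ fun k => ?_⟩
    rw [hJ₀, hx, mul_inv_cancel_left₀ (hs0 k)]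
  refine ⟨LinearEquiv.ofBijective J₀ ⟨hinj, hsurj⟩, hJ₀, fun u v => ?_⟩
  let B : V →ₗ[ℂ] V →ₗ⋆[ℂ] ℂ := LinearMap.mk₂'ₛₗ (RingHom.id ℂ) (starRingEnd ℂ)
    (fun u v => inner ℂ (J₀ v) (J₀ u)) (fun u u' v => by simp) (fun c u v => by simp)
    (fun u v v' => by simp) (fun c u v => by simp [mul_comm])
  have hB : ∀ u, (a - B) u u = 0 := fun u => by
    have h1 := (mem_and_tendsto_of_summable_energy ha hψV hψa hac u
      (summable_energy ha hψV hψa u)).choose_spec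
    have h2 := hasSum_norm_coef_sq ψ (J₀ u)
    simp only [hJ₀, hsq] at h2
    have h3 := h1.unique h2
    change a u u - inner ℂ (J₀ u) (J₀ u) = 0
    rw [form_self_im ha u, inner_self_eq_norm_sq_to_K]
    rw [show (a u u).re = ‖J₀ u‖ ^ 2 from h3]
    simp
  exact sub_eq_zero.1 (eq_zero_of_diag (a - B) hB u v)

end Eigen

namespace IsEnergyMap

variable {J : V ≃ₗ[ℂ] H}

theorem energyNorm_eq (hJ : IsEnergyMap a μ ψ J) (u : V) : energyNorm a u = ‖J u‖ := by
  rw [energyNorm, hJ.form_eq, inner_self_eq_norm_sq_to_K]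
  norm_cast
  exact Real.sqrt_sq (norm_nonneg _)

theorem apply_basis (hJ : IsEnergyMap a μ ψ J) (k : ℕ) (hk : ψ k ∈ V) :
    J ⟨ψ k, hk⟩ = (√(μ k) : ℂ) • ψ k := by
  refine ext_coef ψ fun i => ?_
  rw [hJ.coef_apply, map_smul, smul_eq_mul, coef_basis]
  split_ifs with h
  · rw [h]
  · simp

/-- Semilinear functionals that are continuous in the energy norm vanish if they vanish on the
eigenvectors. -/
theorem functional_eq_zero (hJ : IsEnergyMap a μ ψ J) {D : Submodule ℂ H} (hDV : D ≤ V)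
    (hψD : ∀ k, ψ k ∈ D) {σ : ℂ →+* ℂ} (F : D →ₛₗ[σ] ℂ) {C : ℝ}
    (hF : ∀ u, ‖F u‖ ≤ C * ‖J (Submodule.inclusion hDV u)‖) (h0 : ∀ k, F ⟨ψ k, hψD k⟩ = 0)
    (u : D) : F u = 0 := by
  let w : ℕ → D := fun n => ∑ k ∈ Finset.range n, coef ψ k (u : H) • ⟨ψ k, hψD k⟩
  have hw : ∀ n, F (w n) = 0 := fun n => by
    simp only [w, map_sum]
    exact Finset.sum_eq_zero fun k _ => by rw [LinearMap.map_smulₛₗ, h0, smul_zero]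
  have hJw : ∀ n, J (Submodule.inclusion hDV (w n)) =
      ∑ k ∈ Finset.range n, coef ψ k (J (Submodule.inclusion hDV u)) • ψ k := fun n => by
    simp only [w, map_sum, map_smul]
    refine Finset.sum_congr rfl fun k _ => ?_
    rw [hJ.coef_apply]
    have h1 := hJ.apply_basis k (hDV (hψD k))
    change coef ψ k (u : H) • J ⟨ψ k, hDV (hψD k)⟩ = _
    rw [h1, smul_smul, mul_comm]
    rfl
  have h1 : Tendsto (fun n => C * ‖J (Submodule.inclusion hDV u) -
      J (Submodule.inclusion hDV (w n))‖) atTop (𝓝 (C * 0)) := by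
    refine Tendsto.const_mul _ ?_
    have h2 := (hasSum_coef ψ (J (Submodule.inclusion hDV u))).tendsto_sum_nat
    simp only [hJw]
    simpa [norm_sub_rev] using tendsto_iff_norm_sub_tendsto_zero.1 h2
  rw [mul_zero] at h1
  refine norm_le_zero_iff.1 (ge_of_tendsto h1 (Eventually.of_forall fun n => ?_))
  have := hF (u - w n)
  simpa [hw n] using this

theorem form_eq_zero (hJ : IsEnergyMap a μ ψ J) {D : Submodule ℂ H} (hDV : D ≤ V)
    (hψD : ∀ k, ψ k ∈ D) (e : D →ₗ[ℂ] D →ₗ⋆[ℂ] ℂ) (he : IsEnergyBounded a hDV e)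
    (h0 : ∀ k l, e ⟨ψ k, hψD k⟩ ⟨ψ l, hψD l⟩ = 0) (u v : D) : e u v = 0 := by
  obtain ⟨C, hC⟩ := he
  simp only [hJ.energyNorm_eq] at hC
  have h1 : ∀ k v, e ⟨ψ k, hψD k⟩ v = 0 := fun k v =>
    hJ.functional_eq_zero hDV hψD (e ⟨ψ k, hψD k⟩) (hC _) (h0 k) v
  refine hJ.functional_eq_zero hDV hψD (e.flip v)
    (C := C * ‖J (Submodule.inclusion hDV v)‖) (fun u => ?_) (fun k => h1 k v) u
  rw [mul_right_comm]
  exact hC u v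

end IsEnergyMap

end EnergyMap

/-! ### Extension of the perturbing form, and the compact resolvent of the perturbed operator. -/

section Extension

variable {H : Type*} [NormedAddCommGroup H] [InnerProductSpace ℂ H]
  {V : Submodule ℂ H} {a : V →ₗ[ℂ] V →ₗ⋆[ℂ] ℂ} {μ : ℕ → ℝ} {ψ : HilbertBasis ℕ ℂ H}
  {J : V ≃ₗ[ℂ] H}

/-- The form `u, v ↦ (K (J u), J v)` of an operator `K`. -/
noncomputable def operatorForm (J : V ≃ₗ[ℂ] H) (K : H →L[ℂ] H) : V →ₗ[ℂ] V →ₗ⋆[ℂ] ℂ :=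
  LinearMap.mk₂'ₛₗ (RingHom.id ℂ) (starRingEnd ℂ) (fun u v => inner ℂ (J v) (K (J u)))
    (fun u u' v => by simp) (fun c u v => by simp)
    (fun u v v' => by simp) (fun c u v => by simp [mul_comm])

theorem operatorForm_apply (K : H →L[ℂ] H) (u v : V) :
    operatorForm J K u v = inner ℂ (J v) (K (J u)) := rfl

/-- The restriction of a form to a smaller domain. -/
noncomputable def restrictForm {D : Submodule ℂ H} (hDV : D ≤ V) (c : V →ₗ[ℂ] V →ₗ⋆[ℂ] ℂ) :
    D →ₗ[ℂ] D →ₗ⋆[ℂ] ℂ :=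
  LinearMap.mk₂'ₛₗ (RingHom.id ℂ) (starRingEnd ℂ)
    (fun u v => c (Submodule.inclusion hDV u) (Submodule.inclusion hDV v))
    (fun u u' v => by simp) (fun c u v => by simp)
    (fun u v v' => by simp) (fun c u v => by simp)

theorem form_eq_zero_of_mem_span {D : Submodule ℂ H} (hψD : ∀ k, ψ k ∈ D)
    (e : D →ₗ[ℂ] D →ₗ⋆[ℂ] ℂ) (h0 : ∀ k l, e ⟨ψ k, hψD k⟩ ⟨ψ l, hψD l⟩ = 0) (u v : D)
    (hu : (u : H) ∈ Submodule.span ℂ (Set.range ψ))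
    (hv : (v : H) ∈ Submodule.span ℂ (Set.range ψ)) : e u v = 0 := by
  have hle : Submodule.span ℂ (Set.range ψ) ≤ D := by
    rw [Submodule.span_le]; rintro _ ⟨k, rfl⟩; exact hψD k
  -- A general `σ` lets one argument serve the conjugate-linear and the linear variable.
  have key : ∀ {σ : ℂ →+* ℂ} (F : D →ₛₗ[σ] ℂ), (∀ k, F ⟨ψ k, hψD k⟩ = 0) →
      ∀ w : D, (w : H) ∈ Submodule.span ℂ (Set.range ψ) → F w = 0 := by
    rintro σ F hF ⟨w, hwD⟩ hw
    simp only at hw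
    induction hw using Submodule.span_induction with
    | mem x hx => obtain ⟨k, rfl⟩ := hx; exact hF k
    | zero => exact map_zero F
    | add x y hx hy ihx ihy =>
      have : (⟨x + y, hwD⟩ : D) = ⟨x, hle hx⟩ + ⟨y, hle hy⟩ := rfl
      rw [this, map_add, ihx, ihy, add_zero]
    | smul c x hx ih =>
      have : (⟨c • x, hwD⟩ : D) = c • ⟨x, hle hx⟩ := rfl
      rw [this, LinearMap.map_smulₛₗ, ih, smul_zero]
  exact key (e.flip v) (fun k => key (e ⟨ψ k, hψD k⟩) (h0 k) v hv) u hu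

namespace IsEnergyMap

theorem isEnergyBounded_operatorForm (hJ : IsEnergyMap a μ ψ J) (K : H →L[ℂ] H) :
    IsEnergyBounded a le_rfl (operatorForm J K) := by
  refine ⟨‖K‖, fun u v => ?_⟩
  rw [operatorForm_apply, hJ.energyNorm_eq, hJ.energyNorm_eq]
  change _ ≤ ‖K‖ * ‖J u‖ * ‖J v‖
  calc _ ≤ ‖J v‖ * ‖K (J u)‖ := norm_inner_le_norm _ _
    _ ≤ ‖J v‖ * (‖K‖ * ‖J u‖) := by gcongr; exact K.le_opNorm _
    _ = _ := by ring

/-- Energy-bounded extensions are unique. -/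
theorem continuousExtension_unique (hJ : IsEnergyMap a μ ψ J) {D : Submodule ℂ H} (hDV : D ≤ V)
    (hψD : ∀ k, ψ k ∈ D) {b : D →ₗ[ℂ] D →ₗ⋆[ℂ] ℂ} {c c' : V →ₗ[ℂ] V →ₗ⋆[ℂ] ℂ}
    (hc : IsContinuousExtension a hDV b (Submodule.span ℂ (Set.range ψ)) c)
    (hc' : IsContinuousExtension a hDV b (Submodule.span ℂ (Set.range ψ)) c') : c = c' := by
  have hmem : ∀ k, ψ k ∈ Submodule.span ℂ (Set.range ψ) := fun k =>
    Submodule.subset_span ⟨k, rfl⟩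
  have h1 : IsEnergyBounded a le_rfl (c - c') := by
    obtain ⟨C, hC⟩ := hc.bounded
    obtain ⟨C', hC'⟩ := hc'.bounded
    refine ⟨C + C', fun u v => ?_⟩
    rw [LinearMap.sub_apply, LinearMap.sub_apply]
    refine (norm_sub_le _ _).trans ((add_le_add (hC u v) (hC' u v)).trans_eq ?_)
    ring
  refine LinearMap.ext₂ fun u v => sub_eq_zero.1 ?_
  refine hJ.form_eq_zero le_rfl (fun k => hDV (hψD k)) (c - c') h1 (fun k l => ?_) u v
  have e1 := hc.extends_form ⟨ψ k, hψD k⟩ ⟨ψ l, hψD l⟩ (hmem k) (hmem l)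
  have e2 := hc'.extends_form ⟨ψ k, hψD k⟩ ⟨ψ l, hψD l⟩ (hmem k) (hmem l)
  exact sub_eq_zero.2 (e1.trans e2.symm)

/-- The difference of both forms on `D` is energy-bounded and vanishes on the eigenvectors, whose
combinations approximate every element of `D` in the energy norm. -/
theorem continuousExtension_eq_of_bounded (hJ : IsEnergyMap a μ ψ J) {D : Submodule ℂ H}
    (hDV : D ≤ V) (hψD : ∀ k, ψ k ∈ D) {b : D →ₗ[ℂ] D →ₗ⋆[ℂ] ℂ} {c : V →ₗ[ℂ] V →ₗ⋆[ℂ] ℂ}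
    (hc : IsContinuousExtension a hDV b (Submodule.span ℂ (Set.range ψ)) c)
    (hb : IsEnergyBounded a hDV b) (u v : D) :
    c (Submodule.inclusion hDV u) (Submodule.inclusion hDV v) = b u v := by
  let e : D →ₗ[ℂ] D →ₗ⋆[ℂ] ℂ :=
    restrictForm hDV c - b
  have he : ∀ u v, e u v =
      c (Submodule.inclusion hDV u) (Submodule.inclusion hDV v) - b u v := fun _ _ => rfl
  have h1 : IsEnergyBounded a hDV e := by
    obtain ⟨C, hC⟩ := hc.bounded
    obtain ⟨C', hC'⟩ := hb
    refine ⟨C + C', fun u v => ?_⟩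
    rw [he]
    refine (norm_sub_le _ _).trans ((add_le_add (hC _ _) (hC' u v)).trans_eq ?_)
    change C * energyNorm a (Submodule.inclusion hDV u) * energyNorm a (Submodule.inclusion hDV v)
      + _ = _
    ring
  refine sub_eq_zero.1 (hJ.form_eq_zero hDV hψD e h1 (fun k l => sub_eq_zero.2 ?_) u v)
  exact hc.extends_form _ _ (Submodule.subset_span ⟨k, rfl⟩) (Submodule.subset_span ⟨l, rfl⟩)

variable [CompleteSpace H]

/-- A form matrix dominated by `M β l β m` with `∑ β k ^ 2 / μ k < ∞` belongs to a Hilbert-Schmidt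
operator. -/
theorem exists_continuousExtension (hJ : IsEnergyMap a μ ψ J) (hμ : ∀ k, 0 < μ k)
    {D : Submodule ℂ H} (hDV : D ≤ V) (hψD : ∀ k, ψ k ∈ D) (b : D →ₗ[ℂ] D →ₗ⋆[ℂ] ℂ)
    {β : ℕ → ℝ} {M : ℝ} (hβ : Summable fun k => β k ^ 2 / μ k)
    (hb : ∀ m n, ‖b ⟨ψ m, hψD m⟩ ⟨ψ n, hψD n⟩‖ ≤ M * (β m * β n)) :
    ∃ K : H →L[ℂ] H, IsCompactOperator K ∧
      (∀ ε > 0, ∃ N, ∀ x, (∀ k < N, coef ψ k x = 0) → ‖K x‖ ≤ ε * ‖x‖) ∧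
      IsContinuousExtension a hDV b (Submodule.span ℂ (Set.range ψ)) (operatorForm J K) := by
  set B : ℕ → ℕ → ℂ := fun l m => b ⟨ψ l, hψD l⟩ ⟨ψ m, hψD m⟩
  have hs0 : ∀ k, (√(μ k) : ℂ) ≠ 0 := fun k => by
    exact_mod_cast (Real.sqrt_pos.2 (hμ k)).ne'
  have hsq : ∀ k, ‖(√(μ k) : ℂ)‖ ^ 2 = μ k := fun k => by
    rw [Complex.norm_real, Real.norm_of_nonneg (Real.sqrt_nonneg _), Real.sq_sqrt (hμ k).le]
  have hk : ∀ l m, ‖B l m / (√(μ l) * √(μ m))‖ ^ 2 ≤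
      M ^ 2 * (β l ^ 2 / μ l) * (β m ^ 2 / μ m) := fun l m => by
    rw [norm_div, norm_mul, div_pow, mul_pow, hsq, hsq]
    have h1 := pow_le_pow_left₀ (norm_nonneg _) (hb l m) 2
    have hl := hμ l
    have hm := hμ m
    calc _ ≤ (M * (β l * β m)) ^ 2 / (μ l * μ m) := by gcongr
      _ = _ := by field_simp
  -- The vector `d l` is the image of `ψ l` under `K`: since `J` maps `ψ l` to `√(μ l) • ψ l`, these
  -- coordinates reproduce the matrix of `b`.
  have hd : ∀ l, ∃ d : H, ∀ m, coef ψ m d = B l m / (√(μ l) * √(μ m)) := fun l =>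
    exists_coef_eq ψ (f := fun m => B l m / (√(μ l) * √(μ m)))
      (Summable.of_nonneg_of_le (fun m => sq_nonneg _) (hk l) (hβ.mul_left _))
  choose d hd using hd
  have hds : Summable fun l => ‖d l‖ ^ 2 := by
    refine Summable.of_nonneg_of_le (fun l => sq_nonneg _) (fun l => ?_)
      ((hβ.mul_left (M ^ 2)).mul_right (∑' m, β m ^ 2 / μ m))
    exact norm_le_of_coef_sq_le ψ (hβ.hasSum.mul_left _) fun m => by rw [hd]; exact hk l m
  obtain ⟨K, hK, hK'⟩ := exists_operator_of_summable_sq ψ hds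
  have hKψ : ∀ l, K (ψ l) = d l := fun l => by
    refine (hK (ψ l)).unique ?_
    convert hasSum_ite_eq l (d l) using 2 with k
    rw [coef_basis]
    split_ifs with h <;> simp [h]
  refine ⟨K, isCompactOperator_of_small_tail ψ K (exists_tail_le ψ hK'), exists_tail_le ψ hK',
    hJ.isEnergyBounded_operatorForm K, fun u v hu hv => ?_⟩
  let e : D →ₗ[ℂ] D →ₗ⋆[ℂ] ℂ :=
    restrictForm hDV (operatorForm J K) - b
  refine sub_eq_zero.1 (form_eq_zero_of_mem_span hψD e (fun l m => sub_eq_zero.2 ?_) u v hu hv)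
  change operatorForm J K ⟨ψ l, hDV (hψD l)⟩ ⟨ψ m, hDV (hψD m)⟩ = B l m
  rw [operatorForm_apply, hJ.apply_basis, hJ.apply_basis, map_smul, hKψ, inner_smul_left,
    inner_smul_right, ← coef_eq_inner, hd, Complex.conj_ofReal]
  have := hs0 l
  have := hs0 m
  field_simp

/-- The inverse of the energy map as a compact operator in `H`. -/
theorem exists_inverse (hJ : IsEnergyMap a μ ψ J) {m : ℝ} (hm : 0 < m) (hμ : ∀ k, m ≤ μ k)
    (hlim : Tendsto μ atTop atTop) :
    ∃ G : H →L[ℂ] H, IsCompactOperator G ∧ (∀ y, G y = (J.symm y : H)) ∧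
      ∀ k y, coef ψ k y = √(μ k) * coef ψ k (G y) := by
  have hc : ∀ k y, coef ψ k y = √(μ k) * coef ψ k (J.symm y : H) := fun k y => by
    rw [← hJ.coef_apply, LinearEquiv.apply_symm_apply]
  have hsq : ∀ k y, ‖coef ψ k y‖ ^ 2 = μ k * ‖coef ψ k (J.symm y : H)‖ ^ 2 := fun k y => by
    rw [hc, norm_mul, mul_pow, Complex.norm_real, Real.norm_of_nonneg (Real.sqrt_nonneg _),
      Real.sq_sqrt (hm.le.trans (hμ k))]
  -- The case `N = 0` gives boundedness; letting `B` grow with `N` gives compactness.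
  have key : ∀ (N : ℕ) (B : ℝ), 0 < B → (∀ k, N ≤ k → B ≤ μ k) → ∀ y,
      (∀ k < N, coef ψ k y = 0) → ‖(J.symm y : H)‖ ≤ √B⁻¹ * ‖y‖ := fun N B hB hN y hy => by
    refine le_of_sq_le_sq ?_ (by positivity)
    rw [mul_pow, Real.sq_sqrt (by positivity)]
    refine norm_le_of_coef_sq_le ψ ((hasSum_norm_coef_sq ψ y).mul_left B⁻¹) fun k => ?_
    rw [← div_eq_inv_mul, le_div_iff₀ hB, mul_comm]
    rcases lt_or_ge k N with hk | hk
    · have := hsq k y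
      rw [hy k hk] at this ⊢
      have h0 : μ k * ‖coef ψ k (J.symm y : H)‖ ^ 2 = 0 := by rw [← this]; simp
      rw [(mul_eq_zero.1 h0).resolve_left (hm.trans_le (hμ k)).ne']
      simp
    · rw [hsq k y]
      exact mul_le_mul_of_nonneg_right (hN k hk) (sq_nonneg _)
  refine ⟨(V.subtype ∘ₗ J.symm.toLinearMap).mkContinuous _
    fun y => key 0 m hm (fun k _ => hμ k) y (by simp), ?_, fun y => rfl, hc⟩
  refine isCompactOperator_of_small_tail ψ _ fun ε hε => ?_
  obtain ⟨N, hN⟩ := eventually_atTop.1 (hlim.eventually_ge_atTop ((ε ^ 2)⁻¹))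
  refine ⟨N, fun y hy => ?_⟩
  have := key N _ (by positivity) hN y hy
  rwa [inv_inv, Real.sqrt_sq hε.le] at this

variable {G : H →L[ℂ] H}

omit [CompleteSpace H] in
theorem inverse_symm (hG : ∀ k y, coef ψ k y = √(μ k) * coef ψ k (G y))
    (x y : H) : inner ℂ (G x) y = inner ℂ x (G y) := by
  rw [← ψ.tsum_inner_mul_inner, ← ψ.tsum_inner_mul_inner x]
  refine tsum_congr fun k => ?_
  have h1 := hG k x
  have h2 := hG k y
  rw [coef_eq_inner, coef_eq_inner] at h1 h2
  rw [← inner_conj_symm (G x), ← inner_conj_symm x, h1, h2, map_mul, Complex.conj_ofReal]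
  ring

omit [CompleteSpace H] in
/-- The equation `t(u, v) = (f, v)` in terms of operators. -/
theorem forall_form_eq_iff (hJ : IsEnergyMap a μ ψ J)
    (hGJ : ∀ y, G y = (J.symm y : H)) (hG : ∀ k y, coef ψ k y = √(μ k) * coef ψ k (G y))
    (K : H →L[ℂ] H) (u : V) (f : H) :
    (∀ v : V, (a + operatorForm J K) u v = inner ℂ (v : H) f) ↔ J u + K (J u) = G f := by
  have h1 : ∀ v : V, (a + operatorForm J K) u v = inner ℂ (J v) (J u + K (J u)) := fun v => by
    rw [LinearMap.add_apply, LinearMap.add_apply, operatorForm_apply, hJ.form_eq, inner_add_right]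
  have h2 : ∀ v : V, inner ℂ (v : H) f = inner ℂ (J v) (G f) := fun v => by
    rw [← inverse_symm hG, hGJ, LinearEquiv.symm_apply_apply]
  simp only [h1, h2]
  constructor
  · intro h
    refine ext_inner_left ℂ fun w => ?_
    have := h (J.symm w)
    rwa [LinearEquiv.apply_symm_apply] at this
  · intro h v
    rw [h]

omit [CompleteSpace H] in
/-- Eigenvectors of the perturbed operator in coordinates. -/
theorem forall_form_eq_of_hasSum (hJ : IsEnergyMap a μ ψ J) (hμ : ∀ k, 0 < μ k)
    (hGJ : ∀ y, G y = (J.symm y : H)) (hG : ∀ k y, coef ψ k y = √(μ k) * coef ψ k (G y))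
    (hψV : ∀ k, ψ k ∈ V) (K : H →L[ℂ] H) (u : V) (f : H)
    (h : ∀ m, HasSum (fun l => coef ψ l (u : H) * operatorForm J K ⟨ψ l, hψV l⟩ ⟨ψ m, hψV m⟩)
      (coef ψ m f - μ m * coef ψ m (u : H))) :
    ∀ v : V, (a + operatorForm J K) u v = inner ℂ (v : H) f := by
  rw [hJ.forall_form_eq_iff hGJ hG]
  refine ext_coef ψ fun m => ?_
  have hs0 : (√(μ m) : ℂ) ≠ 0 := by
    exact_mod_cast (Real.sqrt_pos.2 (hμ m)).ne'
  have hss : (√(μ m) : ℂ) * √(μ m) = μ m := by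
    rw [← Complex.ofReal_mul, Real.mul_self_sqrt (hμ m).le]
  have h1 := ((hasSum_coef ψ (J u)).mapL K).mapL (coef ψ m)
  have h2 := h1.mul_left (√(μ m) : ℂ)
  have h4 : (fun l => coef ψ l (u : H) * operatorForm J K ⟨ψ l, hψV l⟩ ⟨ψ m, hψV m⟩) =
      fun l => √(μ m) * coef ψ m (K (coef ψ l (J u) • ψ l)) := funext fun l => by
    rw [operatorForm_apply, hJ.apply_basis, hJ.apply_basis, map_smul, map_smul, map_smul,
      hJ.coef_apply, inner_smul_left, inner_smul_right, Complex.conj_ofReal, coef_eq_inner ψ m]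
    simp only [smul_eq_mul]
    ring
  have h3 := (h m).unique (h4 ▸ h2)
  -- Multiplied by `√(μ m)`, the `m`-th coordinate of `J u + K (J u) = G f` becomes the matrix
  -- equation in the hypothesis.
  refine mul_left_cancel₀ hs0 ?_
  rw [map_add, mul_add, ← h3, ← hG, hJ.coef_apply]
  linear_combination (coef ψ m (u : H)) * hss

/-- The perturbed operator has compact resolvent. -/
theorem exists_resolvent (hJ : IsEnergyMap a μ ψ J) (hμ : ∀ k, 0 < μ k)
    (hGc : IsCompactOperator G)
    (hGJ : ∀ y, G y = (J.symm y : H)) (hG : ∀ k y, coef ψ k y = √(μ k) * coef ψ k (G y))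
    (K : H →L[ℂ] H) (hK : IsCompactOperator K)
    (hKt : ∀ ε > 0, ∃ N, ∀ x, (∀ k < N, coef ψ k x = 0) → ‖K x‖ ≤ ε * ‖x‖) :
    ∃ (R : H →L[ℂ] H) (x : ℂ), IsCompactOperator R ∧ ∀ u f : H,
      (∃ hu : u ∈ V, ∀ v : V, (a + operatorForm J K) ⟨u, hu⟩ v = inner ℂ (v : H) f) ↔
        u = R (f + x • u) := by
  -- `K` is split at index `N`. On the tail its norm is at most `1 / 4`; the first coordinates `p`
  -- of `y` satisfy `‖p‖ ^ 2 ≤ C * ‖G y‖ ^ 2`. Testing `y + K y + x • G (G y) = 0` with `y`, the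
  -- shift `x = ‖K‖ ^ 2 * C + 1` absorbs the contribution of `p` and leaves `y = 0`.
  obtain ⟨N, hN⟩ := hKt (1 / 4) (by norm_num)
  set C : ℝ := ∑ k ∈ Finset.range N, μ k
  have hC : 0 ≤ C := Finset.sum_nonneg fun k _ => (hμ k).le
  set x : ℝ := ‖K‖ ^ 2 * C + 1
  have hx : 0 < x := by positivity
  have hCk : ∀ k < N, μ k ≤ C := fun k hk =>
    Finset.single_le_sum (fun k _ => (hμ k).le) (Finset.mem_range.2 hk)
  have hsq : ∀ k y, ‖coef ψ k y‖ ^ 2 = μ k * ‖coef ψ k (G y)‖ ^ 2 := fun k y => by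
    rw [hG, norm_mul, mul_pow, Complex.norm_real, Real.norm_of_nonneg (Real.sqrt_nonneg _),
      Real.sq_sqrt (hμ k).le]
  let S : H →L[ℂ] H := K + (x : ℂ) • (G ∘L G)
  have hS : IsCompactOperator S := hK.add ((hGc.clm_comp G).smul (x : ℂ))
  have hinj : ∀ y, y + S y = 0 → y = 0 := fun y hy => by
    set p : H := ∑ k ∈ Finset.range N, coef ψ k y • ψ k with hp
    have hpc : ∀ k, coef ψ k p = if k < N then coef ψ k y else 0 := fun k => by
      rw [hp, coef_sum_smul_basis]; simp
    have h1 : ‖K (y - p)‖ ≤ 1 / 4 * ‖y‖ := by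
      refine (hN _ fun k hk => by rw [map_sub, hpc, if_pos hk, sub_self]).trans ?_
      refine mul_le_mul_of_nonneg_left (le_of_sq_le_sq ?_ (norm_nonneg _)) (by norm_num)
      refine norm_le_of_coef_sq_le ψ (hasSum_norm_coef_sq ψ y) fun k => ?_
      rw [map_sub, hpc]
      split_ifs <;> simp
    have h2 : ‖p‖ ^ 2 ≤ C * ‖G y‖ ^ 2 := by
      refine norm_le_of_coef_sq_le ψ ((hasSum_norm_coef_sq ψ (G y)).mul_left C) fun k => ?_
      rw [hpc]
      split_ifs with hk
      · rw [hsq]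
        exact mul_le_mul_of_nonneg_right (hCk k hk) (sq_nonneg _)
      · simp only [norm_zero, ne_eq, OfNat.ofNat_ne_zero, not_false_eq_true, zero_pow]
        positivity
    have h3 : (‖y‖ : ℂ) ^ 2 + x * (‖G y‖ : ℂ) ^ 2 = -inner ℂ y (K y) := by
      have h4 : inner ℂ y (y + S y) = 0 := by rw [hy, inner_zero_right]
      simp only [S, add_apply, smul_apply,
        ContinuousLinearMap.comp_apply, inner_add_right, inner_smul_right] at h4
      rw [← inverse_symm hG, inner_self_eq_norm_sq_to_K, inner_self_eq_norm_sq_to_K] at h4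
      simp only [Complex.coe_algebraMap] at h4
      linear_combination h4
    have h4 : ‖y‖ ^ 2 + x * ‖G y‖ ^ 2 ≤ ‖y‖ * ‖K y‖ := by
      have h5 : ‖((‖y‖ : ℂ) ^ 2 + x * (‖G y‖ : ℂ) ^ 2)‖ = ‖y‖ ^ 2 + x * ‖G y‖ ^ 2 := by
        rw [← Complex.ofReal_pow, ← Complex.ofReal_pow, ← Complex.ofReal_mul,
          ← Complex.ofReal_add, Complex.norm_real, Real.norm_of_nonneg (by positivity)]
      rw [← h5, h3, norm_neg]
      exact norm_inner_le_norm _ _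
    have h5 : ‖K y‖ ≤ ‖K‖ * ‖p‖ + 1 / 4 * ‖y‖ := by
      calc ‖K y‖ = ‖K p + K (y - p)‖ := by rw [← map_add, add_sub_cancel]
        _ ≤ ‖K p‖ + ‖K (y - p)‖ := norm_add_le _ _
        _ ≤ _ := add_le_add (K.le_opNorm p) h1
    have h6 := mul_le_mul_of_nonneg_left h5 (norm_nonneg y)
    have h7 : ‖K‖ ^ 2 * ‖p‖ ^ 2 ≤ ‖K‖ ^ 2 * (C * ‖G y‖ ^ 2) :=
      mul_le_mul_of_nonneg_left h2 (sq_nonneg _)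
    have h8 : ‖y‖ * (‖K‖ * ‖p‖) ≤ 1 / 4 * ‖y‖ ^ 2 + ‖K‖ ^ 2 * ‖p‖ ^ 2 := by
      have := sq_nonneg (1 / 2 * ‖y‖ - ‖K‖ * ‖p‖)
      linarith
    have h9 : x * ‖G y‖ ^ 2 = ‖K‖ ^ 2 * (C * ‖G y‖ ^ 2) + ‖G y‖ ^ 2 := by simp only [x]; ring
    have h10 : ‖y‖ ^ 2 ≤ 0 := by
      have := sq_nonneg ‖G y‖
      linarith
    exact norm_eq_zero.1 (pow_eq_zero_iff two_ne_zero |>.1 (le_antisymm h10 (sq_nonneg _)))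
  obtain ⟨L, hL⟩ := isUnit_one_add_of_injective hS hinj
  have hL1 : ∀ y, (↑L⁻¹ : H →L[ℂ] H) (y + S y) = y := fun y => by
    have : ((↑L⁻¹ : H →L[ℂ] H) * (1 + S)) y = y := by rw [← hL, Units.inv_mul]; rfl
    exact this
  have hL2 : ∀ y, (↑L⁻¹ : H →L[ℂ] H) y + S ((↑L⁻¹ : H →L[ℂ] H) y) = y := fun y => by
    have : ((1 + S) * (↑L⁻¹ : H →L[ℂ] H)) y = y := by rw [← hL, Units.mul_inv]; rfl
    exact this
  -- Adding `x • G u = x • G (G (J u))` to both sides of `J u + K (J u) = G f` gives `(1 + S) (J u)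
  -- = G (f + x • u)`. Hence `(T + x)⁻¹ = G (1 + S)⁻¹ G`.
  refine ⟨G ∘L (↑L⁻¹ : H →L[ℂ] H) ∘L G, x, hGc.comp_clm _, fun u f => ?_⟩
  have hrw : ∀ u : V, J u + S (J u) = J u + K (J u) + (x : ℂ) • G (u : H) := fun u => by
    simp only [S, add_apply, smul_apply,
        ContinuousLinearMap.comp_apply]
    rw [hGJ (J u), LinearEquiv.symm_apply_apply, add_assoc]
  change _ ↔ u = G ((↑L⁻¹ : H →L[ℂ] H) (G (f + (x : ℂ) • u)))
  rw [map_add G, map_smul G]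
  constructor
  · rintro ⟨hu, h⟩
    rw [hJ.forall_form_eq_iff hGJ hG] at h
    have h1 := hrw ⟨u, hu⟩
    rw [h] at h1
    have h2 := hL1 (J ⟨u, hu⟩)
    rw [h1] at h2
    rw [h2, hGJ, LinearEquiv.symm_apply_apply]
  · intro h
    set w : H := (↑L⁻¹ : H →L[ℂ] H) (G f + (x : ℂ) • G u) with hw
    have h1 : u = (J.symm w : H) := by
      rw [← hGJ, hw]
      exact h
    have hu : u ∈ V := by rw [h1]; exact (J.symm w).2
    have hJu : J ⟨u, hu⟩ = w := by
      rw [← LinearEquiv.eq_symm_apply]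
      exact Subtype.ext h1
    refine ⟨hu, (hJ.forall_form_eq_iff hGJ hG _ _ _).2 ?_⟩
    have h2 := hL2 (G f + (x : ℂ) • G u)
    rw [← hw, ← hJu, hrw] at h2
    exact add_right_cancel h2

end IsEnergyMap

end Extension

/-! ### The perturbed eigenvalue equation in coordinates, as a fixed point problem. -/

section EigenSequence

variable {B : ℕ → ℕ → ℂ} {β μ : ℕ → ℝ} {M : ℝ} {n : ℕ}

theorem half_gap_le_norm_sub {r : ℝ} {z : ℂ} (hz : ‖z - μ n‖ ≤ r) {m : ℕ}
    (hm : 2 * r ≤ |μ n - μ m|) : |μ n - μ m| / 2 ≤ ‖z - μ m‖ := by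
  have h1 : |μ n - μ m| = ‖((μ n : ℂ) - z) + (z - μ m)‖ := by
    rw [sub_add_sub_cancel, ← Complex.ofReal_sub, Complex.norm_real, Real.norm_eq_abs]
  have h2 := norm_add_le ((μ n : ℂ) - z) (z - μ m)
  rw [← h1, norm_sub_rev] at h2
  linarith

/-- The coordinates of the eigenvector with eigenvalue near `μ n` and residual `g`. -/
noncomputable def eigenCoord (β μ : ℕ → ℝ) (n : ℕ) (g : ℕ → ℂ) (l : ℕ) : ℂ :=
  if l = n then 1 else β l * g l / (μ n + β n * g n - μ l)

/-- The eigenvalue shift `β n * g n` is at most `2 * M * β n ^ 2`, half of the gap, so every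
denominator keeps half of its unperturbed size. The term `l = n` is listed separately because its
inverse gap counts as zero. -/
theorem norm_eigenCoord_mul_le (hM : 0 < M) (hβ : ∀ m, 0 < β m)
    (hB : ∀ l m, ‖B l m‖ ≤ M * (β l * β m))
    (hgap : ∀ m, m ≠ n → 4 * M * β n ^ 2 ≤ |μ n - μ m|) {g : ℕ → ℂ}
    (hg : ∀ l, ‖g l‖ ≤ 2 * M * β n) :
    (∀ l, l ≠ n → ‖eigenCoord β μ n g l‖ ≤ 4 * M * (β n * β l) / |μ n - μ l|) ∧
    ∀ l m, ‖eigenCoord β μ n g l * B l m‖ ≤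
      ((if l = n then M * β n else 0) + 4 * M ^ 2 * β n * (β l ^ 2 / |μ n - μ l|)) * β m := by
  have hn := hβ n
  have h1 : ∀ l, l ≠ n → ‖eigenCoord β μ n g l‖ ≤ 4 * M * (β n * β l) / |μ n - μ l| :=
    fun l hl => by
    have hl' := hβ l
    have hd : 0 < |μ n - μ l| := lt_of_lt_of_le (by positivity) (hgap l hl)
    have h2 : |μ n - μ l| / 2 ≤ ‖(μ n + β n * g n - μ l : ℂ)‖ :=
      half_gap_le_norm_sub (r := 2 * M * β n ^ 2) (by
        rw [add_sub_cancel_left, norm_mul, Complex.norm_real, Real.norm_of_nonneg hn.le]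
        have := mul_le_mul_of_nonneg_left (hg n) hn.le
        linarith) (by have := hgap l hl; linarith)
    rw [eigenCoord, if_neg hl, norm_div, norm_mul, Complex.norm_real, Real.norm_of_nonneg hl'.le]
    calc β l * ‖g l‖ / ‖(μ n + β n * g n - μ l : ℂ)‖
        ≤ β l * (2 * M * β n) / (|μ n - μ l| / 2) := by
          gcongr
          exact hg l
      _ = _ := by field_simp; ring
  refine ⟨h1, fun l m => ?_⟩
  have hl' := hβ l
  have hm' := hβ m
  rw [norm_mul]
  split_ifs with hl
  · subst hl
    simp only [eigenCoord, if_true, norm_one, one_mul, sub_self, abs_zero, div_zero, mul_zero,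
      add_zero]
    exact (hB l m).trans_eq (by ring)
  · calc _ ≤ 4 * M * (β n * β l) / |μ n - μ l| * (M * (β l * β m)) := by
          gcongr
          · exact h1 l hl
          · exact hB l m
      _ = _ := by ring

/-- The residual enters the numerator and, through the eigenvalue, the denominator. Each change
contributes at most `2 * r / |μ n - μ l|`, the second one by the gap condition. -/
theorem norm_eigenCoord_sub_mul_le (hM : 0 < M) (hβ : ∀ m, 0 < β m)
    (hB : ∀ l m, ‖B l m‖ ≤ M * (β l * β m))
    (hgap : ∀ m, m ≠ n → 4 * M * β n ^ 2 ≤ |μ n - μ m|) {g g' : ℕ → ℂ}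
    (hg : ∀ l, ‖g l‖ ≤ 2 * M * β n) (hg' : ∀ l, ‖g' l‖ ≤ 2 * M * β n) {r : ℝ}
    (hr : ∀ l, ‖g l - g' l‖ ≤ r) (l m : ℕ) :
    ‖(eigenCoord β μ n g l - eigenCoord β μ n g' l) * B l m‖ ≤
      4 * M * r * (β l ^ 2 / |μ n - μ l|) * β m := by
  have hn := hβ n
  have hl' := hβ l
  have hm' := hβ m
  have hr0 : 0 ≤ r := (norm_nonneg _).trans (hr 0)
  by_cases hl : l = n
  · simp [eigenCoord, hl]
  have hd : 0 < |μ n - μ l| := lt_of_lt_of_le (by positivity) (hgap l hl)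
  have hden : ∀ h : ℕ → ℂ, (∀ l, ‖h l‖ ≤ 2 * M * β n) →
      |μ n - μ l| / 2 ≤ ‖(μ n + β n * h n - μ l : ℂ)‖ := fun h hh =>
    half_gap_le_norm_sub (r := 2 * M * β n ^ 2) (by
        rw [add_sub_cancel_left, norm_mul, Complex.norm_real, Real.norm_of_nonneg hn.le]
        have := mul_le_mul_of_nonneg_left (hh n) hn.le
        linarith) (by have := hgap l hl; linarith)
  have hD := hden g hg
  have hD' := hden g' hg'
  set w : ℂ := μ n + β n * g n - μ l with hw
  set w' : ℂ := μ n + β n * g' n - μ l with hw'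
  have hw0 : 0 < ‖w‖ := lt_of_lt_of_le (by positivity) hD
  have hw0' : 0 < ‖w'‖ := lt_of_lt_of_le (by positivity) hD'
  have e1 : eigenCoord β μ n g l - eigenCoord β μ n g' l =
      β l * ((g l - g' l) / w + g' l * (β n * (g' n - g n)) / (w * w')) := by
    rw [eigenCoord, eigenCoord, if_neg hl, if_neg hl, ← hw, ← hw']
    have : w ≠ 0 := norm_pos_iff.1 hw0
    have : w' ≠ 0 := norm_pos_iff.1 hw0'
    have e2 : (β n : ℂ) * (g' n - g n) = w' - w := by rw [hw, hw']; ring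
    rw [e2]
    field_simp
    ring
  have h1 : ‖(g l - g' l) / w‖ ≤ 2 * r / |μ n - μ l| := by
    rw [norm_div]
    calc _ ≤ r / (|μ n - μ l| / 2) := by gcongr; exact hr l
      _ = _ := by field_simp
  have h2 : ‖g' l * (β n * (g' n - g n)) / (w * w')‖ ≤ 2 * r / |μ n - μ l| := by
    rw [norm_div, norm_mul, norm_mul, norm_mul, Complex.norm_real, Real.norm_of_nonneg hn.le,
      norm_sub_rev (g' n)]
    calc _ ≤ 2 * M * β n * (β n * r) / (|μ n - μ l| / 2 * (|μ n - μ l| / 2)) := by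
          gcongr
          · exact hg' l
          · exact hr n
      _ = 2 * r / |μ n - μ l| * (4 * M * β n ^ 2 / |μ n - μ l|) := by field_simp; ring
      _ ≤ 2 * r / |μ n - μ l| * 1 := by
          gcongr
          exact (div_le_one hd).2 (hgap l hl)
      _ = _ := mul_one _
  rw [e1, norm_mul, norm_mul, Complex.norm_real, Real.norm_of_nonneg hl'.le]
  calc _ ≤ β l * (2 * r / |μ n - μ l| + 2 * r / |μ n - μ l|) * (M * (β l * β m)) := by
        gcongr
        · exact (norm_add_le _ _).trans (add_le_add h1 h2)
        · exact hB l m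
    _ = _ := by ring

/-- An isolated eigenvalue of the diagonal matrix `μ` persists under a small perturbation `B`. -/
theorem exists_eigenSequence (hM : 0 < M) (hβ : ∀ m, 0 < β m)
    (hB : ∀ l m, ‖B l m‖ ≤ M * (β l * β m))
    (hgap : ∀ m, m ≠ n → 4 * M * β n ^ 2 ≤ |μ n - μ m|)
    (hsum : Summable fun m => β m ^ 2 / |μ n - μ m|)
    (hsmall : 8 * M * ∑' m, β m ^ 2 / |μ n - μ m| ≤ 1) :
    ∃ (lam : ℂ) (φ : ℕ → ℂ), φ n = 1 ∧ ‖lam - μ n‖ ≤ 2 * M * β n ^ 2 ∧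
      (∀ m, m ≠ n → ‖φ m‖ ≤ 4 * M * (β n * β m) / |μ n - μ m|) ∧
      ∀ m, HasSum (fun l => φ l * B l m) ((lam - μ m) * φ m) := by
  set S := ∑' m, β m ^ 2 / |μ n - μ m|
  have hn := hβ n
  -- The unknown is the residual `g m = (∑ l, φ l * B l m) / β m`. The equation at `m = n` with `φ n
  -- = 1` gives the eigenvalue `μ n + β n * g n`; the others give `φ = eigenCoord β μ n g`. Dividing
  -- by `β m` makes the residual bounded in `m`. The ball is preserved because `M * β n + 4 * M ^ 2
  -- * β n * S ≤ 2 * M * β n`.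
  set s : Set (BoundedContinuousFunction ℕ ℂ) := Metric.closedBall 0 (2 * M * β n)
  have hs : ∀ g ∈ s, ∀ l, ‖g l‖ ≤ 2 * M * β n := fun g hg l =>
    (g.norm_coe_le_norm l).trans (by simpa [s] using hg)
  have hbd : ∀ m, HasSum (fun l => ((if l = n then M * β n else 0) +
      4 * M ^ 2 * β n * (β l ^ 2 / |μ n - μ l|)) * β m)
      ((M * β n + 4 * M ^ 2 * β n * S) * β m) := fun m =>
    ((hasSum_ite_eq n (M * β n)).add (hsum.hasSum.mul_left _)).mul_right _
  have hsm : ∀ g ∈ s, ∀ m, Summable fun l => eigenCoord β μ n g l * B l m := fun g hg m =>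
    Summable.of_norm_bounded (hbd m).summable
      ((norm_eigenCoord_mul_le hM hβ hB hgap (hs g hg)).2 · m)
  have hmap : ∀ g ∈ s, ∀ m, ‖(∑' l, eigenCoord β μ n g l * B l m) / β m‖ ≤ 2 * M * β n :=
    fun g hg m => by
    have hm := hβ m
    rw [norm_div, Complex.norm_real, Real.norm_of_nonneg hm.le, div_le_iff₀ hm]
    refine (tsum_of_norm_bounded (hbd m)
      ((norm_eigenCoord_mul_le hM hβ hB hgap (hs g hg)).2 · m)).trans ?_
    gcongr
    have : M * β n * (8 * M * S) ≤ M * β n * 1 := by gcongr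
    linarith [mul_pos hM hn]
  let F : s → s := fun g => ⟨BoundedContinuousFunction.ofNormedAddCommGroupDiscrete
    (fun m => (∑' l, eigenCoord β μ n g.1 l * B l m) / β m) _ (hmap g.1 g.2), by
      rw [mem_closedBall_zero_iff]
      exact (BoundedContinuousFunction.norm_le (by positivity)).2 (hmap g.1 g.2)⟩
  have hF : ∀ g m, (F g).1 m = (∑' l, eigenCoord β μ n g.1 l * B l m) / β m := fun g m => rfl
  -- The Lipschitz constant is `4 * M * S`, at most one half by the smallness assumption.
  have hcontr : ContractingWith (1 / 2) F := by
    refine ⟨by norm_num, LipschitzWith.of_dist_le_mul fun g g' => ?_⟩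
    rw [Subtype.dist_eq, Subtype.dist_eq]
    refine (BoundedContinuousFunction.dist_le (by positivity)).2 fun m => ?_
    have hm := hβ m
    rw [hF, hF, dist_eq_norm, ← sub_div, ← (hsm _ g.2 m).tsum_sub (hsm _ g'.2 m), norm_div,
      Complex.norm_real, Real.norm_of_nonneg hm.le, div_le_iff₀ hm]
    simp only [← sub_mul]
    have hr : ∀ l, ‖g.1 l - g'.1 l‖ ≤ dist g.1 g'.1 := fun l => by
      rw [← dist_eq_norm]
      exact BoundedContinuousFunction.dist_coe_le_dist l
    have h1 : HasSum (fun l => 4 * M * dist g.1 g'.1 * (β l ^ 2 / |μ n - μ l|) * β m)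
        (4 * M * dist g.1 g'.1 * S * β m) := (hsum.hasSum.mul_left _).mul_right _
    refine (tsum_of_norm_bounded h1
      (norm_eigenCoord_sub_mul_le hM hβ hB hgap (hs _ g.2) (hs _ g'.2) hr · m)).trans ?_
    refine mul_le_mul_of_nonneg_right ?_ hm.le
    have : dist g.1 g'.1 * (8 * M * S) ≤ dist g.1 g'.1 * 1 := by gcongr
    simp only [NNReal.coe_div, NNReal.coe_one, NNReal.coe_ofNat]
    linarith
  have hne : Nonempty s := ⟨⟨0, by simp only [s, Metric.mem_closedBall, dist_self]; positivity⟩⟩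
  have hcs : CompleteSpace s := Metric.isClosed_closedBall.completeSpace_coe
  obtain ⟨g, hg⟩ : ∃ g, F g = g := ⟨hcontr.fixedPoint F, hcontr.fixedPoint_isFixedPt⟩
  have hgm : ∀ m, ∑' l, eigenCoord β μ n g.1 l * B l m = β m * g.1 m := fun m => by
    have h1 := hF g m
    rw [hg, eq_div_iff (by exact_mod_cast (hβ m).ne')] at h1
    rw [← h1, mul_comm]
  have hb := norm_eigenCoord_mul_le hM hβ hB hgap (hs _ g.2)
  refine ⟨μ n + β n * g.1 n, eigenCoord β μ n g.1, by simp [eigenCoord], ?_, hb.1, fun m => ?_⟩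
  · rw [add_sub_cancel_left, norm_mul, Complex.norm_real, Real.norm_of_nonneg hn.le]
    have := mul_le_mul_of_nonneg_left (hs _ g.2 n) hn.le
    linarith
  · have h1 := (hsm _ g.2 m).hasSum
    rw [hgm] at h1
    convert h1 using 1
    by_cases hm : m = n
    · subst hm
      simp [eigenCoord]
    · have hd : 0 < |μ n - μ m| := lt_of_lt_of_le (by positivity) (hgap m hm)
      have h2 : |μ n - μ m| / 2 ≤ ‖(μ n + β n * g.1 n - μ m : ℂ)‖ :=
        half_gap_le_norm_sub (r := 2 * M * β n ^ 2) (by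
          rw [add_sub_cancel_left, norm_mul, Complex.norm_real, Real.norm_of_nonneg hn.le]
          have := mul_le_mul_of_nonneg_left (hs _ g.2 n) hn.le
          linarith) (by have := hgap m hm; linarith)
      have h3 : (μ n + β n * g.1 n - μ m : ℂ) ≠ 0 :=
        norm_pos_iff.1 (lt_of_lt_of_le (by positivity) h2)
      rw [eigenCoord, if_neg hm, mul_div_cancel₀ _ h3]

end EigenSequence

/-! ### Operators with compact resolvent, biorthogonal eigenvectors and root systems. -/

section RootVectors

variable {H : Type*} [NormedAddCommGroup H] [InnerProductSpace ℂ H]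

/-- `u` lies in the domain of `T` and `T u = f`. -/
def IsImage (T : H →ₗ.[ℂ] H) (u f : H) : Prop := ∃ hu : u ∈ T.domain, T ⟨u, hu⟩ = f

variable {T : H →ₗ.[ℂ] H}

theorem isImage_iff_mem_graph {u f : H} : IsImage T u f ↔ (u, f) ∈ T.graph := by
  rw [LinearPMap.mem_graph_iff]
  constructor
  · rintro ⟨hu, h⟩
    exact ⟨⟨u, hu⟩, rfl, h⟩
  · rintro ⟨⟨y, hy⟩, h, h'⟩
    simp only at h
    subst h
    exact ⟨hy, h'⟩

theorem IsImage.unique {u f f' : H} (h : IsImage T u f) (h' : IsImage T u f') : f = f' := by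
  obtain ⟨_, rfl⟩ := h
  obtain ⟨_, rfl⟩ := h'
  rfl

theorem IsImage.sub {u f u' f' : H} (h : IsImage T u f) (h' : IsImage T u' f') :
    IsImage T (u - u') (f - f') := by
  rw [isImage_iff_mem_graph] at *
  exact T.graph.sub_mem h h'

theorem IsImage.smul {u f : H} (c : ℂ) (h : IsImage T u f) : IsImage T (c • u) (c • f) := by
  rw [isImage_iff_mem_graph] at *
  exact T.graph.smul_mem c h

theorem isEigenvector_iff {z : ℂ} {u : H} : IsEigenvector T z u ↔ u ≠ 0 ∧ IsImage T u (z • u) :=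
  Iff.rfl

theorem isResolventAt_iff {z : ℂ} {R : H →L[ℂ] H} : IsResolventAt T z R ↔
    (∀ f, IsImage T (R f) (z • R f - f)) ∧ ∀ u f, IsImage T u f → R (z • u - f) = u := by
  constructor
  · rintro ⟨h1, h2⟩
    refine ⟨fun f => ?_, ?_⟩
    · obtain ⟨hf, h⟩ := h1 f
      exact ⟨hf, by linear_combination (norm := module) -h⟩
    · rintro u f ⟨hu, rfl⟩
      exact h2 ⟨u, hu⟩
  · rintro ⟨h1, h2⟩
    refine ⟨fun f => ?_, fun u => h2 u (T u) ⟨u.2, rfl⟩⟩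
    obtain ⟨hf, h⟩ := h1 f
    exact ⟨hf, by rw [h, sub_sub_cancel]⟩

theorem opResolvent_eq {z : ℂ} (hz : z ∈ resolventSet T) {u f : H}
    (h : IsImage T u (z • u - f)) : opResolvent T z f = u := by
  rw [opResolvent, dif_pos hz]
  have h1 := (isResolventAt_iff.1 (Classical.choose_spec hz)).2 u _ h
  rwa [sub_sub_cancel] at h1

theorem mem_powKer_succ {z : ℂ} {k : ℕ} {u : H} :
    u ∈ powKer T z (k + 1) ↔ ∃ f, IsImage T u f ∧ f - z • u ∈ powKer T z k := by
  rw [powKer, Submodule.mem_map]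
  constructor
  · rintro ⟨⟨y, hy⟩, h, rfl⟩
    exact ⟨T ⟨y, hy⟩, ⟨hy, rfl⟩, h⟩
  · rintro ⟨_, ⟨hu, rfl⟩, h⟩
    exact ⟨⟨u, hu⟩, h, rfl⟩

theorem isImage_zero : IsImage T 0 0 := isImage_iff_mem_graph.2 T.graph.zero_mem

theorem powKer_le_succ (z : ℂ) (k : ℕ) : powKer T z k ≤ powKer T z (k + 1) := by
  induction k with
  | zero => exact bot_le
  | succ k ih =>
    intro u hu
    rw [mem_powKer_succ] at hu ⊢
    obtain ⟨f, hf, h⟩ := hu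
    exact ⟨f, hf, ih h⟩

theorem powKer_mono (z : ℂ) : Monotone (powKer T z) := monotone_nat_of_le_succ (powKer_le_succ z)

theorem mem_rootSpace {z : ℂ} {u : H} : u ∈ rootSpace T z ↔ ∃ k, u ∈ powKer T z k :=
  Submodule.mem_iSup_of_directed _ (powKer_mono z).directed_le

theorem mem_powKer_one {z : ℂ} {u : H} (h : IsImage T u (z • u)) : u ∈ powKer T z 1 :=
  mem_powKer_succ.2 ⟨_, h, by rw [sub_self]; exact Submodule.zero_mem _⟩

theorem rootSpace_eq_bot_of_mem_resolventSet {z : ℂ} (hz : z ∈ resolventSet T) :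
    rootSpace T z = ⊥ := by
  obtain ⟨R, hR⟩ := hz
  rw [isResolventAt_iff] at hR
  have : ∀ k, powKer T z k = ⊥ := fun k => by
    induction k with
    | zero => rfl
    | succ k ih =>
      rw [eq_bot_iff]
      intro u hu
      obtain ⟨f, hf, h⟩ := mem_powKer_succ.1 hu
      rw [ih, Submodule.mem_bot] at h
      have h1 := hR.2 u f hf
      rw [show z • u - f = -(f - z • u) by abel, h, neg_zero, map_zero] at h1
      exact (Submodule.mem_bot ℂ).2 h1.symm
  simp [rootSpace, this]

section CompactResolvent

variable [CompleteSpace H] {R : H →L[ℂ] H} {x : ℂ}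

/-- With `R = (T + x)⁻¹`, the kernel of `1 - (z + x) R` is the kernel of `T - z`. The Fredholm
alternative therefore applies, and the resolvent is `-(1 - (z + x) R)⁻¹ R`. -/
theorem mem_resolventSet_of_injective (hRc : IsCompactOperator R)
    (hR : ∀ u f, IsImage T u f ↔ u = R (f + x • u)) {z : ℂ}
    (hinj : ∀ u, IsImage T u (z • u) → u = 0) : z ∈ resolventSet T := by
  let S : H →L[ℂ] H := (-(z + x)) • R
  have hS : IsCompactOperator S := hRc.smul (-(z + x))
  have hSy : ∀ y, y + S y = 0 ↔ IsImage T y (z • y) := fun y => by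
    rw [hR, ← add_smul, map_smul]
    change y + (-(z + x)) • R y = 0 ↔ _
    rw [neg_smul, ← sub_eq_add_neg, sub_eq_zero]
  obtain ⟨L, hL⟩ := isUnit_one_add_of_injective hS fun y hy => hinj y ((hSy y).1 hy)
  have hL1 : ∀ y, (↑L⁻¹ : H →L[ℂ] H) (y + S y) = y := fun y => by
    have : ((↑L⁻¹ : H →L[ℂ] H) * (1 + S)) y = y := by rw [← hL, Units.inv_mul]; rfl
    exact this
  have hL2 : ∀ y, (↑L⁻¹ : H →L[ℂ] H) y + S ((↑L⁻¹ : H →L[ℂ] H) y) = y := fun y => by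
    have : ((1 + S) * (↑L⁻¹ : H →L[ℂ] H)) y = y := by rw [← hL, Units.mul_inv]; rfl
    exact this
  have hSR : ∀ y, S y = (-(z + x)) • R y := fun y => rfl
  refine ⟨-((↑L⁻¹ : H →L[ℂ] H) ∘L R), isResolventAt_iff.2 ⟨fun f => ?_, fun u f h => ?_⟩⟩
  · rw [hR]
    set w := (-((↑L⁻¹ : H →L[ℂ] H) ∘L R)) f with hw
    have h1 : w + S w = -R f := by
      have h2 := hL2 (R f)
      have h3 : (↑L⁻¹ : H →L[ℂ] H) (R f) = -w := by rw [hw]; simp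
      rw [h3, map_neg] at h2
      rw [← h2]; abel
    rw [hSR] at h1
    rw [map_add, map_sub, map_smul, map_smul]
    rw [neg_smul, add_smul] at h1
    linear_combination (norm := module) h1
  · have h1 := (hR u f).1 h
    have h2 := hL1 u
    rw [map_add, map_smul] at h1
    have h3 : R (z • u - f) = -(u + S u) := by
      rw [hSR, map_sub, map_smul, neg_smul, add_smul]
      linear_combination (norm := module) h1
    change -((↑L⁻¹ : H →L[ℂ] H) (R (z • u - f))) = u
    rw [h3, map_neg, neg_neg, h2]

end CompactResolvent

/-- Eigenvectors `φ n` of an operator with compact resolvent and eigenvectors `φ' n` of its adjoint,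
for simple eigenvalues `lam n`, `n ≥ N`, biorthonormal to each other. -/
structure IsBiorthogonalSystem (T : H →ₗ.[ℂ] H) (R : H →L[ℂ] H) (x : ℂ) (N : ℕ) (lam : ℕ → ℂ)
    (φ φ' : ℕ → H) : Prop where
  compact : IsCompactOperator R
  isImage_iff : ∀ u f, IsImage T u f ↔ u = R (f + x • u)
  eigen : ∀ n, N ≤ n → IsImage T (φ n) (lam n • φ n)
  dual : ∀ n, N ≤ n → ∀ u f, IsImage T u f → inner ℂ (φ' n) f = lam n * inner ℂ (φ' n) u
  pairing : ∀ n, N ≤ n → inner ℂ (φ' n) (φ n) = 1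
  injective : ∀ m n, N ≤ m → N ≤ n → lam m = lam n → m = n

/-- The common annihilator of the vectors `φ' n`, `n ≥ N`. -/
def annihilator (φ' : ℕ → H) (N : ℕ) : Submodule ℂ H where
  carrier := {y | ∀ n, N ≤ n → inner ℂ (φ' n) y = 0}
  add_mem' := fun ha hb n hn => by rw [inner_add_right, ha n hn, hb n hn, add_zero]
  zero_mem' := fun n _ => inner_zero_right _
  smul_mem' := fun c y hy n hn => by rw [inner_smul_right, hy n hn, mul_zero]

theorem mem_annihilator {φ' : ℕ → H} {N : ℕ} {y : H} :
    y ∈ annihilator φ' N ↔ ∀ n, N ≤ n → inner ℂ (φ' n) y = 0 := Iff.rfl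

/-- The annihilator of a system close to the tail of an orthonormal basis has the same dimension
as the annihilator of this tail. -/
theorem annihilator_equiv [CompleteSpace H] (ψ : HilbertBasis ℕ ℂ H) {φ' : ℕ → H} {N : ℕ}
    (hs : Summable fun k => ‖φ' (k + N) - ψ (k + N)‖ ^ 2)
    (hlt : ∑' k, ‖φ' (k + N) - ψ (k + N)‖ ^ 2 < 1) :
    Nonempty (annihilator φ' N ≃ₗ[ℂ] (Fin N → ℂ)) := by
  -- `1 + E` fixes `ψ n` for `n < N` and maps `ψ n` to `φ' n` for `n ≥ N`. It is invertible since
  -- `‖E‖ < 1`, so its adjoint carries the annihilator of the `φ' n` bijectively onto the span of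
  -- the first `N` basis vectors.
  let d : ℕ → H := fun n => if N ≤ n then φ' n - ψ n else 0
  have hdN : ∀ k, d (k + N) = φ' (k + N) - ψ (k + N) := fun k => if_pos (Nat.le_add_left _ _)
  have hd : Summable fun n => ‖d n‖ ^ 2 := by
    rw [← summable_nat_add_iff N]
    simpa only [hdN] using hs
  have hdt : ∑' n, ‖d n‖ ^ 2 < 1 := by
    rw [← hd.sum_add_tsum_nat_add N, Finset.sum_eq_zero fun k hk => by
      rw [show d k = 0 from if_neg (by simpa using hk)]; simp, zero_add]
    simpa only [hdN] using hlt
  obtain ⟨E, hE, hE'⟩ := exists_operator_of_summable_sq ψ hd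
  have hEψ : ∀ l, E (ψ l) = d l := fun l => by
    refine (hE (ψ l)).unique ?_
    convert hasSum_ite_eq l (d l) using 2 with k
    rw [coef_basis]
    split_ifs with h <;> simp [h]
  have hnorm : ‖E‖ < 1 := by
    refine lt_of_le_of_lt (E.opNorm_le_bound (Real.sqrt_nonneg _) fun y => hE' 0 y (by simp)) ?_
    rw [Real.sqrt_lt' one_pos, one_pow]
    simpa using hdt
  have hU : IsUnit (1 + E) := by
    have := isUnit_one_sub_of_norm_lt_one (x := -E) (by rwa [norm_neg])
    rwa [sub_neg_eq_add] at this
  obtain ⟨A, hA⟩ : ∃ A : H →L[ℂ] H, A = ContinuousLinearMap.adjoint (1 + E) := ⟨_, rfl⟩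
  have hAbij : Function.Bijective A := by
    rw [← ContinuousLinearMap.isUnit_iff_bijective, hA, ← ContinuousLinearMap.star_eq_adjoint]
    exact hU.star
  have hAc : ∀ n y, coef ψ n (A y) = inner ℂ (ψ n + d n) y := fun n y => by
    rw [coef_eq_inner, hA, ContinuousLinearMap.adjoint_inner_right, ← hEψ]
    rfl
  have hmem : ∀ y, y ∈ annihilator φ' N ↔ ∀ n, N ≤ n → coef ψ n (A y) = 0 := fun y => by
    rw [mem_annihilator]
    refine forall₂_congr fun n hn => ?_
    rw [hAc, show d n = φ' n - ψ n from if_pos hn, add_sub_cancel]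
  let F : annihilator φ' N →ₗ[ℂ] (Fin N → ℂ) :=
    LinearMap.pi fun i => ((coef ψ i).toLinearMap ∘ₗ A.toLinearMap) ∘ₗ
      (annihilator φ' N).subtype
  have hF : ∀ y i, F y i = coef ψ i (A y) := fun y i => rfl
  refine ⟨LinearEquiv.ofBijective F ⟨?_, fun g => ?_⟩⟩
  · rw [← LinearMap.ker_eq_bot, LinearMap.ker_eq_bot']
    intro y hy
    refine Subtype.ext (hAbij.1 ?_)
    rw [Submodule.coe_zero, map_zero]
    refine ext_coef ψ fun k => ?_
    rw [map_zero]
    rcases lt_or_ge k N with hk | hk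
    · exact congrFun hy ⟨k, hk⟩
    · exact (hmem y).1 y.2 k hk
  · obtain ⟨y, hy⟩ := hAbij.2 (∑ k ∈ Finset.range N, (if h : k < N then g ⟨k, h⟩ else 0) • ψ k)
    have hc : ∀ k, coef ψ k (A y) = if h : k < N then g ⟨k, h⟩ else 0 := fun k => by
      rw [hy, coef_sum_smul_basis]
      simp only [Finset.mem_range]
      split_ifs <;> rfl
    refine ⟨⟨y, (hmem y).2 fun n hn => by rw [hc, dif_neg (by omega)]⟩, ?_⟩
    ext i
    rw [hF, hc, dif_pos i.2]

namespace IsBiorthogonalSystem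

variable {R : H →L[ℂ] H} {x : ℂ} {N : ℕ} {lam : ℕ → ℂ} {φ φ' : ℕ → H}

theorem orthogonal (h : IsBiorthogonalSystem T R x N lam φ φ') {m n : ℕ} (hm : N ≤ m) (hn : N ≤ n)
    (hmn : m ≠ n) : inner ℂ (φ' n) (φ m) = 0 := by
  have h1 := h.dual n hn _ _ (h.eigen m hm)
  rw [inner_smul_right] at h1
  have h2 : (lam m - lam n) * inner ℂ (φ' n) (φ m) = 0 := by linear_combination h1
  exact (mul_eq_zero.1 h2).resolve_left
    (sub_ne_zero.2 fun h3 => hmn (h.injective m n hm hn h3))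

theorem ne_zero (h : IsBiorthogonalSystem T R x N lam φ φ') {n : ℕ} (hn : N ≤ n) : φ n ≠ 0 :=
  fun h0 => by
    have := h.pairing n hn
    rw [h0, inner_zero_right] at this
    exact zero_ne_one this

theorem add_ne_zero (h : IsBiorthogonalSystem T R x N lam φ φ') {n : ℕ} (hn : N ≤ n) :
    lam n + x ≠ 0 := fun h0 => by
  have h1 := (h.isImage_iff _ _).1 (h.eigen n hn)
  rw [← add_smul, h0, zero_smul, map_zero] at h1
  exact h.ne_zero hn h1

theorem isImage_resolvent (h : IsBiorthogonalSystem T R x N lam φ φ') (y : H) :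
    IsImage T (R y) (y - x • R y) := by
  rw [h.isImage_iff, sub_add_cancel]

theorem inner_resolvent (h : IsBiorthogonalSystem T R x N lam φ φ') {n : ℕ} (hn : N ≤ n) (y : H) :
    (lam n + x) * inner ℂ (φ' n) (R y) = inner ℂ (φ' n) y := by
  have h1 := h.dual n hn _ _ (h.isImage_resolvent y)
  rw [inner_sub_right, inner_smul_right] at h1
  linear_combination -h1

/-- The operator acts on the finite-dimensional annihilator of the adjoint eigenvectors. -/
theorem exists_restriction (h : IsBiorthogonalSystem T R x N lam φ φ')
    [FiniteDimensional ℂ (annihilator φ' N)] :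
    ∃ f : Module.End ℂ (annihilator φ' N), ∀ y : annihilator φ' N, IsImage T (y : H) (f y : H) := by
  -- `R` preserves the annihilator and is injective, hence bijective on it in finite dimension. So
  -- the annihilator lies in the domain of `T`, and there `T = R⁻¹ - x`.
  have hmap : ∀ y ∈ annihilator φ' N, R y ∈ annihilator φ' N := fun y hy n hn => by
    have h1 := h.inner_resolvent hn y
    rw [hy n hn] at h1
    exact (mul_eq_zero.1 h1).resolve_left (h.add_ne_zero hn)
  let r : Module.End ℂ (annihilator φ' N) := R.toLinearMap.restrict hmap
  have hrinj : Function.Injective r := by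
    rw [← LinearMap.ker_eq_bot, LinearMap.ker_eq_bot']
    intro y hy
    have h1 : R (y : H) = 0 := congrArg Subtype.val hy
    have h2 := h.isImage_resolvent (y : H)
    rw [h1, smul_zero, sub_zero] at h2
    exact Subtype.ext (h2.unique isImage_zero)
  let s := LinearEquiv.ofInjectiveEndo r hrinj
  refine ⟨s.symm.toLinearMap - x • LinearMap.id, fun y => ?_⟩
  have h1 : R (s.symm y : H) = y := congrArg Subtype.val (s.apply_symm_apply y)
  have h2 := h.isImage_resolvent (s.symm y : H)
  rw [h1] at h2
  exact h2

variable {f : Module.End ℂ (annihilator φ' N)}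

theorem pow_apply_eq_zero_iff (hf : ∀ y : annihilator φ' N, IsImage T (y : H) (f y : H)) (z : ℂ)
    (k : ℕ) (y : annihilator φ' N) : ((f - z • 1) ^ k) y = 0 ↔ (y : H) ∈ powKer T z k := by
  induction k generalizing y with
  | zero =>
    rw [pow_zero]
    exact (Submodule.coe_eq_zero).symm
  | succ k ih =>
    rw [pow_succ, Module.End.mul_apply, ih, mem_powKer_succ]
    constructor
    · intro h1
      exact ⟨_, hf y, h1⟩
    · rintro ⟨g, hg, h1⟩
      rw [hg.unique (hf y)] at h1
      exact h1

variable {e : ℕ → annihilator φ' N} {ν : ℕ → ℂ}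

/-- Root vectors: a Jordan basis of the annihilator, followed by the eigenvectors `φ n`. -/
noncomputable def rootVector (e : ℕ → annihilator φ' N) (φ : ℕ → H) (n : ℕ) : H :=
  if n < N then (e n : H) else φ n

/-- The eigenvalues that belong to `rootVector`. -/
noncomputable def rootValue (N : ℕ) (ν lam : ℕ → ℂ) (n : ℕ) : ℂ :=
  if n < N then ν n else lam n

variable (h : IsBiorthogonalSystem T R x N lam φ φ')
  (hf : ∀ y : annihilator φ' N, IsImage T (y : H) (f y : H))
  (hJ : IsJordanBasis f N e ν)
include h hf hJ

/-- At most one `n ≥ N` has `lam n = z`. Subtracting from a root vector at `z` its component along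
this `φ n` leaves a root vector in the annihilator, where the Jordan basis describes all root
vectors. -/
theorem span_rootVector (z : ℂ) :
    Submodule.span ℂ (rootVector e φ '' {n | rootValue N ν lam n = z}) = rootSpace T z := by
  have hmem : ∀ n, N ≤ n → lam n = z →
      φ n ∈ Submodule.span ℂ (rootVector e φ '' {n | rootValue N ν lam n = z}) := fun n hn hz =>
    Submodule.subset_span ⟨n, by simp [rootValue, not_lt.2 hn, hz],
      by simp [rootVector, not_lt.2 hn]⟩
  apply le_antisymm
  · rw [Submodule.span_le]
    rintro _ ⟨n, hn, rfl⟩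
    simp only [Set.mem_ofPred_eq, rootValue, rootVector] at hn ⊢
    rw [SetLike.mem_coe, mem_rootSpace]
    split_ifs at hn ⊢ with hnN
    · obtain ⟨k, hk⟩ := (Module.End.mem_maxGenEigenspace _ _ _).1 (hJ.mem_maxGenEigenspace n hnN)
      rw [hn] at hk
      exact ⟨k, (pow_apply_eq_zero_iff hf z k _).1 hk⟩
    · have h1 := h.eigen n (not_lt.1 hnN)
      rw [hn] at h1
      exact ⟨1, mem_powKer_one h1⟩
  · intro u hu
    obtain ⟨k, hk⟩ := mem_rootSpace.1 hu
    -- Pairing `(T - z) u` with `φ' n` multiplies the pairing of `u` by `lam n - z ≠ 0`, so the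
    -- vanishing descends along the chain.
    have h1 : ∀ n, N ≤ n → lam n ≠ z → ∀ k, ∀ u ∈ powKer T z k, inner ℂ (φ' n) u = 0 := by
      intro n hn hz k
      induction k with
      | zero =>
        intro u hu
        rw [(Submodule.mem_bot ℂ).1 hu, inner_zero_right]
      | succ k ih =>
        intro u hu
        obtain ⟨g, hg, h2⟩ := mem_powKer_succ.1 hu
        have h3 := ih _ h2
        rw [inner_sub_right, inner_smul_right, h.dual n hn _ _ hg, ← sub_mul] at h3
        exact (mul_eq_zero.1 h3).resolve_left (sub_ne_zero.2 hz)
    have key : ∀ w ∈ annihilator φ' N, (∃ k, w ∈ powKer T z k) →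
        w ∈ Submodule.span ℂ (rootVector e φ '' {n | rootValue N ν lam n = z}) := by
      rintro w hw ⟨k, hk⟩
      have h2 := (pow_apply_eq_zero_iff hf z k ⟨w, hw⟩).2 hk
      have h3 := hJ.maxGenEigenspace_le z ((Module.End.mem_maxGenEigenspace _ _ _).2 ⟨k, h2⟩)
      have h4 := Submodule.mem_map_of_mem (f := (annihilator φ' N).subtype) h3
      rw [Submodule.map_span] at h4
      refine Submodule.span_mono ?_ h4
      rintro _ ⟨_, ⟨i, ⟨hi, hz⟩, rfl⟩, rfl⟩
      exact ⟨i, by simp [rootValue, hi, hz], by simp [rootVector, hi]⟩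
    by_cases hex : ∃ n, N ≤ n ∧ lam n = z
    · obtain ⟨n, hn, hz⟩ := hex
      rw [← sub_add_cancel u (inner ℂ (φ' n) u • φ n)]
      refine add_mem (key _ (fun m hm => ?_) ⟨max k 1, sub_mem ?_ ?_⟩)
        (Submodule.smul_mem _ _ (hmem n hn hz))
      · rw [inner_sub_right, inner_smul_right]
        by_cases hmn : m = n
        · rw [hmn, h.pairing n hn, mul_one, sub_self]
        · rw [h.orthogonal hn hm (Ne.symm hmn), mul_zero, sub_zero]
          refine h1 m hm (fun h2 => hmn (h.injective m n hm hn (h2.trans hz.symm))) k u hk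
      · exact powKer_mono z (le_max_left _ _) hk
      · refine powKer_mono z (le_max_right _ _) (Submodule.smul_mem _ _ (mem_powKer_one ?_))
        rw [← hz]
        exact h.eigen n hn
    · push Not at hex
      exact key u (fun n hn => h1 n hn (hex n hn) k u hk) ⟨k, hk⟩

-- Pairing a relation with `φ' n` removes the coefficients with `n ≥ N`; what remains is a relation
-- in the Jordan basis.
omit hf in
theorem linearIndependent_rootVector : LinearIndependent ℂ (rootVector e φ) := by
  rw [linearIndependent_iff']
  intro s g hg
  have h1 : ∀ n ∈ s, N ≤ n → g n = 0 := fun n hns hn => by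
    have h2 := congrArg (inner ℂ (φ' n)) hg
    rw [inner_sum, inner_zero_right, Finset.sum_eq_single n] at h2
    · rwa [inner_smul_right, rootVector, if_neg (not_lt.2 hn), h.pairing n hn, mul_one] at h2
    · intro m _ hmn
      rw [inner_smul_right, rootVector]
      split_ifs with hm
      · rw [(e m).2 n hn, mul_zero]
      · rw [h.orthogonal (not_lt.1 hm) hn hmn, mul_zero]
    · exact fun h3 => absurd hns h3
  have h2 : ∑ i : Fin N, (if (i : ℕ) ∈ s then g i else 0) • e i = 0 := by
    refine Subtype.ext ?_
    have h4 : ∑ i ∈ s, g i • rootVector e φ i =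
        ∑ i ∈ s.filter (fun n => n < N), g i • rootVector e φ i := by
      refine (Finset.sum_filter_of_ne fun n hn h5 => ?_).symm
      by_contra h6
      rw [h1 n hn (not_lt.1 h6), zero_smul] at h5
      exact h5 rfl
    have h3 : s.filter (fun n => n < N) = (Finset.range N).filter (fun n => n ∈ s) := by
      ext n; simp [and_comm]
    rw [Submodule.coe_sum, Submodule.coe_zero, ← hg, h4, h3, Finset.sum_filter,
      ← Fin.sum_univ_eq_sum_range (fun n => if n ∈ s then g n • rootVector e φ n else 0)]
    refine Finset.sum_congr rfl fun n _ => ?_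
    split_ifs
    · simp [rootVector]
    · simp
  intro n hn
  rcases lt_or_ge n N with hnN | hnN
  · have h3 := Fintype.linearIndependent_iff.1 hJ.linearIndependent _ h2 ⟨n, hnN⟩
    simpa [hn] using h3
  · exact h1 n hn hnN

theorem isRootSystem [CompleteSpace H] :
    IsRootSystem T (rootValue N ν lam) (rootVector e φ) := by
  have hind := h.linearIndependent_rootVector hJ
  refine ⟨?_, fun m => ?_, fun m => ?_, fun m => h.span_rootVector hf hJ _, fun n => ?_⟩
  · ext z
    rw [opSpectrum, Set.mem_compl_iff]
    constructor
    -- If `z` is none of the listed values, its root space is spanned by the empty set. Then `T - z`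
    -- is injective, and compactness of `R` puts `z` into the resolvent set.
    · contrapose!
      intro hz
      refine mem_resolventSet_of_injective h.compact h.isImage_iff fun u hu => ?_
      have h1 := h.span_rootVector hf hJ z
      have h2 : {n | rootValue N ν lam n = z} = ∅ := by
        ext n
        simp only [Set.mem_ofPred_eq, Set.mem_empty_iff_false, iff_false]
        exact fun h3 => hz ⟨n, h3⟩
      rw [h2, Set.image_empty, Submodule.span_empty] at h1
      have h3 : u ∈ rootSpace T z := mem_rootSpace.2 ⟨1, mem_powKer_one hu⟩
      rwa [← h1, Submodule.mem_bot] at h3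
    · rintro ⟨n, rfl⟩ hz
      have h1 := h.span_rootVector hf hJ (rootValue N ν lam n)
      rw [rootSpace_eq_bot_of_mem_resolventSet hz] at h1
      have h2 : rootVector e φ n ∈ (⊥ : Submodule ℂ H) := by
        rw [← h1]
        exact Submodule.subset_span ⟨n, rfl, rfl⟩
      exact hind.ne_zero n ((Submodule.mem_bot ℂ).1 h2)
  · set z := rootValue N ν lam m
    have h1 : {n | rootValue N ν lam n = z} ⊆ Set.Iio N ∪ {n | N ≤ n ∧ lam n = z} := fun n hn => by
      rcases lt_or_ge n N with hnN | hnN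
      · exact Or.inl hnN
      · right
        simp only [Set.mem_ofPred_eq, rootValue, if_neg (not_lt.2 hnN)] at hn
        exact ⟨hnN, hn⟩
    refine ((Set.finite_Iio N).union (Set.Subsingleton.finite ?_)).subset h1
    rintro p ⟨hp, hpz⟩ q ⟨hq, hqz⟩
    exact h.injective p q hp hq (hpz.trans hqz.symm)
  · exact hind.comp _ Subtype.val_injective
  · have hne := hind.ne_zero n
    by_cases hn : n < N
    · rcases hJ.chain n hn with h1 | ⟨j, rfl, hν, h1⟩
      · left
        rw [isEigenvector_iff]
        refine ⟨hne, ?_⟩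
        have h2 := hf (e n)
        rw [h1] at h2
        simpa [rootVector, rootValue, hn] using h2
      · right
        refine ⟨j, rfl, ?_⟩
        have h2 := hf (e (j + 1))
        rw [h1] at h2
        have hj : j < N := by omega
        have h3 : IsImage T (rootVector e φ (j + 1))
            (rootValue N ν lam (j + 1) • rootVector e φ (j + 1) + rootVector e φ j) := by
          simpa [rootVector, rootValue, hn, hj] using h2
        obtain ⟨hu, h4⟩ := h3
        exact ⟨hu, by rw [h4, add_sub_cancel_left]⟩
    · left
      rw [isEigenvector_iff]
      refine ⟨hne, ?_⟩
      simpa [rootVector, rootValue, hn] using h.eigen n (not_lt.1 hn)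

omit hf hJ in
/-- The resolvent near an isolated simple eigenvalue is a simple pole plus a holomorphic part. -/
theorem resolvent_decomposition [CompleteSpace H] {n : ℕ} (hn : N ≤ n) {y : H}
    (hy : inner ℂ (φ' n) y = 1) {s : Set ℂ}
    (hs : ∀ z ∈ s, ∀ u, IsImage T u (z • u) → inner ℂ (φ' n) u = 0 → u = 0) :
    ∃ g : ℂ → H, DifferentiableOn ℂ g s ∧ ∀ z ∈ s, z ∈ resolventSet T →
      opResolvent T z y = (z - lam n)⁻¹ • φ n + g z := by
  let P : H →L[ℂ] H := (innerSL ℂ (φ' n)).smulRight (φ n)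
  have hP : ∀ u, P u = inner ℂ (φ' n) u • φ n := fun u => rfl
  have hφP : ∀ u, inner ℂ (φ' n) (P u) = inner ℂ (φ' n) u := fun u => by
    rw [hP, inner_smul_right, h.pairing n hn, mul_one]
  -- `P` is the spectral projection onto `φ n`. Removing it from `R` eliminates the pole: `1 - (z +
  -- x) R'` stays invertible at `z = lam n` too, provided that `T - z` has no kernel inside the
  -- annihilator of `φ' n`.
  let R' : H →L[ℂ] H := R - P ∘L R
  have hR' : ∀ u, R' u = R u - inner ℂ (φ' n) (R u) • φ n := fun u => rfl
  have hφR' : ∀ u, inner ℂ (φ' n) (R' u) = 0 := fun u => by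
    rw [show R' u = R u - P (R u) from rfl, inner_sub_right, hφP, sub_self]
  have hR'c : IsCompactOperator R' := h.compact.sub (h.compact.clm_comp P)
  have hRφ : ∀ u, inner ℂ (φ' n) u = 0 → R' u = R u := fun u hu => by
    have h1 := h.inner_resolvent hn u
    rw [hu] at h1
    rw [hR', (mul_eq_zero.1 h1).resolve_left (h.add_ne_zero hn), zero_smul, sub_zero]
  let S : ℂ → H →L[ℂ] H := fun z => 1 + (-(z + x)) • R'
  have hSu : ∀ z u, S z u = u - (z + x) • R' u := fun z u => by
    change u + (-(z + x)) • R' u = _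
    rw [neg_smul, ← sub_eq_add_neg]
  have hunit : ∀ z ∈ s, IsUnit (S z) := fun z hz => by
    refine isUnit_one_add_of_injective (hR'c.smul (-(z + x))) fun u hu => ?_
    have h1 : u = (z + x) • R' u := by
      have := hSu z u
      rw [← sub_eq_zero, ← this]
      exact hu
    have h2 : inner ℂ (φ' n) u = 0 := by
      rw [h1, inner_smul_right, hφR', mul_zero]
    refine hs z hz u ?_ h2
    rw [h.isImage_iff, ← add_smul, map_smul, ← hRφ u h2]
    exact h1
  refine ⟨fun z => -R (Ring.inverse (S z) (y - φ n)), ?_, fun z hz hzr => ?_⟩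
  · intro z hz
    have hSd : DifferentiableAt ℂ S z := by
      have : DifferentiableAt ℂ (fun z : ℂ => (-(z + x))) z := by fun_prop
      exact (this.smul_const R').const_add 1
    have h1 : DifferentiableAt ℂ Ring.inverse (S z) := differentiableAt_inverse (hunit z hz)
    have h2 : DifferentiableAt ℂ (fun z => Ring.inverse (S z)) z := h1.comp z hSd
    have h3 : DifferentiableAt ℂ (fun z => Ring.inverse (S z) (y - φ n)) z :=
      h2.clm_apply (differentiableAt_const _)
    exact ((R.differentiableAt.comp z h3).neg).differentiableWithinAt
  -- The part `φ n` of `y` gives the pole. The part `v` is annihilated by `φ' n`, and with `w = (1 -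
  -- (z + x) R')⁻¹ v` one has `(T - z) R w = v`, so it contributes `-R w`.
  · set v := y - φ n with hv
    have hφv : inner ℂ (φ' n) v = 0 := by
      rw [hv, inner_sub_right, hy, h.pairing n hn, sub_self]
    set w := Ring.inverse (S z) v with hw
    have hSw : S z w = v := by
      have : (S z * Ring.inverse (S z)) v = v := by rw [Ring.mul_inverse_cancel _ (hunit z hz)]; rfl
      exact this
    have hww : w = v + (z + x) • R' w := by
      rw [hSu] at hSw
      rw [← hSw, sub_add_cancel]
    have hφw : inner ℂ (φ' n) w = 0 := by
      rw [hww, inner_add_right, inner_smul_right, hφR', hφv, mul_zero, add_zero]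
    have hne : z - lam n ≠ 0 := fun h0 => by
      have h1 := rootSpace_eq_bot_of_mem_resolventSet hzr
      have h2 : φ n ∈ rootSpace T z := mem_rootSpace.2 ⟨1, mem_powKer_one (by
        rw [sub_eq_zero.1 h0]; exact h.eigen n hn)⟩
      rw [h1] at h2
      exact h.ne_zero hn ((Submodule.mem_bot ℂ).1 h2)
    rw [hRφ w hφw] at hww
    have h1 : IsImage T (R w) (z • R w + v) := by
      have h2 := h.isImage_resolvent w
      convert h2 using 1
      rw [eq_sub_iff_add_eq]
      conv_rhs => rw [hww]
      module
    have h3 := ((h.eigen n hn).smul (z - lam n)⁻¹).sub h1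
    rw [← sub_eq_add_neg]
    refine opResolvent_eq hzr ?_
    convert h3 using 1
    have h4 : y = φ n + v := by rw [hv]; abel
    rw [h4]
    have h5 : (z - lam n)⁻¹ • (z - lam n) • φ n = φ n := by
      rw [smul_smul, inv_mul_cancel₀ hne, one_smul]
    linear_combination (norm := module) h5

end IsBiorthogonalSystem

end RootVectors

/-! ### Eigenvectors of the perturbed operator and of its adjoint. -/

section PerturbedPair

variable {H : Type*} [NormedAddCommGroup H] [InnerProductSpace ℂ H] [CompleteSpace H]
  {V : Submodule ℂ H} {a : V →ₗ[ℂ] V →ₗ⋆[ℂ] ℂ} {μ : ℕ → ℝ} {ψ : HilbertBasis ℕ ℂ H}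
  {J : V ≃ₗ[ℂ] H} {K G : H →L[ℂ] H} {β : ℕ → ℝ} {M : ℝ} {n : ℕ}

theorem operatorForm_adjoint (J : V ≃ₗ[ℂ] H) (K : H →L[ℂ] H) (u v : V) :
    operatorForm J (ContinuousLinearMap.adjoint K) u v = conj (operatorForm J K v u) := by
  rw [operatorForm_apply, operatorForm_apply, ContinuousLinearMap.adjoint_inner_right,
    inner_conj_symm]

/-- The conditions on the index `n` that make `μ n` persist as an isolated simple eigenvalue under a
perturbation with matrix elements bounded by `M β l β m`. -/
structure IsIsolatedIndex (μ β : ℕ → ℝ) (M : ℝ) (n : ℕ) : Prop where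
  gap : ∀ m, m ≠ n → 4 * M * β n ^ 2 ≤ |μ n - μ m|
  summable : Summable fun m => β m ^ 2 / |μ n - μ m|
  small : 8 * M * ∑' m, β m ^ 2 / |μ n - μ m| ≤ 1
  summable_sq : Summable fun m => β m ^ 2 / |μ n - μ m| ^ 2

/-- A bound for the squared distance of perturbed and unperturbed eigenvectors. -/
noncomputable def eigenvectorError (μ β : ℕ → ℝ) (M : ℝ) (n : ℕ) : ℝ :=
  16 * M ^ 2 * (β n ^ 2 * ∑' m, β m ^ 2 / |μ n - μ m| ^ 2)

omit [CompleteSpace H] in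
/-- The perturbed eigenvalue near `μ n` and its eigenvector. -/
theorem IsEnergyMap.exists_eigenvector (hJ : IsEnergyMap a μ ψ J) (hμ : ∀ k, 0 < μ k)
    (hGJ : ∀ y, G y = (J.symm y : H)) (hG : ∀ k y, coef ψ k y = √(μ k) * coef ψ k (G y))
    (hψV : ∀ k, ψ k ∈ V) (hM : 0 < M) (hβ : ∀ m, 0 < β m)
    (hB : ∀ l m, ‖operatorForm J K ⟨ψ l, hψV l⟩ ⟨ψ m, hψV m⟩‖ ≤ M * (β l * β m))
    (hn : IsIsolatedIndex μ β M n) :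
    ∃ (lam : ℂ) (u : V), coef ψ n (u : H) = 1 ∧ ‖lam - μ n‖ ≤ 2 * M * β n ^ 2 ∧
      (∀ v : V, (a + operatorForm J K) u v = inner ℂ (v : H) (lam • (u : H))) ∧
      ‖(u : H) - ψ n‖ ^ 2 ≤ eigenvectorError μ β M n := by
  obtain ⟨lam, f, hfn, hlam, hf, hfs⟩ :=
    exists_eigenSequence hM hβ hB hn.gap hn.summable hn.small
  have hβn := hβ n
  have hμn := hμ n
  have hfle : ∀ m, m ≠ n →
      ‖f m‖ ^ 2 ≤ 16 * M ^ 2 * β n ^ 2 * (β m ^ 2 / |μ n - μ m| ^ 2) := fun m hm => by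
    calc ‖f m‖ ^ 2 ≤ (4 * M * (β n * β m) / |μ n - μ m|) ^ 2 := by gcongr; exact hf m hm
      _ = _ := by ring
  -- Finite energy is needed for the eigenvector to lie in `V`. By the gap condition `μ m ≤ μ n + |μ
  -- n - μ m|` is a constant multiple of `|μ n - μ m|`, so one power of the inverse gap suffices.
  have hen : Summable fun m => μ m * ‖f m‖ ^ 2 := by
    set C : ℝ := 16 * M ^ 2 * β n ^ 2 * (1 + μ n / (4 * M * β n ^ 2))
    have h1 : ∀ m, μ m * ‖f m‖ ^ 2 ≤
        (if m = n then μ n else 0) + C * (β m ^ 2 / |μ n - μ m|) := fun m => by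
      by_cases hm : m = n
      · subst hm
        simp [hfn]
      · rw [if_neg hm, zero_add]
        have hd0 : 0 < 4 * M * β n ^ 2 := by positivity
        have hg := hn.gap m hm
        have hd : 0 < |μ n - μ m| := hd0.trans_le hg
        have h2 : μ m ≤ |μ n - μ m| * (1 + μ n / (4 * M * β n ^ 2)) := by
          have h3 : μ n ≤ |μ n - μ m| * (μ n / (4 * M * β n ^ 2)) := by
            rw [mul_div_assoc', le_div_iff₀ hd0, mul_comm]
            exact mul_le_mul_of_nonneg_right hg hμn.le
          have h4 := neg_abs_le (μ n - μ m)
          linarith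
        calc μ m * ‖f m‖ ^ 2 ≤ (|μ n - μ m| * (1 + μ n / (4 * M * β n ^ 2))) *
              (16 * M ^ 2 * β n ^ 2 * (β m ^ 2 / |μ n - μ m| ^ 2)) :=
              mul_le_mul h2 (hfle m hm) (sq_nonneg _) ((hμ m).le.trans h2)
          _ = _ := by simp only [C]; field_simp
    refine Summable.of_nonneg_of_le (fun m => mul_nonneg (hμ m).le (sq_nonneg _)) h1
      (Summable.add ?_ (hn.summable.mul_left C))
    exact (hasSum_ite_eq n (μ n)).summable
  obtain ⟨y, hy⟩ := exists_coef_eq ψ (f := fun m => √(μ m) * f m) (by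
    convert hen using 2 with m
    rw [norm_mul, mul_pow, Complex.norm_real, Real.norm_of_nonneg (Real.sqrt_nonneg _),
      Real.sq_sqrt (hμ m).le])
  have hs0 : ∀ k, (√(μ k) : ℂ) ≠ 0 := fun k => by
    exact_mod_cast (Real.sqrt_pos.2 (hμ k)).ne'
  have hu : ∀ m, coef ψ m (J.symm y : H) = f m := fun m => by
    have h1 := hJ.coef_apply (J.symm y) m
    rw [LinearEquiv.apply_symm_apply, hy] at h1
    exact (mul_left_cancel₀ (hs0 m) h1).symm
  refine ⟨lam, J.symm y, by rw [hu, hfn], hlam, ?_, ?_⟩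
  · refine hJ.forall_form_eq_of_hasSum hμ hGJ hG hψV K _ _ fun m => ?_
    rw [map_smul, hu, smul_eq_mul, ← sub_mul]
    simpa only [hu] using hfs m
  · rw [eigenvectorError, ← mul_assoc]
    refine norm_le_of_coef_sq_le ψ (hn.summable_sq.hasSum.mul_left _) fun m => ?_
    rw [map_sub, hu, coef_basis]
    split_ifs with hm
    · subst hm
      simp [hfn]
    · rw [sub_zero]
      exact hfle m hm

/-- The perturbed eigenvalue near `μ n`, its eigenvector and the eigenvector of the adjoint. -/
theorem IsEnergyMap.exists_perturbedPair (hV : Dense (V : Set H)) (ha : IsHermitianPosDef a)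
    (hJ : IsEnergyMap a μ ψ J) (hμ : ∀ k, 0 < μ k)
    (hGJ : ∀ y, G y = (J.symm y : H)) (hG : ∀ k y, coef ψ k y = √(μ k) * coef ψ k (G y))
    (hψV : ∀ k, ψ k ∈ V) (hM : 0 < M) (hβ : ∀ m, 0 < β m)
    (hB : ∀ l m, ‖operatorForm J K ⟨ψ l, hψV l⟩ ⟨ψ m, hψV m⟩‖ ≤ M * (β l * β m))
    (hn : IsIsolatedIndex μ β M n) (herr : eigenvectorError μ β M n ≤ 1 / 4) :
    ∃ (lam : ℂ) (φ φ' : H), ‖lam - μ n‖ ≤ 2 * M * β n ^ 2 ∧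
      IsImage (formOperator (a + operatorForm J K)) φ (lam • φ) ∧
      (∀ u f, IsImage (formOperator (a + operatorForm J K)) u f →
        inner ℂ φ' f = lam * inner ℂ φ' u) ∧
      inner ℂ φ' φ = 1 ∧ inner ℂ φ' (ψ n) = 1 ∧
      ‖φ - ψ n‖ ^ 2 ≤ 16 * eigenvectorError μ β M n ∧
      ‖φ' - ψ n‖ ^ 2 ≤ eigenvectorError μ β M n := by
  set S := eigenvectorError μ β M n with hS
  obtain ⟨lam, u, hu1, hlam, hu, hue⟩ := hJ.exists_eigenvector hμ hGJ hG hψV hM hβ hB hn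
  -- The adjoint form has the conjugate transposed matrix, which obeys the same symmetric bound.
  obtain ⟨lam', w, hw1, -, hw, hwe⟩ := hJ.exists_eigenvector (K := ContinuousLinearMap.adjoint K)
    hμ hGJ hG hψV hM hβ (fun l m => by
      rw [operatorForm_adjoint, RCLike.norm_conj, mul_comm (β l)]
      exact hB m l) hn
  have himg : ∀ x f, IsImage (formOperator (a + operatorForm J K)) x f ↔
      ∃ hx : x ∈ V, ∀ v, (a + operatorForm J K) ⟨x, hx⟩ v = inner ℂ (v : H) f :=
    mem_graph_formOperator_iff hV _
  have hdual : ∀ x f, IsImage (formOperator (a + operatorForm J K)) x f →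
      inner ℂ (w : H) f = conj lam' * inner ℂ (w : H) x := fun x f hx => by
    obtain ⟨hxV, h⟩ := (himg x f).1 hx
    rw [← h w]
    have h1 := hw ⟨x, hxV⟩
    rw [inner_smul_right, LinearMap.add_apply, LinearMap.add_apply, operatorForm_adjoint] at h1
    have h2 := congrArg conj h1
    rw [map_add, Complex.conj_conj, ← ha.hermitian, map_mul, inner_conj_symm] at h2
    exact h2
  have heig : IsImage (formOperator (a + operatorForm J K)) (u : H) (lam • (u : H)) :=
    (himg _ _).2 ⟨u.2, hu⟩
  have hwψ : inner ℂ (w : H) (ψ n) = 1 := by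
    rw [← inner_conj_symm, ← coef_eq_inner, hw1, map_one]
  set p : ℂ := inner ℂ (w : H) (u : H) with hp
  -- Both vectors have `n`-th coordinate one, so their differences from `ψ n` are orthogonal to `ψ
  -- n`, and `p - 1` is the product of two small differences.
  have hp1 : ‖p - 1‖ ≤ S := by
    have h1 : p - 1 = inner ℂ ((w : H) - ψ n) ((u : H) - ψ n) := by
      rw [inner_sub_left, inner_sub_right, inner_sub_right, hwψ, ← coef_eq_inner, ← coef_eq_inner,
        hu1, coef_basis, if_pos rfl]
      ring
    rw [h1]
    refine (norm_inner_le_norm _ _).trans ?_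
    have := two_mul_le_add_sq ‖(w : H) - ψ n‖ ‖(u : H) - ψ n‖
    linarith
  have hph : 1 / 2 ≤ ‖p‖ := by
    have := norm_sub_norm_le (1 : ℂ) p
    rw [norm_one, norm_sub_rev] at this
    linarith
  have hp0 : p ≠ 0 := norm_pos_iff.1 (by linarith)
  -- The two eigenvalues were obtained independently; they correspond because the pairing `p` is
  -- nonzero.
  have hll : lam = conj lam' := by
    have h1 := hdual _ _ heig
    rw [inner_smul_right] at h1
    exact mul_right_cancel₀ hp0 h1
  refine ⟨lam, p⁻¹ • (u : H), w, hlam, ?_, ?_, ?_, hwψ, ?_, hwe⟩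
  · have := heig.smul p⁻¹
    rwa [smul_comm] at this
  · rw [hll]
    exact hdual
  · rw [inner_smul_right, ← hp, inv_mul_cancel₀ hp0]
  · have h1 : p⁻¹ • (u : H) - ψ n = p⁻¹ • (((u : H) - ψ n) - (p - 1) • ψ n) := by
      rw [sub_smul, one_smul, sub_sub_sub_cancel_right, smul_sub, smul_smul, inv_mul_cancel₀ hp0,
        one_smul]
    have h2 : ‖((u : H) - ψ n) - (p - 1) • ψ n‖ ≤ ‖(u : H) - ψ n‖ + S := by
      refine (norm_sub_le _ _).trans ?_
      rw [norm_smul, ψ.orthonormal.1, mul_one]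
      linarith
    have h3 : ‖p⁻¹‖ ≤ 2 := by
      rw [norm_inv]
      exact inv_le_of_inv_le₀ (by norm_num) (by linarith)
    have hS0 : 0 ≤ S := (norm_nonneg _).trans hp1
    -- The factor `2` bounds `p⁻¹`. Then `(r + S) ^ 2 ≤ 2 * r ^ 2 + 2 * S ^ 2` with `r ^ 2 ≤ S` and
    -- `S ^ 2 ≤ S` gives `16 * S`.
    calc ‖p⁻¹ • (u : H) - ψ n‖ ^ 2 ≤ (2 * (‖(u : H) - ψ n‖ + S)) ^ 2 := by
          rw [h1, norm_smul]
          gcongr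
      _ ≤ 16 * S := by
        have h4 := sq_nonneg (‖(u : H) - ψ n‖ - S)
        have h5 : S ^ 2 ≤ S := by nlinarith
        nlinarith

end PerturbedPair

/-! ### Geometry of the rectangles around the eigenvalues. -/

section Boxes

variable {μ : ℕ → ℝ} {γ κ : ℝ} {N₀ : ℕ}

theorem box_eq (κ γ : ℝ) (μ : ℕ → ℝ) (n : ℕ) :
    box κ γ μ n = Set.Ioo (boxLeft κ γ μ n) (boxRight κ γ μ n) ×ℂ
      Set.Ioo (-boxHeight κ γ n) (boxHeight κ γ n) := by
  ext z
  simp only [box, Set.mem_ofPred_eq, Complex.mem_reProdIm, Set.mem_Ioo, abs_lt, and_assoc]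

/-- The closed rectangle around `μ n`. -/
def closedBox (κ γ : ℝ) (μ : ℕ → ℝ) (n : ℕ) : Set ℂ :=
  Set.Icc (boxLeft κ γ μ n) (boxRight κ γ μ n) ×ℂ Set.Icc (-boxHeight κ γ n) (boxHeight κ γ n)

theorem isOpen_box (n : ℕ) : IsOpen (box κ γ μ n) := by
  rw [box_eq]
  exact isOpen_Ioo.reProdIm isOpen_Ioo

theorem box_subset_closedBox (n : ℕ) : box κ γ μ n ⊆ closedBox κ γ μ n := by
  rw [box_eq]
  exact fun z hz => ⟨Set.Ioo_subset_Icc_self hz.1, Set.Ioo_subset_Icc_self hz.2⟩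

theorem frontier_box_subset (n : ℕ) :
    frontier (box κ γ μ n) ⊆ closedBox κ γ μ n \ box κ γ μ n := by
  rw [(isOpen_box n).frontier_eq]
  refine Set.sdiff_subset_sdiff_left (closure_minimal (box_subset_closedBox n) ?_)
  exact isClosed_Icc.reProdIm isClosed_Icc

theorem mem_frontier_box {n : ℕ} {z w : ℂ} (hw : w ∈ box κ γ μ n) (hz : z ∈ closedBox κ γ μ n)
    (h : z.re = boxLeft κ γ μ n ∨ z.re = boxRight κ γ μ n ∨ z.im = -boxHeight κ γ n ∨
      z.im = boxHeight κ γ n) : z ∈ frontier (box κ γ μ n) := by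
  rw [box_eq] at hw
  have h1 : boxLeft κ γ μ n ≠ boxRight κ γ μ n := (hw.1.1.trans hw.1.2).ne
  have h2 : -boxHeight κ γ n ≠ boxHeight κ γ n := (hw.2.1.trans hw.2.2).ne
  rw [(isOpen_box n).frontier_eq, box_eq, Complex.closure_reProdIm, closure_Ioo h1, closure_Ioo h2]
  refine ⟨hz, fun h3 => ?_⟩
  obtain ⟨⟨h4, h5⟩, h6, h7⟩ := h3
  rcases h with h | h | h | h
  · exact h4.ne' h
  · exact h5.ne h
  · exact h6.ne' h
  · exact h7.ne h

variable (hκ : 0 < κ)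
  (hsep : ∀ k, N₀ ≤ k → κ * ((k : ℝ) + 1) ^ (γ - 1) ≤ μ (k + 1) - μ k)
include hκ hsep

theorem boxRight_le_boxLeft {m n : ℕ} (hm : N₀ ≤ m) (hmn : m < n) :
    boxRight κ γ μ m ≤ boxLeft κ γ μ n := by
  -- Neighbouring rectangles each take half of the guaranteed gap `κ * (k + 1) ^ (γ - 1)`.
  have key : ∀ k, N₀ ≤ k → boxRight κ γ μ k ≤ boxLeft κ γ μ (k + 1) := fun k hk => by
    have := hsep k hk
    rw [boxRight, boxLeft]
    push_cast
    linarith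
  obtain ⟨n, rfl⟩ : ∃ k, n = k + 1 := ⟨n - 1, by omega⟩
  refine le_trans ?_ (key n (by omega))
  have hmn' : m ≤ n := by omega
  induction n, hmn' using Nat.le_induction with
  | base => exact le_rfl
  | succ n hn ih =>
    refine (ih (by omega)).trans ((key n (hm.trans hn)).trans ?_)
    rw [boxLeft, boxRight]
    have h1 : 0 ≤ κ / 2 * ((n + 1 : ℕ) : ℝ) ^ (γ - 1) := by positivity
    have h2 : 0 ≤ κ / 2 * (((n + 1 : ℕ) : ℝ) + 1) ^ (γ - 1) := by positivity
    linarith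

theorem not_mem_closedBox_of_mem_box {m n : ℕ} (hm : N₀ ≤ m) (hn : N₀ ≤ n) (hmn : m ≠ n) {z : ℂ}
    (hz : z ∈ box κ γ μ m) : z ∉ closedBox κ γ μ n := fun hz' => by
  rcases lt_or_gt_of_ne hmn with h | h
  · exact absurd (boxRight_le_boxLeft hκ hsep hm h) (not_le.2 (hz'.1.1.trans_lt hz.2.1))
  · exact absurd (boxRight_le_boxLeft hκ hsep hn h) (not_le.2 (hz.1.trans_le hz'.1.2))

/-- The left end of the `n`-th rectangle is at least `μ (n - 1)`, so the rectangles leave every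
half-plane bounded to the right. Hence the finitely many eigenvalues of the Jordan part do not
disturb the rectangles of large index. -/
theorem eventually_notMem_closedBox (hlim : Tendsto μ atTop atTop) (ν : ℕ → ℂ) (N : ℕ) :
    ∃ N₂, ∀ n, N₂ ≤ n → ∀ m < N, ν m ∉ closedBox κ γ μ n := by
  obtain ⟨C, hC⟩ : ∃ C, ∀ m < N, (ν m).re ≤ C := by
    obtain ⟨C, hC⟩ := ((Finset.range N).image fun m => (ν m).re).bddAbove
    exact ⟨C, fun m hm => hC (Finset.mem_coe.2 (Finset.mem_image_of_mem _ (Finset.mem_range.2 hm)))⟩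
  obtain ⟨N₁, hN₁⟩ := eventually_atTop.1 (hlim.eventually_gt_atTop C)
  refine ⟨max N₀ N₁ + 1, fun n hn m hm hz => ?_⟩
  have h1 := boxRight_le_boxLeft hκ hsep (m := n - 1) (n := n) (by omega) (by omega)
  have h2 := hN₁ (n - 1) (by omega)
  have h3 := hz.1.1
  have h4 := hC m hm
  have h5 : 0 ≤ κ / 2 * (((n - 1 : ℕ) : ℝ) + 1) ^ (γ - 1) := by positivity
  rw [boxRight] at h1
  linarith

end Boxes

/-! ### The Riesz projections, and uniqueness of the root vectors for large indices. -/

section RieszProjection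

variable {H : Type*} [NormedAddCommGroup H] [InnerProductSpace ℂ H] [CompleteSpace H]
  {T : H →ₗ.[ℂ] H} {R : H →L[ℂ] H} {x : ℂ} {N : ℕ} {lam ν : ℕ → ℂ} {φ φ' : ℕ → H}
  {f : Module.End ℂ (annihilator φ' N)} {e : ℕ → annihilator φ' N}
  {μ : ℕ → ℝ} {γ κ : ℝ} {N₀ : ℕ} {ψ : ℕ → H}

/-- The normalisation `(ψ n, φ' n) = 1` makes `φ n` itself the residue of the resolvent applied to
`ψ n`. -/
theorem rieszProjection_eq (h : IsBiorthogonalSystem T R x N lam φ φ') {n : ℕ} (hn : N ≤ n)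
    (hψ : inner ℂ (φ' n) (ψ n) = 1) (hlam : lam n ∈ box κ γ μ n)
    (hs : ∀ z ∈ closedBox κ γ μ n, ∀ u, IsImage T u (z • u) → inner ℂ (φ' n) u = 0 → u = 0)
    (hfr : frontier (box κ γ μ n) ⊆ resolventSet T) :
    rieszProjection T κ γ μ n (ψ n) = φ n := by
  obtain ⟨g, hg, hgr⟩ := h.resolvent_decomposition hn hψ hs
  have hπ : (2 * (Real.pi : ℂ) * Complex.I) ≠ 0 := by simp [Real.pi_ne_zero]
  have hlam' := hlam
  rw [box_eq] at hlam'
  rw [rieszProjection, rectIntegral_eq_of_simple_pole hlam'.1.1 hlam'.1.2 hlam'.2.1 hlam'.2.2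
    (φ n) hg
    fun z hz hz' => hgr z hz (hfr (mem_frontier_box hlam hz hz')), smul_smul, inv_mul_cancel₀ hπ,
    one_smul]

/-- Disjointness of the rectangles excludes the other `lam m`, and large `n` excludes the
eigenvalues of the Jordan part. So `lam n` is the only spectral point in the closed rectangle, and
its root space is the line of `φ n`. -/
theorem IsBiorthogonalSystem.isPerturbedRootSystem (h : IsBiorthogonalSystem T R x N lam φ φ')
    (hf : ∀ y : annihilator φ' N, IsImage T (y : H) (f y : H)) (hJ : IsJordanBasis f N e ν)
    (hψ : ∀ n, N ≤ n → inner ℂ (φ' n) (ψ n) = 1) (hbox : ∀ n, N ≤ n → lam n ∈ box κ γ μ n)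
    (hN : N₀ ≤ N) (hκ : 0 < κ)
    (hsep : ∀ k, N₀ ≤ k → κ * ((k : ℝ) + 1) ^ (γ - 1) ≤ μ (k + 1) - μ k)
    (hlim : Tendsto μ atTop atTop) :
    IsPerturbedRootSystem T κ γ μ ψ (rootValue N ν lam) (rootVector e φ) := by
  have hroot := h.isRootSystem hf hJ
  obtain ⟨N₂, hN₂⟩ := eventually_notMem_closedBox hκ hsep hlim ν N
  refine ⟨hroot, max N N₂, fun n hn => ?_⟩
  have hnN : N ≤ n := le_of_max_le_left hn
  have hlamn : rootValue N ν lam n = lam n := if_neg (not_lt.2 hnN)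
  have hφn : rootVector e φ n = φ n := if_neg (not_lt.2 hnN)
  have hother : ∀ m, rootValue N ν lam m ∈ closedBox κ γ μ n → m = n := fun m hm => by
    by_contra hmn
    rcases lt_or_ge m N with hmN | hmN
    · rw [rootValue, if_pos hmN] at hm
      exact hN₂ n (le_of_max_le_right hn) m hmN hm
    · rw [rootValue, if_neg (not_lt.2 hmN)] at hm
      exact not_mem_closedBox_of_mem_box hκ hsep (hN.trans hmN) (hN.trans hnN) hmn
        (hbox m hmN) hm
  have hspec : ∀ z ∈ closedBox κ γ μ n, z ∉ resolventSet T → z = lam n := fun z hz hzr => by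
    have h1 : z ∈ opSpectrum T := hzr
    rw [hroot.spectrum_eq] at h1
    obtain ⟨m, rfl⟩ := h1
    rw [hother m hz, hlamn]
  have hclosed := box_subset_closedBox (κ := κ) (γ := γ) (μ := μ) n
  have hspan : Submodule.span ℂ {φ n} = rootSpace T (lam n) := by
    rw [← hlamn, ← h.span_rootVector hf hJ]
    have h1 : {m | rootValue N ν lam m = rootValue N ν lam n} = {n} := by
      ext m
      simp only [Set.mem_ofPred_eq, Set.mem_singleton_iff]
      refine ⟨fun h2 => hother m ?_, fun h2 => by rw [h2]⟩
      rw [h2, hlamn]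
      exact hclosed (hbox n hnN)
    rw [h1, Set.image_singleton, hφn]
  have hfr : frontier (box κ γ μ n) ⊆ resolventSet T := fun z hz => by
    have h1 := frontier_box_subset n hz
    by_contra h2
    exact h1.2 (hspec z h1.1 h2 ▸ hbox n hnN)
  refine ⟨hfr, ?_, ?_, ?_⟩
  · rw [hlamn]
    ext z
    rw [Set.mem_singleton_iff]
    refine ⟨fun hz => hspec z (hclosed hz.2) hz.1, ?_⟩
    rintro rfl
    refine ⟨?_, hbox n hnN⟩
    rw [hroot.spectrum_eq, ← hlamn]
    exact ⟨n, rfl⟩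
  · rw [hlamn, ← hspan]
    exact finrank_span_singleton (h.ne_zero hnN)
  · rw [hφn]
    refine (rieszProjection_eq h hnN (hψ n hnN) (hbox n hnN) (fun z hz u hu h0 => ?_) hfr).symm
    -- An eigenvector for a point of the closed rectangle belongs to `lam n`, hence is a multiple of
    -- `φ n`, which pairs to one with `φ' n`.
    by_contra hu0
    have h1 : u ∈ rootSpace T z := mem_rootSpace.2 ⟨1, mem_powKer_one hu⟩
    have h2 : z = lam n := hspec z hz fun hzr => hu0 <| by
      rwa [rootSpace_eq_bot_of_mem_resolventSet hzr, Submodule.mem_bot] at h1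
    rw [h2, ← hspan, Submodule.mem_span_singleton] at h1
    obtain ⟨c, rfl⟩ := h1
    rw [inner_smul_right, h.pairing n hnN, mul_one] at h0
    exact hu0 (by rw [h0, zero_smul])

/-- An operator with compact resolvent and eigenvectors quadratically close to an orthonormal basis
has a perturbed root system, and all such systems are quadratically close to this basis. -/
theorem IsBiorthogonalSystem.exists_isPerturbedRootSystem {ψ : HilbertBasis ℕ ℂ H}
    (h : IsBiorthogonalSystem T R x N lam φ φ')
    (hs : Summable fun k => ‖φ' (k + N) - ψ (k + N)‖ ^ 2)
    (hlt : ∑' k, ‖φ' (k + N) - ψ (k + N)‖ ^ 2 < 1)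
    (hφs : Summable fun k => ‖φ (k + N) - ψ (k + N)‖ ^ 2)
    (hψ : ∀ n, N ≤ n → inner ℂ (φ' n) (ψ n) = 1) (hbox : ∀ n, N ≤ n → lam n ∈ box κ γ μ n)
    (hN : N₀ ≤ N) (hκ : 0 < κ)
    (hsep : ∀ k, N₀ ≤ k → κ * ((k : ℝ) + 1) ^ (γ - 1) ≤ μ (k + 1) - μ k)
    (hlim : Tendsto μ atTop atTop) :
    (∃ (lam : ℕ → ℂ) (φ : ℕ → H), IsPerturbedRootSystem T κ γ μ ψ lam φ) ∧
    ∀ (lam : ℕ → ℂ) (φ : ℕ → H), IsPerturbedRootSystem T κ γ μ ψ lam φ →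
      Summable fun n => ‖ψ n - φ n‖ ^ 2 := by
  obtain ⟨E⟩ := annihilator_equiv ψ hs hlt
  have : FiniteDimensional ℂ (annihilator φ' N) := E.symm.finiteDimensional
  have hfin : Module.finrank ℂ (annihilator φ' N) = N := by
    rw [E.finrank_eq, Module.finrank_fin_fun]
  obtain ⟨f, hf⟩ := h.exists_restriction
  obtain ⟨e, ν, hJ⟩ := exists_isJordanBasis f
  rw [hfin] at hJ
  have hP := h.isPerturbedRootSystem hf hJ hψ hbox hN hκ hsep hlim
  refine ⟨⟨_, _, hP⟩, fun lam₁ φ₁ hP₁ => ?_⟩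
  obtain ⟨N₂, h2⟩ := hP.eventually_riesz
  obtain ⟨N₃, h3⟩ := hP₁.eventually_riesz
  -- Beyond `p` both systems consist of the same Riesz projections, so they agree there, and the
  -- first finitely many terms do not affect summability.
  set p := max N₂ N₃
  rw [← summable_nat_add_iff (p + N)]
  convert (summable_nat_add_iff p).2 hφs using 3 with n
  rw [add_assoc, norm_sub_rev, (h3 (n + (p + N)) (by omega)).2.2.2,
    ← (h2 (n + (p + N)) (by omega)).2.2.2, rootVector, if_neg (by omega)]

end RieszProjection

/-! ### Validity of the isolation conditions for large indices. -/

section Asymptotics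

variable {μ : ℕ → ℝ} {γ κ α M : ℝ} {N₀ : ℕ}

theorem sq_succ_rpow_neg (α : ℝ) (m : ℕ) :
    (((m : ℝ) + 1) ^ (-α)) ^ 2 = ((m : ℝ) + 1) ^ (-(2 * α)) := by
  rw [← Real.rpow_mul_natCast (by positivity)]
  congr 1
  push_cast
  ring

/-- The quotient of both powers is `(n + 1) ^ (-(2 * α + γ - 1))`, which tends to zero: the shift of
an eigenvalue is small compared with its gap. -/
theorem eventually_le_succ_rpow (hδ : 1 < 2 * α + γ) (C : ℝ) {ε : ℝ} (hε : 0 < ε) :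
    ∀ᶠ n : ℕ in atTop, C * (((n : ℝ) + 1) ^ (-α)) ^ 2 < ε * ((n : ℝ) + 1) ^ (γ - 1) := by
  have h1 := (tendsto_succ_rpow_neg (s := 2 * α + γ - 1) (by linarith)).const_mul C
  rw [mul_zero] at h1
  filter_upwards [h1.eventually (gt_mem_nhds hε)] with n hn
  have hp : (0 : ℝ) < (n : ℝ) + 1 := by positivity
  have h2 : (((n : ℝ) + 1) ^ (-α)) ^ 2 =
      ((n : ℝ) + 1) ^ (-(2 * α + γ - 1)) * ((n : ℝ) + 1) ^ (γ - 1) := by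
    rw [sq_succ_rpow_neg, ← Real.rpow_add hp]
    congr 1
    ring
  rw [h2, ← mul_assoc]
  exact mul_lt_mul_of_pos_right hn (by positivity)

/-- Disks that are small compared with the gaps lie in the rectangles. -/
theorem eventually_mem_box (hδ : 1 < 2 * α + γ) (hκ : 0 < κ) (C : ℝ) :
    ∀ᶠ n : ℕ in atTop, ∀ z : ℂ, ‖z - μ n‖ ≤ C * (((n : ℝ) + 1) ^ (-α)) ^ 2 →
      z ∈ box κ γ μ n := by
  set c := min 1 ((1 / 4 : ℝ) ^ (γ - 1))
  have hc : 0 < c := by positivity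
  filter_upwards [eventually_le_succ_rpow hδ C (show 0 < κ / 2 by positivity),
    eventually_le_succ_rpow hδ C (show 0 < κ / 2 * c by positivity),
    eventually_ge_atTop 1] with n h1 h2 hn z hz
  have hn' : (1 : ℝ) ≤ n := by exact_mod_cast hn
  -- The left end of the rectangle involves `n ^ (γ - 1)`, not `(n + 1) ^ (γ - 1)`; the two are
  -- comparable for `n ≥ 1`.
  have h3 := rpow_ge_of_quarter_le (x := (n : ℝ) + 1) (y := n) (e := γ - 1) (by positivity)
    (by linarith) (by linarith)
  have h4 : κ / 2 * c * ((n : ℝ) + 1) ^ (γ - 1) ≤ κ / 2 * (n : ℝ) ^ (γ - 1) := by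
    rw [mul_assoc]
    exact mul_le_mul_of_nonneg_left h3 (by positivity)
  have hre := abs_le.1 ((Complex.abs_re_le_norm (z - μ n)).trans hz)
  have him := (Complex.abs_im_le_norm (z - μ n)).trans hz
  rw [Complex.sub_re, Complex.ofReal_re] at hre
  rw [Complex.sub_im, Complex.ofReal_im, sub_zero] at him
  refine ⟨?_, ?_, ?_⟩
  · rw [boxLeft]; linarith [hre.1]
  · rw [boxRight]; linarith [hre.2]
  · rw [boxHeight]; linarith

/-- Under local form-subordination, all large indices are isolated, and the errors of the
eigenvectors are summable. -/
theorem eventually_isIsolatedIndex (hγ : 0 < γ) (hκ : 0 < κ)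
    (hsep : ∀ k, N₀ ≤ k → κ * ((k : ℝ) + 1) ^ (γ - 1) ≤ μ (k + 1) - μ k)
    (hα : α ≤ 3 / 4) (hδ : 3 / 2 < 2 * α + γ) (M : ℝ) :
    (∀ᶠ n in atTop, IsIsolatedIndex μ (fun m => ((m : ℝ) + 1) ^ (-α)) M n) ∧
      Summable (eigenvectorError μ (fun m => ((m : ℝ) + 1) ^ (-α)) M) := by
  obtain ⟨c, hc, N₁, hN₁, h⟩ := exists_separation hγ hκ hsep
  obtain ⟨hs1, ht⟩ := tendsto_tsum_weight_div hα hδ hc h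
  obtain ⟨hs2, hss⟩ := summable_tsum_weight_div_sq hα hδ hc h
  simp only [← sq_succ_rpow_neg] at hs1 ht hs2 hss
  refine ⟨?_, hss.mul_left (16 * M ^ 2)⟩
  have hδ1 : 1 < 2 * α + γ := by linarith
  have ht' := ht.const_mul (8 * M)
  rw [mul_zero] at ht'
  filter_upwards [eventually_ge_atTop N₁, ht'.eventually (ge_mem_nhds one_pos),
    eventually_le_succ_rpow hδ1 (4 * M) hc,
    eventually_le_succ_rpow hδ1 (4 * M) hκ] with n hn h1 h2 h3
  refine ⟨fun m hm => ?_, hs1 n hn, h1, hs2 n hn⟩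
  -- For `m < n` the general separation is needed, as small indices are unordered. For `m > n` the
  -- gap next to `n` and monotonicity suffice.
  rcases lt_or_gt_of_ne hm with hmn | hmn
  · have h4 := h m n hn hmn
    have h5 : (1 : ℝ) ≤ (n : ℝ) - m := by
      have : (m : ℝ) + 1 ≤ n := by exact_mod_cast hmn
      linarith
    have h6 : 0 < ((n : ℝ) + 1) ^ (γ - 1) := by positivity
    have h7 : c * ((n : ℝ) + 1) ^ (γ - 1) ≤ c * (((n : ℝ) + 1) ^ (γ - 1) * ((n : ℝ) - m)) :=
      mul_le_mul_of_nonneg_left (le_mul_of_one_le_right h6.le h5) hc.le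
    exact h2.le.trans (h7.trans (h4.trans (le_abs_self _)))
  · have h4 := hsep n (by omega)
    have h5 := le_of_separation hκ hsep (m := n + 1) (n := m) (by omega) hmn
    have h6 := neg_abs_le (μ n - μ m)
    linarith

end Asymptotics

/-! ### Assembly of the perturbation theorem. -/

section Main

variable {H : Type*} [NormedAddCommGroup H] [InnerProductSpace ℂ H] [CompleteSpace H]
  {V : Submodule ℂ H} {a : V →ₗ[ℂ] V →ₗ⋆[ℂ] ℂ} {μ β : ℕ → ℝ} {ψ : HilbertBasis ℕ ℂ H}
  {J : V ≃ₗ[ℂ] H} {K : H →L[ℂ] H} {κ γ M m : ℝ} {N₀ : ℕ}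

/-- Perturbations of an operator with separated eigenvalues by forms with small matrix elements. -/
theorem IsEnergyMap.exists_isPerturbedRootSystem (hV : Dense (V : Set H))
    (ha : IsHermitianPosDef a) (hJ : IsEnergyMap a μ ψ J) (hψV : ∀ k, ψ k ∈ V)
    (hm : 0 < m) (hμ : ∀ k, m ≤ μ k) (hlim : Tendsto μ atTop atTop)
    (hκ : 0 < κ) (hsep : ∀ k, N₀ ≤ k → κ * ((k : ℝ) + 1) ^ (γ - 1) ≤ μ (k + 1) - μ k)
    (hK : IsCompactOperator K)
    (hKt : ∀ ε > 0, ∃ N, ∀ x, (∀ k < N, coef ψ k x = 0) → ‖K x‖ ≤ ε * ‖x‖)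
    (hM : 0 < M) (hβ : ∀ k, 0 < β k)
    (hB : ∀ l m, ‖operatorForm J K ⟨ψ l, hψV l⟩ ⟨ψ m, hψV m⟩‖ ≤ M * (β l * β m))
    (hiso : ∀ᶠ n in atTop, IsIsolatedIndex μ β M n) (herr : Summable (eigenvectorError μ β M))
    (hbox : ∀ᶠ n in atTop, ∀ z : ℂ, ‖z - μ n‖ ≤ 2 * M * β n ^ 2 → z ∈ box κ γ μ n) :
    (∃ (lam : ℕ → ℂ) (φ : ℕ → H), IsPerturbedRootSystem (formOperator (a + operatorForm J K))
      κ γ μ ψ lam φ) ∧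
    ∀ (lam : ℕ → ℂ) (φ : ℕ → H), IsPerturbedRootSystem (formOperator (a + operatorForm J K))
      κ γ μ ψ lam φ → Summable fun n => ‖ψ n - φ n‖ ^ 2 := by
  have hμ0 : ∀ k, 0 < μ k := fun k => hm.trans_le (hμ k)
  obtain ⟨G, hGc, hGJ, hG⟩ := hJ.exists_inverse hm hμ hlim
  obtain ⟨R, x, hRc, hR⟩ := hJ.exists_resolvent hμ0 hGc hGJ hG K hK hKt
  have htail := (tendsto_sum_nat_add (eigenvectorError μ β M)).eventually (gt_mem_nhds one_pos)
  obtain ⟨N, hN⟩ := eventually_atTop.1 (hiso.and (hbox.and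
    ((herr.tendsto_atTop_zero.eventually (ge_mem_nhds (show (0 : ℝ) < 1 / 4 by norm_num))).and
      (htail.and (eventually_ge_atTop N₀)))))
  -- The values for `n < N` are irrelevant and set to zero; the Jordan basis of the annihilator
  -- takes these places.
  have hex : ∀ n, ∃ (lam : ℂ) (φ φ' : H), N ≤ n → ‖lam - μ n‖ ≤ 2 * M * β n ^ 2 ∧
      IsImage (formOperator (a + operatorForm J K)) φ (lam • φ) ∧
      (∀ u f, IsImage (formOperator (a + operatorForm J K)) u f →
        inner ℂ φ' f = lam * inner ℂ φ' u) ∧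
      inner ℂ φ' φ = 1 ∧ inner ℂ φ' (ψ n) = 1 ∧
      ‖φ - ψ n‖ ^ 2 ≤ 16 * eigenvectorError μ β M n ∧
      ‖φ' - ψ n‖ ^ 2 ≤ eigenvectorError μ β M n := fun n => by
    by_cases hn : N ≤ n
    · obtain ⟨lam, φ, φ', h⟩ := hJ.exists_perturbedPair hV ha hμ0 hGJ hG hψV hM hβ hB
        (hN n hn).1 (hN n hn).2.2.1
      exact ⟨lam, φ, φ', fun _ => h⟩
    · exact ⟨0, 0, 0, fun h => absurd h hn⟩
  choose lam φ φ' hp using hex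
  have hlam : ∀ n, N ≤ n → lam n ∈ box κ γ μ n := fun n hn => (hN n hn).2.1 _ (hp n hn).1
  have hN₀ : N₀ ≤ N := (hN N le_rfl).2.2.2.2
  have hbi : IsBiorthogonalSystem (formOperator (a + operatorForm J K)) R x N lam φ φ' := by
    refine ⟨hRc, fun u f => ?_, fun n hn => (hp n hn).2.1, fun n hn => (hp n hn).2.2.1,
      fun n hn => (hp n hn).2.2.2.1, fun k n hk hn hkn => ?_⟩
    · exact (mem_graph_formOperator_iff hV _ u f).trans (hR u f)
    · by_contra hne
      refine not_mem_closedBox_of_mem_box hκ hsep (hN₀.trans hk) (hN₀.trans hn) hne (hlam k hk) ?_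
      rw [hkn]
      exact box_subset_closedBox n (hlam n hn)
  have herrN := (summable_nat_add_iff N).2 herr
  have hle := fun k => (hp (k + N) (Nat.le_add_left _ _)).2.2.2.2.2
  have hs := Summable.of_nonneg_of_le (fun k => sq_nonneg _) (fun k => (hle k).2) herrN
  exact hbi.exists_isPerturbedRootSystem hs
    ((hs.tsum_le_tsum (fun k => (hle k).2) herrN).trans_lt (hN N le_rfl).2.2.2.1)
    (Summable.of_nonneg_of_le (fun k => sq_nonneg _) (fun k => (hle k).1) (herrN.mul_left 16))
    (fun n hn => (hp n hn).2.2.2.2.1) hlam hN₀ hκ hsep hlim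

end Main

end FormPerturbation

theorem mainTheorem7 {H : Type*} [NormedAddCommGroup H] [InnerProductSpace ℂ H] [CompleteSpace H]
    -- the closed Hermitian positive-definite form `a` with dense domain `V`
    (V : Submodule ℂ H) (hV : Dense (V : Set H))
    (a : V →ₗ[ℂ] V →ₗ⋆[ℂ] ℂ) (ha : FormPerturbation.IsHermitianPosDef a)
    (hac : FormPerturbation.IsClosedForm a)
    -- the eigenpairs of the operator of `a`, with an orthonormal basis of eigenvectors
    (μ : ℕ → ℝ) (ψ : HilbertBasis ℕ ℂ H)
    (hψ : ∀ k, FormPerturbation.IsEigenvector (FormPerturbation.formOperator a) (μ k) (ψ k))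
    -- the form `b`, whose domain contains the eigenvectors
    (D : Submodule ℂ H) (hDV : D ≤ V) (hψD : ∀ k, ψ k ∈ D)
    (b : D →ₗ[ℂ] D →ₗ⋆[ℂ] ℂ)
    -- eigenvalue separation (index `k` stands for the `(k+1)`-st eigenpair)
    (γ κ : ℝ) (hγ : 0 < γ) (hκ : 0 < κ) (N₀ : ℕ)
    (hsep : ∀ k, N₀ ≤ k → κ * ((k : ℝ) + 1) ^ (γ - 1) ≤ μ (k + 1) - μ k)
    -- local form-subordination
    (α M : ℝ) (hM : 0 < M)
    (hsub : ∀ m n, ‖b ⟨ψ m, hψD m⟩ ⟨ψ n, hψD n⟩‖ ≤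
      M / (((m : ℝ) + 1) ^ α * ((n : ℝ) + 1) ^ α))
    (hα : (α ≤ 1 ∧ 3 / 2 < 2 * α + γ) ∨ (1 < α ∧ 1 < 2 * α + γ)) :
    -- `b` extends uniquely by continuity from the span of the eigenvectors to `V`, and
    (∃! c : V →ₗ[ℂ] V →ₗ⋆[ℂ] ℂ, FormPerturbation.IsContinuousExtension a hDV b
      (Submodule.span ℂ (Set.range ψ)) c) ∧
    ∀ c : V →ₗ[ℂ] V →ₗ⋆[ℂ] ℂ, FormPerturbation.IsContinuousExtension a hDV b
        (Submodule.span ℂ (Set.range ψ)) c →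
      -- the extension is one of `b` itself if `b` is continuous on its domain,
      (FormPerturbation.IsEnergyBounded a hDV b →
        ∀ u v : D, c (Submodule.inclusion hDV u) (Submodule.inclusion hDV v) = b u v) ∧
      -- and the root vectors of the operator of `a + b` exist and are quadratically close
      -- to the eigenvectors of the operator of `a`
      (∃ (lam : ℕ → ℂ) (φ : ℕ → H), FormPerturbation.IsPerturbedRootSystem
        (FormPerturbation.formOperator (a + c)) κ γ μ ψ lam φ) ∧
      ∀ (lam : ℕ → ℂ) (φ : ℕ → H), FormPerturbation.IsPerturbedRootSystem
        (FormPerturbation.formOperator (a + c)) κ γ μ ψ lam φ →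
        Summable fun n => ‖ψ n - φ n‖ ^ 2 := by
  -- Replacing `α` by `min α (3 / 4)` weakens the matrix bound, as `k + 1 ≥ 1`. When `α > 3 / 4`,
  -- the condition on `α'` reduces to `γ > 0`.
  obtain ⟨α', hα', hδ, hsub'⟩ : ∃ α' ≤ (3 / 4 : ℝ), 3 / 2 < 2 * α' + γ ∧
      ∀ m n, ‖b ⟨ψ m, hψD m⟩ ⟨ψ n, hψD n⟩‖ ≤
        M * (((m : ℝ) + 1) ^ (-α') * ((n : ℝ) + 1) ^ (-α')) := by
    have hb : ∀ m n, ‖b ⟨ψ m, hψD m⟩ ⟨ψ n, hψD n⟩‖ ≤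
        M * (((m : ℝ) + 1) ^ (-α) * ((n : ℝ) + 1) ^ (-α)) := fun m n => by
      refine (hsub m n).trans_eq ?_
      rw [Real.rpow_neg (by positivity), Real.rpow_neg (by positivity), div_eq_mul_inv, mul_inv]
    rcases le_or_gt α (3 / 4) with h | h
    · refine ⟨α, h, ?_, hb⟩
      rcases hα with h1 | h1
      · exact h1.2
      · linarith
    · refine ⟨3 / 4, le_rfl, by linarith, fun m n => (hb m n).trans ?_⟩
      have hle : ∀ k : ℕ, ((k : ℝ) + 1) ^ (-α) ≤ ((k : ℝ) + 1) ^ (-(3 / 4) : ℝ) := fun k =>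
        Real.rpow_le_rpow_of_exponent_le (by have := k.cast_nonneg (α := ℝ); linarith) (by linarith)
      exact mul_le_mul_of_nonneg_left
        (mul_le_mul (hle m) (hle n) (by positivity) (by positivity)) hM.le
  have hψV : ∀ k, ψ k ∈ V := fun k => hDV (hψD k)
  have hψa : ∀ k v, a ⟨ψ k, hψV k⟩ v = μ k * inner ℂ (v : H) (ψ k) := fun k v => by
    obtain ⟨hk, h⟩ := (FormPerturbation.mem_graph_formOperator_iff hV a _ _).1 (hψ k).2
    rw [h v, inner_smul_right]
  have hμ0 := FormPerturbation.eigenvalue_pos ha hψV hψa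
  obtain ⟨c₁, hc₁, N₁, -, h₁⟩ := FormPerturbation.exists_separation hγ hκ hsep
  obtain ⟨c₂, hc₂, hgrow⟩ := FormPerturbation.exists_growth hc₁ hμ0 h₁
  have hμ : ∀ k, c₂ ≤ μ k := fun k => by
    refine le_trans (le_mul_of_one_le_right hc₂.le ?_) (hgrow k)
    exact Real.one_le_rpow (by have := k.cast_nonneg (α := ℝ); linarith) hγ.le
  have hlim : Filter.Tendsto μ Filter.atTop Filter.atTop :=
    Filter.tendsto_atTop_mono hgrow (((tendsto_rpow_atTop hγ).comp
      (Filter.tendsto_atTop_add_const_right _ 1 tendsto_natCast_atTop_atTop)).const_mul_atTop hc₂)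
  obtain ⟨J, hJ⟩ := FormPerturbation.exists_isEnergyMap ha hψV hψa hac hc₂ hμ
  -- By the growth of `μ` the terms are of order `(k + 1) ^ (-(2 * α' + γ))` at most; this makes `K`
  -- Hilbert-Schmidt and needs only `2 * α' + γ > 1`.
  have hβμ : Summable fun k : ℕ => (((k : ℝ) + 1) ^ (-α')) ^ 2 / μ k := by
    refine Summable.of_nonneg_of_le (fun k => div_nonneg (sq_nonneg _) (hμ0 k).le) (fun k => ?_)
      ((FormPerturbation.summable_succ_rpow (s := 2 * α' + γ) (by linarith)).mul_left c₂⁻¹)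
    have hp : (0 : ℝ) < (k : ℝ) + 1 := by positivity
    calc _ ≤ (((k : ℝ) + 1) ^ (-α')) ^ 2 / (c₂ * ((k : ℝ) + 1) ^ γ) := by
          gcongr
          exact hgrow k
      _ = _ := by
          rw [FormPerturbation.sq_succ_rpow_neg, neg_add, Real.rpow_add hp, Real.rpow_neg hp.le γ]
          field_simp
  obtain ⟨K, hK, hKt, hext⟩ := hJ.exists_continuousExtension hμ0 hDV hψD b hβμ hsub'
  have huniq : ∀ c, FormPerturbation.IsContinuousExtension a hDV b
      (Submodule.span ℂ (Set.range ψ)) c → c = FormPerturbation.operatorForm J K := fun c hc =>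
    hJ.continuousExtension_unique hDV hψD hc hext
  refine ⟨⟨_, hext, huniq⟩, fun c hc => ⟨hJ.continuousExtension_eq_of_bounded hDV hψD hc, ?_⟩⟩
  obtain rfl := huniq c hc
  have hmem : ∀ k, ψ k ∈ Submodule.span ℂ (Set.range ψ) := fun k => Submodule.subset_span ⟨k, rfl⟩
  obtain ⟨hiso, herr⟩ := FormPerturbation.eventually_isIsolatedIndex hγ hκ hsep hα' hδ M
  refine hJ.exists_isPerturbedRootSystem hV ha hψV hc₂ hμ hlim hκ hsep hK hKt hM
    (fun k => by positivity) (fun l m => ?_) hiso herr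
    (FormPerturbation.eventually_mem_box (by linarith) hκ (2 * M))
  have h := hext.extends_form ⟨ψ l, hψD l⟩ ⟨ψ m, hψD m⟩ (hmem l) (hmem m)
  exact (congrArg norm h).trans_le (hsub' l m)
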